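/- Let $M$ be a smooth $5$-manifold and $\mathcal H=T^{-1}M\subset TM$ a generic rank-$2$ distribution, i.e. a smooth rank-$2$ subbundle such that at each point the values of iterated Lie brackets of at most three local sections of $\mathcal H$ span the tangent space. Let $T^{-2}M=[\mathcal H,\mathcal H]$ be the rank-$3$ subbundle spanned by local sections of $\mathcal H$ and their Lie brackets, put $\operatorname{gr}_{-2}=T^{-2}M/T^{-1}M$ and $\operatorname{gr}_{-3}=TM/T^{-2}M$ with quotient maps $q_{-2},q_{-3}$, and let $\{\ ,\ \}$ be the Levi bracket, induced by the Lie bracket: $\{\xi,\eta\}=q_{-2}([\xi,\eta])$, $\{\xi,q_{-2}(\zeta)\}=q_{-3}([\xi,\zeta])=-\{q_{-2}(\zeta),\xi\}$ for $\xi,\eta\in\Gamma(\mathcal H)$, $\zeta\in\Gamma(T^{-2}M)$. A generalized contact form is a smooth section $\alpha$ of $(T^{-2}M)^*$ whose kernel at each point $x$ is $\mathcal H_x$. Given a generalized contact form $\alpha$, one has the following objects (Greek letters $\xi,\eta,\gamma$ denote local sections of $\mathcal H$). * A section $r$ of $T^{-2}M$ with $q_{-2}(r)$ nowhere zero defines a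 partial connection on $\mathcal H$ by $\nabla_\xi\eta\in\Gamma(\mathcal H)$, $\{\nabla_\xi\eta,q_{-2}(r)\}=q_{-3}([\xi,[\eta,r]])$, and an induced one on $\operatorname{gr}_{-2}$ by $\nabla_\gamma\{\xi,\eta\}=\{\nabla_\gamma\xi,\eta\}+\{\xi,\nabla_\gamma\eta\}$. The generalized Reeb field is the section $r$ with $\alpha(r)=1$ such that $q_{-2}(r)$ is parallel for the partial connection determined by $r$ itself. From now on $r$ and $\nabla$ refer to this choice. * The canonical extension, again denoted $\alpha$, is the one-form on $M$ extending $\alpha$ with $i_r d\alpha|_{\mathcal H}=0$. Here $d\alpha(X,Y)=X\alpha(Y)-Y\alpha(X)-\alpha([X,Y])$. * Operators $\Phi,\Psi$ on $\Gamma(\mathcal H)$ are defined by $\nabla_\xi\nabla_\eta\gamma-\nabla_\eta\nabla_\xi\gamma-\nabla_{[\xi,\eta]-\alpha([\xi,\eta])r}\gamma=\alpha([\xi,\eta])\,\Phi(\gamma)$ and $\{\Psi(\gamma),q_{-2}(r)\}=\tfrac12 q_{-3}([r,[\gamma,r]])$. * For a vector field $\zeta$, let $\zeta_1\in\Gamma(\mathcal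 H)$ be the section with $q_{-3}(\zeta)=\{q_{-2}(r),\zeta_1\}$, let $\zeta_2=\zeta-[r,\zeta_1]-\alpha(\zeta)r\in\Gamma(\mathcal H)$, and put $\pi_{-1}(\zeta)=-\tfrac25\Phi(\zeta_1)+\tfrac75\Psi(\zeta_1)+\zeta_2$. * Finally $g_\alpha(\zeta,\zeta')=d\alpha(\zeta_1,\pi_{-1}(\zeta'))-\tfrac43\alpha(\zeta)\alpha(\zeta')+d\alpha(\zeta'_1,\pi_{-1}(\zeta))$. **Theorem.** 1. For every generalized contact form $\alpha$, the generalized Reeb field exists and is unique, the canonical extension exists and is unique, and the last formula defines a unique tensor field $g_\alpha$ on $M$. It is a smooth pseudo-Riemannian metric of signature $(2,3)$ (two positive, three negative directions). 2. For every generalized contact form $\alpha$ and every $f\in C^\infty(M,\mathbb R)$, the section $\hat\alpha=e^f\alpha$ is a generalized contact form and $$g_{\hat\alpha}=e^{2f}g_\alpha .$$ 3. For any two generalized contact forms $\alpha,\beta$ for $\mathcal H$, the metrics $g_\alpha$ and $g_\beta$ have the same conformal class, where the conformal class of $g$ consists of all $u\,g$ with $u\in C^\infty(M,\mathbb R)$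 positive. Thus $[g_\alpha]$ depends only on $\mathcal H$. -/

import Mathlib

open scoped Manifold ContDiff Topology
open Bundle VectorField

noncomputable section

namespace GenericRankTwo

/-- The model space `ℝ⁵`. -/
abbrev E5 : Type := EuclideanSpace ℝ (Fin 5)

/-- Not necessarily continuous vector fields on a 5-manifold. Smoothness is always imposed
separately, near the points where it matters; the operators below only see germs. -/
abbrev VField (M : Type*) [TopologicalSpace M] [ChartedSpace E5 M] : Type _ :=
  (x : M) → TangentSpace (𝓡 5) x

/-- A family of linear subspaces of the tangent spaces. -/
abbrev Distrib (M : Type*) [TopologicalSpace M] [ChartedSpace E5 M] : Type _ :=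
  (x : M) → Submodule ℝ (TangentSpace (𝓡 5) x)

/-- A (not necessarily continuous) field of linear forms on the tangent spaces. -/
abbrev OneForm (M : Type*) [TopologicalSpace M] [ChartedSpace E5 M] : Type _ :=
  (x : M) → (TangentSpace (𝓡 5) x →L[ℝ] ℝ)

/-- A (not necessarily continuous) field of bilinear forms on the tangent spaces. -/
abbrev BilinField (M : Type*) [TopologicalSpace M] [ChartedSpace E5 M] : Type _ :=
  (x : M) → (TangentSpace (𝓡 5) x →L[ℝ] TangentSpace (𝓡 5) x →L[ℝ] ℝ)

section Sections

variable {M : Type*} [TopologicalSpace M] [ChartedSpace E5 M] [IsManifold (𝓡 5) ∞ M]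

/-- `V` restricts to a smooth section of `D` over the set `U`. -/
def IsSectionOn (D : Distrib M) (U : Set M) (V : VField M) : Prop :=
  ContMDiffOn (𝓡 5) (𝓡 5).tangent ∞ (fun y => (⟨y, V y⟩ : TangentBundle (𝓡 5) M)) U ∧
    ∀ y ∈ U, V y ∈ D y

/-- `V` is a local smooth section of `D`, defined on some open neighbourhood of `x`. -/
def IsLocalSection (D : Distrib M) (x : M) (V : VField M) : Prop :=
  ∃ U : Set M, IsOpen U ∧ x ∈ U ∧ IsSectionOn D U V

/-- `V` is a smooth vector field on some open neighbourhood of `x`. -/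
def IsLocalVField (x : M) (V : VField M) : Prop :=
  IsLocalSection (fun y => (⊤ : Submodule ℝ (TangentSpace (𝓡 5) y))) x V

/-- `H` is a smooth subbundle of rank two of the tangent bundle: it has smooth local frames. -/
def IsSmoothRankTwo (H : Distrib M) : Prop :=
  ∀ x : M, ∃ (U : Set M) (ξ η : VField M), IsOpen U ∧ x ∈ U ∧
    IsSectionOn H U ξ ∧ IsSectionOn H U η ∧
    ∀ y ∈ U, LinearIndependent ℝ ![ξ y, η y] ∧ H y = Submodule.span ℝ {ξ y, η y}

/-- The values at `x` of local sections of `H`. -/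
def sectionValues (H : Distrib M) (x : M) : Set (TangentSpace (𝓡 5) x) :=
  {v | ∃ V : VField M, IsLocalSection H x V ∧ v = V x}

/-- The values at `x` of brackets of two local sections of `H`. -/
def bracketValues (H : Distrib M) (x : M) : Set (TangentSpace (𝓡 5) x) :=
  {v | ∃ V W : VField M, IsLocalSection H x V ∧ IsLocalSection H x W ∧
    v = mlieBracket (𝓡 5) V W x}

/-- The values at `x` of iterated brackets of three local sections of `H`. -/
def tripleBracketValues (H : Distrib M) (x : M) : Set (TangentSpace (𝓡 5) x) :=
  {v | ∃ V W Z : VField M, IsLocalSection H x V ∧ IsLocalSection H x W ∧ IsLocalSection H x Z ∧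
    v = mlieBracket (𝓡 5) V (mlieBracket (𝓡 5) W Z) x}

/-- `T⁻²M = [H, H]`, spanned by local sections of `H = T⁻¹M` and their brackets. -/
def derived (H : Distrib M) : Distrib M := fun x =>
  Submodule.span ℝ (sectionValues H x ∪ bracketValues H x)

/-- A generic rank two distribution on a 5-manifold: iterated brackets of at most three sections
span every tangent space. -/
def IsGeneric (H : Distrib M) : Prop :=
  IsSmoothRankTwo H ∧ ∀ x : M,
    Submodule.span ℝ (sectionValues H x ∪ bracketValues H x ∪ tripleBracketValues H x) = ⊤

/-! ### The Levi bracket -/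

/-- For tangent vectors `v ∈ D x`, `w ∈ E x`, the class of `[V, W](x)` modulo `F x`, where `V`, `W`
are any local sections of `D`, `E` through `v`, `w`. It is used only where this class does not
depend on `V`, `W`. -/
def bracketMod (D E F : Distrib M) (x : M) (v w : TangentSpace (𝓡 5) x) :
    TangentSpace (𝓡 5) x ⧸ F x :=
  Classical.epsilon fun c => ∀ V W : VField M, IsLocalSection D x V → IsLocalSection E x W →
    V x = v → W x = w → c = (F x).mkQ (mlieBracket (𝓡 5) V W x)

/-- The quotient map `q₋₂ : T⁻²M → gr₋₂(TM) = T⁻²M / T⁻¹M`; the quotient `gr₋₂(TM)` is regarded as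
a subspace of `TM / T⁻¹M`. -/
def q2 (H : Distrib M) (x : M) (v : TangentSpace (𝓡 5) x) : TangentSpace (𝓡 5) x ⧸ H x :=
  (H x).mkQ v

/-- The quotient map `q₋₃ : TM → gr₋₃(TM) = TM / T⁻²M`. -/
def q3 (H : Distrib M) (x : M) (v : TangentSpace (𝓡 5) x) :
    TangentSpace (𝓡 5) x ⧸ derived H x :=
  (derived H x).mkQ v

/-- The Levi bracket `{v, w} ∈ gr₋₂(TM)` of `v, w ∈ T⁻¹M`. -/
def levi11 (H : Distrib M) (x : M) (v w : TangentSpace (𝓡 5) x) :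
    TangentSpace (𝓡 5) x ⧸ H x :=
  bracketMod H H H x v w

/-- The Levi bracket `{v, q₋₂(w)} ∈ gr₋₃(TM)` of `v ∈ T⁻¹M` and the class of `w ∈ T⁻²M`. -/
def levi12 (H : Distrib M) (x : M) (v w : TangentSpace (𝓡 5) x) :
    TangentSpace (𝓡 5) x ⧸ derived H x :=
  bracketMod H (derived H) (derived H) x v w

/-- The Levi bracket `{q₋₂(w), v} ∈ gr₋₃(TM)` of the class of `w ∈ T⁻²M` and `v ∈ T⁻¹M`. -/
def levi21 (H : Distrib M) (x : M) (w v : TangentSpace (𝓡 5) x) :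
    TangentSpace (𝓡 5) x ⧸ derived H x :=
  bracketMod (derived H) H (derived H) x w v

/-! ### Generalized contact forms, partial connections and Reeb fields -/

/-- A field of linear forms on `T⁻²M`. -/
abbrev PartialForm (H : Distrib M) : Type _ := (x : M) → Module.Dual ℝ (derived H x)

open scoped Classical in
/-- The function `α(V)`, for `V` with values in `T⁻²M` (and zero where `V` is not in `T⁻²M`). -/
def PartialForm.eval {H : Distrib M} (α : PartialForm H) (V : VField M) (x : M) : ℝ :=
  if h : V x ∈ derived H x then α x ⟨V x, h⟩ else 0

/-- A generalized contact form: a smooth section of `(T⁻²M)*` with kernel `T⁻¹M` everywhere. -/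
def IsContactForm (H : Distrib M) (α : PartialForm H) : Prop :=
  (∀ (U : Set M) (V : VField M), IsOpen U → IsSectionOn (derived H) U V →
    ContMDiffOn (𝓡 5) 𝓘(ℝ, ℝ) ∞ (α.eval V) U) ∧
  ∀ x : M, LinearMap.ker (α x) = (H x).submoduleOf (derived H x)

/-- The rescaled form `e^f α`. -/
def expSmul {H : Distrib M} (f : M → ℝ) (α : PartialForm H) : PartialForm H :=
  fun x => Real.exp (f x) • α x

/-- The partial connection on `T⁻¹M` determined by a section `r` of `T⁻²M`:
`{∇_ξ η, q₋₂(r)} = q₋₃([ξ, [η, r]])` with `∇_ξ η` in `T⁻¹M`. -/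
def nabla (H : Distrib M) (r ξ η : VField M) : VField M := fun x =>
  Classical.epsilon fun v => v ∈ H x ∧
    levi12 H x v (r x) =
      q3 H x (mlieBracket (𝓡 5) ξ (mlieBracket (𝓡 5) η r) x)

/-- The induced partial connection on `gr₋₂(TM)`: if `σ = {ξ, η}` near `x` for local sections
`ξ, η` of `T⁻¹M`, then `∇_γ σ = {∇_γ ξ, η} + {ξ, ∇_γ η}` at `x`. -/
def nablaGr (H : Distrib M) (r γ : VField M) (σ : (x : M) → TangentSpace (𝓡 5) x ⧸ H x) (x : M) :
    TangentSpace (𝓡 5) x ⧸ H x :=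
  Classical.epsilon fun c => ∀ ξ η : VField M, IsLocalSection H x ξ → IsLocalSection H x η →
    (∀ᶠ y in 𝓝 x, σ y = levi11 H y (ξ y) (η y)) →
    c = levi11 H x (nabla H r γ ξ x) (η x) + levi11 H x (ξ x) (nabla H r γ η x)

/-- `r` is a generalized Reeb field of `α`: a smooth section of `T⁻²M` with `α(r) = 1` such that
`q₋₂(r)` is parallel for the partial connection determined by `r`. -/
def IsReebField (H : Distrib M) (α : PartialForm H) (r : VField M) : Prop :=
  IsSectionOn (derived H) Set.univ r ∧
  (∀ x : M, α.eval r x = 1) ∧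
  ∀ (x : M) (γ : VField M), IsLocalSection H x γ → nablaGr H r γ (fun y => q2 H y (r y)) x = 0

/-- The generalized Reeb field of a generalized contact form. -/
def reebField (H : Distrib M) (α : PartialForm H) : VField M :=
  Classical.epsilon fun r => IsReebField H α r

/-! ### The canonical extension -/

/-- The exterior derivative of a one-form on two vector fields:
`dθ(X, Y) = X(θ(Y)) - Y(θ(X)) - θ([X, Y])`. -/
def dOne (θ : OneForm M) (X Y : VField M) (x : M) : ℝ :=
  mvfderiv (𝓡 5) (fun y => θ y (Y y)) x (X x) - mvfderiv (𝓡 5) (fun y => θ y (X y)) x (Y x)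
    - θ x (mlieBracket (𝓡 5) X Y x)

/-- Smoothness of a one-form, as a section of the cotangent bundle. -/
def IsSmoothOneForm (θ : OneForm M) : Prop :=
  ContMDiff (𝓡 5) ((𝓡 5).prod 𝓘(ℝ, E5 →L[ℝ] ℝ)) ∞
    (fun x => TotalSpace.mk' (E5 →L[ℝ] ℝ) (E := fun y : M => TangentSpace (𝓡 5) y →L[ℝ] ℝ) x (θ x))

/-- `θ` is a smooth one-form on `M` which extends `α` and satisfies `i_r dθ = 0` on `T⁻¹M`. -/
def IsCanonicalExtension (H : Distrib M) (α : PartialForm H) (r : VField M) (θ : OneForm M) :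
    Prop :=
  IsSmoothOneForm θ ∧
  (∀ (x : M) (v : derived H x), θ x v = α x v) ∧
  ∀ (x : M) (γ : VField M), IsLocalSection H x γ → dOne θ r γ x = 0

/-- The canonical extension of a generalized contact form to a one-form on `M`. -/
def extension (H : Distrib M) (α : PartialForm H) : OneForm M :=
  Classical.epsilon fun θ => IsCanonicalExtension H α (reebField H α) θ

/-! ### The operators `Φ`, `Ψ`, the projection `π₋₁`, and the metric -/

/-- `[ξ, η] - α([ξ, η]) r`. -/
def bracketProj (H : Distrib M) (α : PartialForm H) (ξ η : VField M) : VField M := fun x =>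
  mlieBracket (𝓡 5) ξ η x - extension H α x (mlieBracket (𝓡 5) ξ η x) • reebField H α x

/-- The operator `Φ` on sections of `T⁻¹M`, characterized by
`∇_ξ ∇_η γ - ∇_η ∇_ξ γ - ∇_{[ξ, η] - α([ξ, η]) r} γ = α([ξ, η]) Φ(γ)`. -/
def Phi (H : Distrib M) (α : PartialForm H) (γ : VField M) : VField M := fun x =>
  Classical.epsilon fun v => v ∈ H x ∧
    ∀ ξ η : VField M, IsLocalSection H x ξ → IsLocalSection H x η →
      nabla H (reebField H α) ξ (nabla H (reebField H α) η γ) x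
        - nabla H (reebField H α) η (nabla H (reebField H α) ξ γ) x
        - nabla H (reebField H α) (bracketProj H α ξ η) γ x
      = extension H α x (mlieBracket (𝓡 5) ξ η x) • v

/-- The operator `Ψ` on sections of `T⁻¹M`, characterized by
`{Ψ(γ), q₋₂(r)} = 1/2 q₋₃([r, [γ, r]])`. -/
def Psi (H : Distrib M) (α : PartialForm H) (γ : VField M) : VField M := fun x =>
  Classical.epsilon fun v => v ∈ H x ∧
    levi12 H x v (reebField H α x) =
      (1 / 2 : ℝ) • q3 H x (mlieBracket (𝓡 5) (reebField H α)
        (mlieBracket (𝓡 5) γ (reebField H α)) x)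

/-- The component `ζ₁` in `T⁻¹M`, characterized by `q₋₃(ζ) = {q₋₂(r), ζ₁}`. -/
def zeta1 (H : Distrib M) (α : PartialForm H) (ζ : VField M) : VField M := fun x =>
  Classical.epsilon fun v => v ∈ H x ∧ q3 H x (ζ x) = levi21 H x (reebField H α x) v

/-- The component `ζ₂ = ζ - [r, ζ₁] - α(ζ) r`. -/
def zeta2 (H : Distrib M) (α : PartialForm H) (ζ : VField M) : VField M := fun x =>
  ζ x - mlieBracket (𝓡 5) (reebField H α) (zeta1 H α ζ) x
    - extension H α x (ζ x) • reebField H α x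

/-- The projection `π₋₁(ζ) = -2/5 Φ(ζ₁) + 7/5 Ψ(ζ₁) + ζ₂`. -/
def piMinusOne (H : Distrib M) (α : PartialForm H) (ζ : VField M) : VField M := fun x =>
  (-2 / 5 : ℝ) • Phi H α (zeta1 H α ζ) x + (7 / 5 : ℝ) • Psi H α (zeta1 H α ζ) x + zeta2 H α ζ x

/-- `dα(ζ₁, π₋₁(ζ')) - 4/3 α(ζ) α(ζ') + dα(ζ'₁, π₋₁(ζ))` at the point `x`. -/
def metricFormula (H : Distrib M) (α : PartialForm H) (ζ ζ' : VField M) (x : M) : ℝ :=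
  dOne (extension H α) (zeta1 H α ζ) (piMinusOne H α ζ') x
    - (4 / 3 : ℝ) * (extension H α x (ζ x) * extension H α x (ζ' x))
    + dOne (extension H α) (zeta1 H α ζ') (piMinusOne H α ζ) x

/-- `g` is the tensor whose value on local vector fields is given by the metric formula. -/
def IsAssociatedMetric (H : Distrib M) (α : PartialForm H) (g : BilinField M) : Prop :=
  ∀ (x : M) (ζ ζ' : VField M), IsLocalVField x ζ → IsLocalVField x ζ' →
    g x (ζ x) (ζ' x) = metricFormula H α ζ ζ' x

/-- The metric `g_α` associated to a generalized contact form `α`. -/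
def metric (H : Distrib M) (α : PartialForm H) : BilinField M :=
  Classical.epsilon fun g => IsAssociatedMetric H α g

/-- Smoothness of a field of bilinear forms. -/
def IsSmoothBilin (g : BilinField M) : Prop :=
  ContMDiff (𝓡 5) ((𝓡 5).prod 𝓘(ℝ, E5 →L[ℝ] E5 →L[ℝ] ℝ)) ∞
    (fun x => TotalSpace.mk' (E5 →L[ℝ] E5 →L[ℝ] ℝ)
      (E := fun y : M => TangentSpace (𝓡 5) y →L[ℝ] TangentSpace (𝓡 5) y →L[ℝ] ℝ) x (g x))

/-- `g` is a pseudo-Riemannian metric of signature `(2, 3)`: smooth, symmetric, and at each point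
there is an orthogonal basis with `g(bᵢ, bᵢ)` equal to `1` twice and to `-1` three times. -/
def IsMetricTwoThree (g : BilinField M) : Prop :=
  IsSmoothBilin g ∧
  (∀ (x : M) (v w : TangentSpace (𝓡 5) x), g x v w = g x w v) ∧
  ∀ x : M, ∃ b : Module.Basis (Fin 5) ℝ (TangentSpace (𝓡 5) x), ∀ i j : Fin 5,
    g x (b i) (b j) = if i = j then (if i < 2 then 1 else -1) else 0

/-- The conformal class of `g`: all multiples of `g` by positive smooth functions. -/
def conformalClass (g : BilinField M) : Set (BilinField M) :=
  {g' | ∃ u : M → ℝ, ContMDiff (𝓡 5) 𝓘(ℝ, ℝ) ∞ u ∧ (∀ x, 0 < u x) ∧ ∀ x, g' x = u x • g x}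

end Sections

end GenericRankTwo

end

noncomputable section

namespace GenericRankTwo

open LieRinehartRing TopologicalSpace

/-! ### Reeb data in a Lie-Rinehart algebra -/

section Algebra

set_option linter.unusedSectionVars false

variable {A L : Type*} [CommRing A] [LieRing L] [Module A L] [LieRingModule L A]
  [LieRinehartRing A L]

/-! The local content is pure algebra in the Lie-Rinehart pair of smooth functions `A` and vector
fields `L` on an open set. Given a section `r` of T⁻² transverse to H, every field is uniquely [r,
ζ₁] + α(ζ) r + ζ₂ with ζ₁, ζ₂ in H; a `ReebDatum` records this splitting. The partial connection
becomes z[ξ, [r, η]] and twice Ψ becomes z[r, [r, γ]]. By Jacobi the connection is torsion free up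
to a multiple of r (`lie_eq`), so its curvature expression is bilinear and alternating in two
arguments; as H has rank two, it is α([ξ, η]) times one operator Φ (`curv_eq`). None of Φ, Ψ, ζ₂ is
tensorial: replacing ζ by aζ produces the extra terms r(a)ζ₁, r(a)ζ₁ and -r(a)ζ₁. Since -2/5 + 7/5 -
1 = 0, the combination π₋₁ is tensorial. Denominators are cleared (`proj` is 10 π₋₁, `G` is 30 g),
so the algebra needs no division by integers.

Under rescaling of α by u with logarithmic derivative df, the new Reeb field is u⁻¹(r + μ) with μ in
H. Parallelism of both Reeb fields forces α([γ, μ]) = 4 γ(f) (`skew_μ`), which determines μ. Second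
derivatives of f then enter only through ∇μ and r(f), and in π₋₁ all terms ∇_γ μ and ∇_μ γ cancel
(`proj_eq`). In the metric the r(f) term dies by skew symmetry, and the coefficient -4/3 makes the
rest cancel against the change of the contact form (`G_eq`).

Adding μ in H to r, with the same class in gr₋₂, changes the trace κ of the connection by α([γ, μ]).
This pairing is nondegenerate, so exactly one translate is parallel (`parallel_of_shift`,
`eq_of_parallel`); local Reeb fields therefore exist and glue. For the signature, H is isotropic, it
has an isotropic complement inside ker π₋₁ ∩ ker α paired with it by the skew form, and r is
orthogonal to both with square -4/3: two hyperbolic planes and a negative line.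

The remaining work connects this algebra with the operators defined by `Classical.epsilon`. `Rep`
says that a field restricts to an element of `L`; each operator is shown to be represented by its
algebraic version. The epsilon conditions quantify over sections defined near one point only, so
frames and Reeb data must be compared with those on smaller open sets. -/

theorem smul_lie_eq (a : A) (x y : L) : ⁅a • x, y⁆ = a • ⁅x, y⁆ - ⁅y, a⁆ • x := by
  rw [← lie_skew, leibniz_smul_right, ← lie_skew x y]
  module

theorem lie_lie_apply (x y : L) (a : A) : ⁅⁅x, y⁆, a⁆ = ⁅x, ⁅y, a⁆⁆ - ⁅y, ⁅x, a⁆⁆ := by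
  rw [leibniz_lie x y a]; abel

theorem lie_one_eq_zero (x : L) : ⁅x, (1 : A)⁆ = 0 := by
  have h := leibniz_mul_right x (1 : A) 1
  simpa using h

theorem lie_natCast_eq_zero (x : L) (n : ℕ) : ⁅x, (n : A)⁆ = 0 := by
  induction n with
  | zero => simp
  | succ n ih => rw [Nat.cast_succ, lie_add, ih, lie_one_eq_zero, add_zero]

/-- A rank two submodule `H` of a Lie-Rinehart algebra, together with an element `r`, the
associated linear maps `z` (the component `ζ₁`) and `θ` (the contact form), and a basis of `H`
which is normalized by `θ`. -/
structure ReebDatum (H : Submodule A L) where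
  r : L
  z : L →ₗ[A] H
  θ : L →ₗ[A] A
  e₁ : H
  e₂ : H
  z_mem (h : H) : z h = 0
  z_r : z r = 0
  z_lie (h : H) : z ⁅r, (h : L)⁆ = h
  z_lie_mem (h k : H) : z ⁅(h : L), (k : L)⁆ = 0
  θ_mem (h : H) : θ h = 0
  θ_r : θ r = 1
  θ_lie (h : H) : θ ⁅r, (h : L)⁆ = 0
  mem_of_eq_zero (X : L) : z X = 0 → θ X = 0 → X ∈ H
  θ_frame : θ ⁅(e₁ : L), (e₂ : L)⁆ = 1
  expand (h : H) : h = θ ⁅(h : L), (e₂ : L)⁆ • e₁ + θ ⁅(e₁ : L), (h : L)⁆ • e₂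

namespace ReebDatum

variable {H : Submodule A L} (D : ReebDatum H)

attribute [simp] z_mem z_r z_lie z_lie_mem θ_mem θ_r θ_lie

/-- The skew form `(ξ, η) ↦ α([ξ, η])` on `H`. -/
def skew : H →ₗ[A] H →ₗ[A] A :=
  LinearMap.mk₂ A (fun ξ η => D.θ ⁅(ξ : L), (η : L)⁆) (by intros; simp)
    (by intros; simp [smul_lie_eq]) (by intros; simp) (by intros; simp)

theorem skew_apply (ξ η : H) : D.skew ξ η = D.θ ⁅(ξ : L), (η : L)⁆ := rfl

theorem skew_swap (ξ η : H) : D.skew ξ η = -D.skew η ξ := by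
  rw [skew_apply, skew_apply, ← lie_skew, map_neg]

@[simp] theorem skew_self (ξ : H) : D.skew ξ ξ = 0 := by simp [skew_apply]

@[simp] theorem skew_frame : D.skew D.e₁ D.e₂ = 1 := D.θ_frame

theorem expand_skew (h : H) : h = D.skew h D.e₂ • D.e₁ + D.skew D.e₁ h • D.e₂ := D.expand h

/-- In rank two every alternating form is a multiple of the determinant, and `skew` has the value 1
on the frame. -/
theorem skew_eq_det (ξ η : H) :
    D.skew ξ η = D.skew ξ D.e₂ * D.skew D.e₁ η - D.skew D.e₁ ξ * D.skew η D.e₂ := by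
  conv_lhs => rw [D.expand_skew ξ]
  simp only [map_add, map_smul, LinearMap.add_apply, LinearMap.smul_apply, smul_eq_mul]
  rw [D.skew_swap D.e₂ η]
  ring

/-- The component `ζ₂` in `H`. -/
def pr (X : L) : H := ⟨X - ⁅D.r, (D.z X : L)⁆ - D.θ X • D.r, D.mem_of_eq_zero _ (by simp) (by simp)⟩

theorem pr_apply (X : L) : (D.pr X : L) = X - ⁅D.r, (D.z X : L)⁆ - D.θ X • D.r := rfl

theorem decomp (X : L) : X = ⁅D.r, (D.z X : L)⁆ + D.θ X • D.r + D.pr X := by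
  rw [pr_apply]; abel

theorem pr_add (X Y : L) : D.pr (X + Y) = D.pr X + D.pr Y := by
  ext
  simp only [pr_apply, map_add, Submodule.coe_add, lie_add]
  module

/-- The derivative term comes from [r, a ζ₁]; it is the defect that `proj` has to compensate. -/
theorem pr_smul (a : A) (X : L) : D.pr (a • X) = a • D.pr X - ⁅D.r, a⁆ • D.z X := by
  ext
  simp only [pr_apply, map_smul, AddSubgroupClass.coe_sub, SetLike.val_smul, leibniz_smul_right,
    smul_eq_mul]
  module

@[simp] theorem pr_mem (h : H) : D.pr h = h := by
  ext; simp [pr_apply]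

/-- The bracket of `h : H` with an element of `T⁻²`. -/
theorem z_lie_of_z_eq_zero (h : H) {X : L} (hX : D.z X = 0) :
    D.z ⁅(h : L), X⁆ = -(D.θ X • h) := by
  have h1 := D.decomp X
  rw [hX, ZeroMemClass.coe_zero, lie_zero, zero_add] at h1
  have h2 : D.z ⁅(h : L), D.r⁆ = -h := by rw [← lie_skew, map_neg, z_lie]
  rw [h1, lie_add, leibniz_smul_right]
  simp [h2]

/-- The partial connection determined by `r`. -/
def nab (ξ η : H) : H := D.z ⁅(ξ : L), ⁅D.r, (η : L)⁆⁆

theorem nab_add_left (ξ ξ' η : H) : D.nab (ξ + ξ') η = D.nab ξ η + D.nab ξ' η := by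
  simp [nab]

theorem nab_smul_left (a : A) (ξ η : H) : D.nab (a • ξ) η = a • D.nab ξ η := by
  simp [nab, smul_lie_eq]

theorem nab_sub_left (ξ ξ' η : H) : D.nab (ξ - ξ') η = D.nab ξ η - D.nab ξ' η := by
  simp [nab]

theorem nab_add_right (ξ η η' : H) : D.nab ξ (η + η') = D.nab ξ η + D.nab ξ η' := by
  simp [nab]

theorem nab_sub_right (ξ η η' : H) : D.nab ξ (η - η') = D.nab ξ η - D.nab ξ η' := by
  simp [nab]

theorem nab_smul_right (a : A) (ξ η : H) :
    D.nab ξ (a • η) = a • D.nab ξ η + ⁅(ξ : L), a⁆ • η := by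
  simp [nab]

/-- Torsion-freeness up to r. On T⁻² the map X ↦ z[r, X] is the projection to H along r, and Jacobi
turns z[r, [ξ, η]] into a difference of covariant derivatives. -/
theorem lie_eq (ξ η : H) :
    ⁅(ξ : L), (η : L)⁆ = D.skew ξ η • D.r + (D.nab ξ η - D.nab η ξ : H) := by
  have h1 : D.z ⁅D.r, ⁅(ξ : L), (η : L)⁆⁆ = D.nab ξ η - D.nab η ξ := by
    rw [leibniz_lie D.r, ← lie_skew ⁅D.r, (ξ : L)⁆]
    simp only [map_add, map_neg, nab]
    abel
  have h2 := D.decomp ⁅(ξ : L), (η : L)⁆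
  have h3 : D.z ⁅D.r, ⁅(ξ : L), (η : L)⁆⁆ = D.pr ⁅(ξ : L), (η : L)⁆ := by
    conv_lhs => rw [h2]
    simp
  rw [← h1, h3]
  simpa [skew_apply] using h2

theorem lie_lie_eq (ξ η : H) (f : A) :
    ⁅(ξ : L), ⁅(η : L), f⁆⁆ = ⁅(η : L), ⁅(ξ : L), f⁆⁆ + D.skew ξ η * ⁅D.r, f⁆
      + ⁅(D.nab ξ η : L), f⁆ - ⁅(D.nab η ξ : L), f⁆ := by
  have h := lie_lie_apply (ξ : L) (η : L) f
  rw [D.lie_eq ξ η] at h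
  simp only [add_lie, lie_smul_eq_mul, Submodule.coe_sub, sub_lie] at h
  linear_combination -h

/-- The element `[ξ, η] - α([ξ, η]) r` of `H`. -/
def tor (ξ η : H) : H := D.pr ⁅(ξ : L), (η : L)⁆

theorem tor_apply (ξ η : H) :
    (D.tor ξ η : L) = ⁅(ξ : L), (η : L)⁆ - D.θ ⁅(ξ : L), (η : L)⁆ • D.r := by
  simp [tor, pr_apply]

theorem tor_eq (ξ η : H) : D.tor ξ η = D.nab ξ η - D.nab η ξ := by
  ext
  rw [tor_apply, ← skew_apply, D.lie_eq]
  simp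

/-- The curvature expression of the partial connection. -/
def curv (ξ η γ : H) : H :=
  D.nab ξ (D.nab η γ) - D.nab η (D.nab ξ γ) - D.nab (D.tor ξ η) γ

/-- The operator `Φ`. -/
def Phi (γ : H) : H := D.curv D.e₁ D.e₂ γ

theorem curv_add_left (ξ ξ' η γ : H) : D.curv (ξ + ξ') η γ = D.curv ξ η γ + D.curv ξ' η γ := by
  simp only [curv, tor_eq, nab_add_left, nab_add_right, nab_sub_left]
  abel

theorem curv_smul_left (a : A) (ξ η γ : H) : D.curv (a • ξ) η γ = a • D.curv ξ η γ := by
  simp only [curv, tor_eq, nab_smul_left, nab_smul_right, nab_sub_left, nab_add_left]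
  module

theorem curv_swap (ξ η γ : H) : D.curv ξ η γ = -D.curv η ξ γ := by
  simp only [curv, tor_eq, nab_sub_left]
  abel

theorem curv_self (ξ γ : H) : D.curv ξ ξ γ = 0 := by
  simp [curv, tor_eq, nab]

/-- The curvature expression is `A`-bilinear and alternating in ξ, η, so on a rank two module it is
the determinant times its value on the frame. Hence Φ does not depend on the normalized frame. -/
theorem curv_eq (ξ η γ : H) : D.curv ξ η γ = D.skew ξ η • D.Phi γ := by
  have key (h k : H) : D.curv h k γ
      = D.skew h D.e₂ • D.curv D.e₁ k γ + D.skew D.e₁ h • D.curv D.e₂ k γ := by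
    conv_lhs => rw [D.expand_skew h]
    rw [curv_add_left, curv_smul_left, curv_smul_left]
  rw [key ξ η, curv_swap D D.e₁ η, curv_swap D D.e₂ η, key η, key η, curv_self, curv_self,
    curv_swap D D.e₂ D.e₁, D.skew_eq_det ξ η, Phi]
  module

/-- The torsion correction omits the r-component of [ξ, η]; differentiating a along that component
is what remains. -/
theorem curv_smul_right (a : A) (ξ η γ : H) :
    D.curv ξ η (a • γ) = a • D.curv ξ η γ + (D.skew ξ η * ⁅D.r, a⁆) • γ := by
  have h := D.lie_lie_eq ξ η a
  simp only [curv, tor_eq, nab_smul_right, nab_sub_left, nab_add_right]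
  rw [h, Submodule.coe_sub, sub_lie]
  module

theorem Phi_smul (a : A) (γ : H) : D.Phi (a • γ) = a • D.Phi γ + ⁅D.r, a⁆ • γ := by
  simp [Phi, curv_smul_right]

theorem Phi_add (γ γ' : H) : D.Phi (γ + γ') = D.Phi γ + D.Phi γ' := by
  simp only [Phi, curv, nab_add_right]
  abel

/-- Twice the operator `Ψ`. -/
def Psi (γ : H) : H := D.z ⁅D.r, ⁅D.r, (γ : L)⁆⁆

theorem Psi_smul (a : A) (γ : H) : D.Psi (a • γ) = a • D.Psi γ + (2 * ⁅D.r, a⁆) • γ := by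
  simp only [Psi, SetLike.val_smul, leibniz_smul_right, lie_add, map_add, map_smul, z_lie, z_mem]
  module

theorem Psi_add (γ γ' : H) : D.Psi (γ + γ') = D.Psi γ + D.Psi γ' := by
  simp [Psi]

/-- Ten times the projection `π₋₁`. -/
def proj : L →ₗ[A] H where
  toFun ζ := (-4 : A) • D.Phi (D.z ζ) + (7 : A) • D.Psi (D.z ζ) + (10 : A) • D.pr ζ
  map_add' X Y := by
    simp only [map_add, Phi_add, Psi_add, pr_add]
    module
  -- The derivative terms r(a) z(X) carry total coefficient -4 · 1 + 7 · 2 - 10 · 1 = 0.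
  map_smul' a X := by
    simp only [map_smul, Phi_smul, Psi_smul, pr_smul, RingHom.id_apply]
    module

theorem proj_apply (ζ : L) :
    D.proj ζ = (-4 : A) • D.Phi (D.z ζ) + (7 : A) • D.Psi (D.z ζ) + (10 : A) • D.pr ζ := rfl

/-- Thirty times the metric. -/
def G (ζ ζ' : L) : A :=
  -(3 * D.skew (D.z ζ) (D.proj ζ')) - 40 * (D.θ ζ * D.θ ζ') - 3 * D.skew (D.z ζ') (D.proj ζ)

/-- The skew form of `D` is parallel for the partial connection of `D`. -/
def Parallel : Prop :=
  ∀ γ ξ η : H, ⁅(γ : L), D.skew ξ η⁆ = D.skew (D.nab γ ξ) η + D.skew ξ (D.nab γ η)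

end ReebDatum

end Algebra

/-! ### Change of the Reeb datum under rescaling of the contact form -/

section Algebra

set_option linter.unusedSectionVars false

variable {A L : Type*} [CommRing A] [LieRing L] [Module A L] [LieRingModule L A]
  [LieRinehartRing A L] {H : Submodule A L}

/-- The Reeb data `D` and `D'` are related by rescaling the contact form by the unit `u`, with
inverse `v` and logarithmic derivative `df`. -/
structure Rescaling (D D' : ReebDatum H) (u v f : A) (μ : H) : Prop where
  mul_eq_one : u * v = 1
  lie_u (X : L) : ⁅X, u⁆ = u * ⁅X, f⁆
  r_eq : D'.r = v • (D.r + μ)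

namespace Rescaling

variable {D D' : ReebDatum H} {u v f : A} {μ : H}

theorem lie_v (S : Rescaling D D' u v f μ) (X : L) : ⁅X, v⁆ = -(v * ⁅X, f⁆) := by
  have h : ⁅X, u * v⁆ = 0 := by rw [S.mul_eq_one, lie_one_eq_zero]
  rw [leibniz_mul_right, S.lie_u, smul_eq_mul] at h
  linear_combination v * h - (⁅X, v⁆ + v * ⁅X, f⁆) * S.mul_eq_one

theorem r_eq' (S : Rescaling D D' u v f μ) : D.r = u • D'.r - μ := by
  rw [S.r_eq, smul_smul, S.mul_eq_one]; module

theorem z_eq (S : Rescaling D D' u v f μ) (X : L) : D'.z X = u • D.z X := by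
  conv_lhs => rw [D.decomp X, S.r_eq']
  simp [smul_lie_eq]

theorem θ_eq_aux (S : Rescaling D D' u v f μ) (X : L) :
    D'.θ X = u * D.θ X - ⁅(D.z X : L), u⁆ - D'.skew μ (D.z X) := by
  conv_lhs => rw [D.decomp X, S.r_eq']
  simp [smul_lie_eq, ReebDatum.skew_apply]
  ring

theorem skew_eq (S : Rescaling D D' u v f μ) (ξ η : H) : D'.skew ξ η = u * D.skew ξ η := by
  rw [ReebDatum.skew_apply, S.θ_eq_aux]
  simp [ReebDatum.skew_apply]

/-- Expand z'[ξ, [r', η]] with r' = v(r + μ): differentiating v gives both df-terms, and the bracket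
with μ contributes only its r-component. -/
theorem nab_eq_aux (S : Rescaling D D' u v f μ) (ξ η : H) :
    D'.nab ξ η = D.nab ξ η - ⁅(ξ : L), f⁆ • η - ⁅(η : L), f⁆ • ξ
    + D.skew η μ • ξ := by
  have h1 : D.z ⁅(ξ : L), ⁅(μ : L), (η : L)⁆⁆ = D.skew η μ • ξ := by
    rw [D.z_lie_of_z_eq_zero _ (D.z_lie_mem _ _), ← ReebDatum.skew_apply, D.skew_swap]
    module
  have h2 : D.z ⁅(ξ : L), D.r⁆ = -ξ := by
    rw [D.z_lie_of_z_eq_zero _ D.z_r, D.θ_r, one_smul]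
  have h3 : D'.nab ξ η = u • (v • (D.nab ξ η + D.skew η μ • ξ) + ⁅(ξ : L), v⁆ • η
      + ⁅(η : L), v⁆ • ξ) := by
    rw [ReebDatum.nab, S.z_eq, S.r_eq, smul_lie_eq, lie_sub, leibniz_smul_right,
      leibniz_smul_right, add_lie, lie_add, lie_add]
    simp only [map_sub, map_add, map_smul, h1, h2, ReebDatum.z_lie, ReebDatum.z_lie_mem,
      ReebDatum.z_r, ReebDatum.z_mem, ReebDatum.nab]
    module
  rw [h3, S.lie_v, S.lie_v]
  linear_combination (norm := module) congrArg (fun t => t • (D.nab ξ η + D.skew η μ • ξ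
    - ⁅(ξ : L), f⁆ • η - ⁅(η : L), f⁆ • ξ)) S.mul_eq_one

/-- Take the trace of `nab_eq_aux`. The new skew form is u times the old one, so its parallelism
reads γ(f) = -3 γ(f) + `skew γ μ`. -/
theorem skew_μ (S : Rescaling D D' u v f μ) (hD : D.Parallel) (hD' : D'.Parallel) (γ : H) :
    D.skew γ μ = 4 * ⁅(γ : L), f⁆ := by
  have h := hD' γ D.e₁ D.e₂
  have h0 := hD γ D.e₁ D.e₂
  simp only [S.skew_eq, leibniz_mul_right, S.lie_u, S.nab_eq_aux, map_add, map_sub, map_smul,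
    LinearMap.add_apply, LinearMap.sub_apply, LinearMap.smul_apply, smul_eq_mul,
    ReebDatum.skew_frame] at h h0
  have h1 : ⁅(γ : L), f⁆ = D.skew γ D.e₂ * ⁅(D.e₁ : L), f⁆ + D.skew D.e₁ γ * ⁅(D.e₂ : L), f⁆ := by
    conv_lhs => rw [D.expand_skew γ]
    simp
  have h2 : D.skew γ μ = D.skew γ D.e₂ * D.skew D.e₁ μ + D.skew D.e₁ γ * D.skew D.e₂ μ := by
    conv_lhs => rw [D.expand_skew γ]
    simp
  have h3 : u * (D.skew γ μ - 4 * ⁅(γ : L), f⁆) = 0 := by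
    linear_combination u * h2 - u * h1 - h + u * h0
  linear_combination v * h3 - (D.skew γ μ - 4 * ⁅(γ : L), f⁆) * S.mul_eq_one

theorem μ_eq (hμ : ∀ γ : H, D.skew γ μ = 4 * ⁅(γ : L), f⁆) :
    μ = (-4 * ⁅(D.e₂ : L), f⁆) • D.e₁ + (4 * ⁅(D.e₁ : L), f⁆) • D.e₂ := by
  conv_lhs => rw [D.expand_skew μ, D.skew_swap, hμ, hμ]
  module

/-- This is `skew μ μ = 0`, without the factor 4; in the frame the two products of derivatives
cancel. -/
theorem μ_lie (hμ : ∀ γ : H, D.skew γ μ = 4 * ⁅(γ : L), f⁆) :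
    ⁅(μ : L), f⁆ = 0 := by
  conv_lhs => rw [μ_eq hμ]
  simp
  ring

theorem nab_eq (S : Rescaling D D' u v f μ) (hμ : ∀ γ : H, D.skew γ μ = 4 * ⁅(γ : L), f⁆)
    (ξ η : H) :
    D'.nab ξ η = D.nab ξ η - ⁅(ξ : L), f⁆ • η + (3 * ⁅(η : L), f⁆) • ξ := by
  rw [S.nab_eq_aux, hμ]; module

theorem θ_eq (S : Rescaling D D' u v f μ) (hμ : ∀ γ : H, D.skew γ μ = 4 * ⁅(γ : L), f⁆)
    (X : L) :
    D'.θ X = u * (D.θ X + 3 * ⁅(D.z X : L), f⁆) := by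
  rw [S.θ_eq_aux, S.lie_u, S.skew_eq, D.skew_swap, hμ]; ring

theorem lie_r (S : Rescaling D D' u v f μ) (a : A) : ⁅D'.r, a⁆ = v * (⁅D.r, a⁆ + ⁅(μ : L), a⁆) := by
  rw [S.r_eq, lie_smul_eq_mul, add_lie]

/-- With s = r + μ one has [r', γ] = v W, where W = [s, γ] + γ(f) s satisfies z W = γ. The second
bracket with r' = v s is then expanded, torsion-freeness rewriting z[r, [μ, γ]]. -/
theorem Psi_eq (S : Rescaling D D' u v f μ) (hμ : ∀ γ : H, D.skew γ μ = 4 * ⁅(γ : L), f⁆)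
    (γ : H) : u • D'.Psi γ = D.Psi γ - D.nab γ μ + (2 : A) • D.nab μ γ
    + (4 * ⁅(γ : L), f⁆) • μ - ⁅D.r, f⁆ • γ := by
  set s : L := D.r + μ with hs
  have hsz : D.z s = 0 := by simp [hs]
  set W : L := ⁅s, (γ : L)⁆ + ⁅(γ : L), f⁆ • s with hW
  have hWz : D.z W = γ := by simp [hW, hs, D.z_lie γ]
  have hsv : ⁅s, v⁆ = -(v * ⁅D.r, f⁆) := by
    rw [S.lie_v, hs, add_lie, μ_lie hμ, add_zero]
  have h1 : ⁅D'.r, (γ : L)⁆ = v • W := by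
    rw [S.r_eq, ← hs, smul_lie_eq, S.lie_v, hW]; module
  have h2 : D.z ⁅s, W⁆ = D.Psi γ - D.nab γ μ + (2 : A) • D.nab μ γ
      + (4 * ⁅(γ : L), f⁆) • μ := by
    have h3 : D.z ⁅D.r, ⁅(μ : L), (γ : L)⁆⁆ = D.nab μ γ - D.nab γ μ := by
      rw [D.lie_eq]
      simp
    have h4 : D.z ⁅(μ : L), ⁅(μ : L), (γ : L)⁆⁆ = (4 * ⁅(γ : L), f⁆) • μ := by
      rw [D.z_lie_of_z_eq_zero _ (D.z_lie_mem _ _), ← ReebDatum.skew_apply, D.skew_swap, hμ]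
      module
    have h5 : D.z ⁅s, ⁅s, (γ : L)⁆⁆ = D.Psi γ + D.nab μ γ + D.z ⁅D.r, ⁅(μ : L), (γ : L)⁆⁆
        + D.z ⁅(μ : L), ⁅(μ : L), (γ : L)⁆⁆ := by
      simp only [hs, add_lie, lie_add, map_add, ReebDatum.Psi, ReebDatum.nab]
      abel
    rw [hW, lie_add, leibniz_smul_right, lie_self, map_add, h5, h3, h4]
    simp only [smul_zero, zero_add, map_smul, hsz]
    module
  have h6 : D'.Psi γ = u • (v • (v • D.z ⁅s, W⁆ + ⁅s, v⁆ • γ)) := by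
    rw [ReebDatum.Psi, S.z_eq, h1, S.r_eq, ← hs, smul_lie_eq, leibniz_smul_right]
    simp only [map_add, map_sub, map_smul, hsz, hWz]
    module
  rw [h6, hsv, h2]
  set T := D.Psi γ - D.nab γ μ + (2 : A) • D.nab μ γ + (4 * ⁅(γ : L), f⁆) • μ - ⁅D.r, f⁆ • γ
    with hT
  have h7 : D.Psi γ - D.nab γ μ + (2 : A) • D.nab μ γ + (4 * ⁅(γ : L), f⁆) • μ
      = T + ⁅D.r, f⁆ • γ := by rw [hT]; abel
  rw [h7]
  linear_combination (norm := module) congrArg (fun t => (t * t) • T) S.mul_eq_one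

/-- The new curvature produces second derivatives of f. They are absorbed into ∇_γ μ, since `skew ξ
μ = 4 ξ(f)` can be differentiated for a parallel skew form; the factor 4 avoids dividing in `A`. -/
theorem Phi_eq (S : Rescaling D D' u v f μ) (hD : D.Parallel)
    (hμ : ∀ γ : H, D.skew γ μ = 4 * ⁅(γ : L), f⁆) (γ : H) :
    (4 * u) • D'.Phi γ = (4 : A) • D.Phi γ + (8 * ⁅D.r, f⁆) • γ + (3 : A) • D.nab γ μ
      + (4 : A) • D.nab μ γ + (3 * ⁅(γ : L), f⁆) • μ := by
  -- The old frame has new skew value u, and u r' = r + μ, so the new torsion correction differs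
  -- from the old one by -μ.
  have h0 : u • D'.Phi γ = D'.nab D.e₁ (D'.nab D.e₂ γ) - D'.nab D.e₂ (D'.nab D.e₁ γ)
      - D'.nab (D.nab D.e₁ D.e₂ - D.nab D.e₂ D.e₁ - μ) γ := by
    have h1 := D'.curv_eq D.e₁ D.e₂ γ
    rw [S.skew_eq, D.skew_frame, mul_one] at h1
    rw [← h1, ReebDatum.curv]
    congr 2
    ext
    rw [D'.tor_apply, ← ReebDatum.skew_apply, S.skew_eq, D.skew_frame, D.lie_eq, D.skew_frame,
      mul_one,
      S.r_eq']
    simp only [Submodule.coe_sub]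
    module
  -- The frame coefficients of ∇_γ μ are found by pairing with e₁ and e₂; exchanging the order of
  -- differentiation costs an r(f) term.
  have h2 : D.nab γ μ = (-4 * (⁅(D.e₂ : L), ⁅(γ : L), f⁆⁆ - ⁅(D.nab D.e₂ γ : L), f⁆)) • D.e₁
      + (4 * (⁅(D.e₁ : L), ⁅(γ : L), f⁆⁆ - ⁅(D.nab D.e₁ γ : L), f⁆)) • D.e₂
      - (4 * ⁅D.r, f⁆) • γ := by
    have h3 (ξ : H) : D.skew ξ (D.nab γ μ) = 4 * (⁅(ξ : L), ⁅(γ : L), f⁆⁆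
        - ⁅(D.nab ξ γ : L), f⁆ - D.skew ξ γ * ⁅D.r, f⁆) := by
      have h4 := hD γ ξ μ
      rw [hμ, hμ, leibniz_mul_right, D.lie_lie_eq γ ξ f, D.skew_swap γ ξ] at h4
      have h5 : ⁅(γ : L), (4 : A)⁆ = 0 := mod_cast lie_natCast_eq_zero (γ : L) 4
      rw [h5, smul_eq_mul] at h4
      linear_combination -h4
    rw [D.expand_skew (D.nab γ μ), D.skew_swap, h3, h3]
    linear_combination (norm := module) (4 * ⁅D.r, f⁆) • D.expand_skew γ
      + congrArg (fun t => (4 * ⁅D.r, f⁆ * t) • D.e₁) (D.skew_swap D.e₂ γ)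
  have h6 := D.lie_lie_eq D.e₁ D.e₂ f
  rw [D.skew_frame] at h6
  have h7 := μ_eq hμ
  have h8 := μ_lie hμ
  have h9 (X : L) (a : A) : ⁅X, 3 * a⁆ = 3 * ⁅X, a⁆ := by
    have h10 : ⁅X, (3 : A)⁆ = 0 := mod_cast lie_natCast_eq_zero X 3
    rw [leibniz_mul_right, h10, smul_eq_mul]; ring
  rw [mul_smul, h0, h2, ReebDatum.Phi, ReebDatum.curv, D.tor_eq]
  simp only [S.nab_eq hμ, ReebDatum.nab_add_right, ReebDatum.nab_sub_right,
    ReebDatum.nab_smul_right, ReebDatum.nab_sub_left, Submodule.coe_add, Submodule.coe_sub,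
    SetLike.val_smul, add_lie, sub_lie, lie_smul_eq_mul, h8, h9]
  linear_combination (norm := module) (9 * ⁅(γ : L), f⁆) • h7 + congrArg (fun t => (-4 * t) • γ) h6

/-- The coefficients of ∇_γ μ from Φ, Ψ and ζ₂ are -3 - 7 + 10 = 0, those of ∇_μ γ are -4 + 14 - 10
= 0. Only terms algebraic in ζ survive, which fixes the weights in π₋₁. -/
theorem proj_eq (S : Rescaling D D' u v f μ) (hD : D.Parallel)
    (hμ : ∀ γ : H, D.skew γ μ = 4 * ⁅(γ : L), f⁆) (ζ : L) :
    D'.proj ζ = D.proj ζ - (15 * ⁅D.r, f⁆) • D.z ζ - (15 * ⁅(D.z ζ : L), f⁆) • μ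
      - (10 * D.θ ζ) • μ := by
  set γ := D.z ζ with hγ
  have hr : ⁅D'.r, u⁆ = ⁅D.r, f⁆ := by
    rw [S.lie_u, S.lie_r, μ_lie hμ]
    linear_combination ⁅D.r, f⁆ * S.mul_eq_one
  have h1 : D'.pr ζ = D.pr ζ - D.nab μ γ + D.nab γ μ - (4 * ⁅(γ : L), f⁆ + D.θ ζ) • μ
      - ⁅D.r, f⁆ • γ := by
    ext
    rw [D'.pr_apply, S.z_eq, SetLike.val_smul, leibniz_smul_right, hr, S.θ_eq hμ, ← hγ, S.r_eq,
      smul_lie_eq, S.lie_v, add_lie, D.lie_eq μ γ, D.skew_swap, hμ]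
    simp only [Submodule.coe_add, Submodule.coe_sub, SetLike.val_smul, D.pr_apply, ← hγ]
    linear_combination (norm := module) congrArg (fun t => (-t) • (⁅D.r, (γ : L)⁆
      + (-(4 * ⁅(γ : L), f⁆)) • D.r + ((D.nab μ γ : L) - D.nab γ μ) + ⁅(γ : L), f⁆ • (D.r + μ)
      + (D.θ ζ + 3 * ⁅(γ : L), f⁆) • (D.r + (μ : L)))) S.mul_eq_one
  rw [D'.proj_apply, D.proj_apply, S.z_eq, ← hγ, D'.Phi_smul, D'.Psi_smul, hr, S.Psi_eq hμ, h1]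
  have h2 := S.Phi_eq hD hμ γ
  linear_combination (norm := module) -h2

/-- The r(f) terms cancel since `skew` is alternating. Pairing with μ yields 360 γ(f) γ'(f) and
120-multiples of θ times a derivative, exactly what -40 (θ + 3 γ(f))(θ' + 3 γ'(f)) removes, for γ =
z ζ and γ' = z ζ'. -/
theorem G_eq (S : Rescaling D D' u v f μ) (hD : D.Parallel)
    (hμ : ∀ γ : H, D.skew γ μ = 4 * ⁅(γ : L), f⁆) (ζ ζ' : L) :
    D'.G ζ ζ' = u ^ 2 * D.G ζ ζ' := by
  simp only [ReebDatum.G, S.proj_eq hD hμ, S.skew_eq, S.z_eq, S.θ_eq hμ, map_sub, map_smul,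
    LinearMap.smul_apply, smul_eq_mul, hμ]
  rw [D.skew_swap (D.z ζ') (D.z ζ)]
  ring

end Rescaling

end Algebra

/-! ### The trace of the connection, parallel translates, and data from adapted bases -/

section Algebra

set_option linter.unusedSectionVars false

variable {A L : Type*} [CommRing A] [LieRing L] [Module A L] [LieRingModule L A]
  [LieRinehartRing A L]

namespace ReebDatum

variable {H : Submodule A L} (D : ReebDatum H)

/-- The trace of the partial connection. -/
def κ (γ : H) : A := D.skew (D.nab γ D.e₁) D.e₂ + D.skew D.e₁ (D.nab γ D.e₂)

/-- On the second exterior power of H, a line, the connection differs from plain differentiation of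
skew values by one scalar. Parallelism can therefore be tested on the frame. -/
theorem κ_spec (γ ξ η : H) :
    D.skew (D.nab γ ξ) η + D.skew ξ (D.nab γ η) = ⁅(γ : L), D.skew ξ η⁆ + D.κ γ * D.skew ξ η := by
  have h (c d c' d' : A) : D.skew (D.nab γ (c • D.e₁ + d • D.e₂)) (c' • D.e₁ + d' • D.e₂)
      + D.skew (c • D.e₁ + d • D.e₂) (D.nab γ (c' • D.e₁ + d' • D.e₂))
      = ⁅(γ : L), D.skew (c • D.e₁ + d • D.e₂) (c' • D.e₁ + d' • D.e₂)⁆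
        + D.κ γ * D.skew (c • D.e₁ + d • D.e₂) (c' • D.e₁ + d' • D.e₂) := by
    have h1 (X : L) (a b : A) : ⁅X, a * b⁆ = a * ⁅X, b⁆ + ⁅X, a⁆ * b := by
      rw [leibniz_mul_right, smul_eq_mul]
    have h2 (X : L) : ⁅X, (-1 : A)⁆ = 0 := by rw [lie_neg, lie_one_eq_zero, neg_zero]
    simp only [nab_add_right, nab_smul_right, map_add, map_smul, LinearMap.add_apply,
      LinearMap.smul_apply, smul_eq_mul, skew_self, skew_frame, D.skew_swap D.e₂ D.e₁, lie_add,
      h1, h2,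
      lie_one_eq_zero, κ, lie_zero, D.skew_swap D.e₂ (D.nab γ D.e₁),
      D.skew_swap (D.nab γ D.e₂) D.e₁, D.skew_swap D.e₂ (D.nab γ D.e₂),
      D.skew_swap (D.nab γ D.e₁) D.e₁]
    ring
  have h3 := h (D.skew ξ D.e₂) (D.skew D.e₁ ξ) (D.skew η D.e₂) (D.skew D.e₁ η)
  rwa [← D.expand_skew, ← D.expand_skew] at h3

theorem parallel_iff : D.Parallel ↔ ∀ γ : H, D.κ γ = 0 := by
  constructor
  · intro h γ
    rw [κ, ← h γ, skew_frame, lie_one_eq_zero]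
  · intro h γ ξ η
    rw [κ_spec, h, zero_mul, add_zero]

theorem κ_add (γ γ' : H) : D.κ (γ + γ') = D.κ γ + D.κ γ' := by
  simp only [κ, nab_add_left, map_add, LinearMap.add_apply]
  ring

theorem κ_smul (a : A) (γ : H) : D.κ (a • γ) = a * D.κ γ := by
  simp only [κ, nab_smul_left, map_smul, LinearMap.smul_apply, smul_eq_mul]
  ring

theorem Rescaling.one {D D' : ReebDatum H} {μ : H} (h : D'.r = D.r + μ) :
    Rescaling D D' 1 1 0 μ where
  mul_eq_one := by simp
  lie_u X := by simp [lie_one_eq_zero]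
  r_eq := by simp [h]

/-- The translation of `r` which makes the skew form parallel. -/
def shift : H := D.κ D.e₂ • D.e₁ - D.κ D.e₁ • D.e₂

theorem skew_shift (γ : H) : D.skew γ D.shift = -D.κ γ := by
  have h : D.κ γ = D.skew γ D.e₂ * D.κ D.e₁ + D.skew D.e₁ γ * D.κ D.e₂ := by
    conv_lhs => rw [D.expand_skew γ, κ_add, κ_smul, κ_smul]
  rw [h, shift]
  simp only [map_sub, map_smul, smul_eq_mul, D.skew_swap γ D.e₁]
  ring

/-- Translating r by μ adds `skew γ μ` to the trace, and `shift` is chosen to make this -κ. -/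
theorem parallel_of_shift {D D' : ReebDatum H} (h : D'.r = D.r + D.shift) (h₁ : D'.e₁ = D.e₁)
    (h₂ : D'.e₂ = D.e₂) : D'.Parallel := by
  have S := Rescaling.one h
  rw [parallel_iff]
  intro γ
  have h3 := D.skew_shift γ
  have h4 : D.skew γ D.shift =
      D.skew γ D.e₂ * D.skew D.e₁ D.shift + D.skew D.e₁ γ * D.skew D.e₂ D.shift := by
    conv_lhs => rw [D.expand_skew γ]
    simp
  rw [κ, h₁, h₂, S.skew_eq, S.skew_eq, S.nab_eq_aux, S.nab_eq_aux]
  simp only [map_add, map_sub, map_smul, LinearMap.add_apply, LinearMap.sub_apply,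
    LinearMap.smul_apply, smul_eq_mul, lie_zero, zero_mul, sub_zero, one_mul]
  rw [κ] at h3
  linear_combination h3 - h4

/-- The case u = 1, f = 0 of the rescaling formula: μ is skew-orthogonal to H, hence zero. -/
theorem eq_of_parallel {D D' : ReebDatum H} (hD : D.Parallel) (hD' : D'.Parallel) {μ : H}
    (h : D'.r = D.r + μ) : D'.r = D.r := by
  have S := Rescaling.one h
  have hμ : μ = 0 := by
    rw [Rescaling.μ_eq (S.skew_μ hD hD')]
    simp
  rw [h, hμ]
  simp

end ReebDatum

/-- A frame of a Lie-Rinehart algebra adapted to a generic submodule of rank two. -/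
structure AdaptedBasis (A L : Type*) [CommRing A] [LieRing L] [Module A L] where
  b : Module.Basis (Fin 5) A L
  lie_zero_one : ⁅b 0, b 1⁆ = b 2
  lie_zero_two : ⁅b 0, b 2⁆ = b 3
  lie_one_two : ⁅b 1, b 2⁆ = b 4

namespace AdaptedBasis

variable (F : AdaptedBasis A L)

/-- The coordinates with respect to an adapted basis. -/
def c (i : Fin 5) : L →ₗ[A] A := F.b.coord i

@[simp] theorem c_b (i j : Fin 5) : F.c i (F.b j) = if j = i then 1 else 0 := by
  simp [c, Finsupp.single_apply]

/-- The submodule of rank two. -/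
def H : Submodule A L := LinearMap.ker (F.c 2) ⊓ LinearMap.ker (F.c 3) ⊓ LinearMap.ker (F.c 4)

theorem mem_H {X : L} : X ∈ F.H ↔ F.c 2 X = 0 ∧ F.c 3 X = 0 ∧ F.c 4 X = 0 := by
  simp [H, and_assoc]

theorem sum_c (X : L) : X = F.c 0 X • F.b 0 + F.c 1 X • F.b 1 + F.c 2 X • F.b 2
    + F.c 3 X • F.b 3 + F.c 4 X • F.b 4 := by
  have h := F.b.sum_repr X
  rw [Fin.sum_univ_five] at h
  exact h.symm

theorem b_zero_mem : F.b 0 ∈ F.H := by simp [mem_H]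

theorem b_one_mem : F.b 1 ∈ F.H := by simp [mem_H]

theorem eq_of_mem {X : L} (h : X ∈ F.H) : X = F.c 0 X • F.b 0 + F.c 1 X • F.b 1 := by
  obtain ⟨h2, h3, h4⟩ := F.mem_H.1 h
  conv_lhs => rw [F.sum_c X, h2, h3, h4]
  simp

/-- The brackets of `H` with `T⁻²`. -/
theorem lie_mem_eq {h X : L} (hh : h ∈ F.H) (h3 : F.c 3 X = 0) (h4 : F.c 4 X = 0) :
    F.c 2 ⁅h, X⁆ = F.c 0 h * F.c 1 X - F.c 1 h * F.c 0 X + ⁅h, F.c 2 X⁆ ∧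
    F.c 3 ⁅h, X⁆ = F.c 0 h * F.c 2 X ∧ F.c 4 ⁅h, X⁆ = F.c 1 h * F.c 2 X := by
  have e1 := F.eq_of_mem hh
  have e2 := F.sum_c X
  rw [h3, h4] at e2
  have e3 : ⁅F.b 1, F.b 0⁆ = -F.b 2 := by rw [← lie_skew, F.lie_zero_one]
  have e4 : ⁅h, X⁆ = ⁅h, F.c 0 X⁆ • F.b 0 + ⁅h, F.c 1 X⁆ • F.b 1 + ⁅h, F.c 2 X⁆ • F.b 2
      + F.c 0 X • ⁅h, F.b 0⁆ + F.c 1 X • ⁅h, F.b 1⁆ + F.c 2 X • ⁅h, F.b 2⁆ := by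
    conv_lhs => rw [e2]
    simp only [lie_add, leibniz_smul_right, zero_smul, lie_zero]
    module
  have e5 (Y : L) : ⁅h, Y⁆ = F.c 0 h • ⁅F.b 0, Y⁆ + F.c 1 h • ⁅F.b 1, Y⁆
      - ⁅Y, F.c 0 h⁆ • F.b 0 - ⁅Y, F.c 1 h⁆ • F.b 1 := by
    conv_lhs => rw [e1]
    rw [add_lie, smul_lie_eq, smul_lie_eq]
    module
  rw [e4, e5 (F.b 0), e5 (F.b 1), e5 (F.b 2), F.lie_zero_one, F.lie_zero_two, F.lie_one_two, e3]
  refine ⟨?_, ?_, ?_⟩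
  · simp; ring
  · simp; ring
  · simp; ring

theorem lie_mem_mem {h k : L} (hh : h ∈ F.H) (hk : k ∈ F.H) :
    F.c 2 ⁅h, k⁆ = F.c 0 h * F.c 1 k - F.c 1 h * F.c 0 k ∧
    F.c 3 ⁅h, k⁆ = 0 ∧ F.c 4 ⁅h, k⁆ = 0 := by
  obtain ⟨h2, h3, h4⟩ := F.mem_H.1 hk
  simpa [h2] using F.lie_mem_eq hh h3 h4

variable {F} {r : L} {w : A}

/-- The map `z` determined by a section `r` of `T⁻²`, where `w` is inverse to the coordinate
of `r`. -/
def zMap (F : AdaptedBasis A L) (w : A) : L →ₗ[A] F.H :=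
  LinearMap.codRestrict F.H ((-w) • ((F.c 3).smulRight (F.b 0) + (F.c 4).smulRight (F.b 1)))
    (fun _ => F.H.smul_mem _ (F.H.add_mem (F.H.smul_mem _ F.b_zero_mem)
      (F.H.smul_mem _ F.b_one_mem)))

theorem zMap_apply (X : L) : (zMap F w X : L) = (-w) • (F.c 3 X • F.b 0 + F.c 4 X • F.b 1) := rfl

theorem zMap_eq_zero {X : L} (h3 : F.c 3 X = 0) (h4 : F.c 4 X = 0) : zMap F w X = 0 := by
  ext; simp [zMap_apply, h3, h4]

theorem c_lie_r (h3 : F.c 3 r = 0) (h4 : F.c 4 r = 0) {h : L} (hh : h ∈ F.H) :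
    F.c 3 ⁅r, h⁆ = -(F.c 2 r * F.c 0 h) ∧ F.c 4 ⁅r, h⁆ = -(F.c 2 r * F.c 1 h) := by
  obtain ⟨-, e3, e4⟩ := F.lie_mem_eq hh h3 h4
  rw [← lie_skew, map_neg, map_neg, e3, e4]
  constructor <;> ring

/-- The Reeb datum determined by a section `r` of `T⁻²`. -/
def datum (F : AdaptedBasis A L) (r : L) (w : A) (h3 : F.c 3 r = 0) (h4 : F.c 4 r = 0)
    (hw : w * F.c 2 r = 1) : ReebDatum F.H where
  r := r
  z := zMap F w
  θ :=
    -- Subtracting [r, z X] leaves an element of T⁻²; its class modulo H is measured in units of r.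
    { toFun X := w * F.c 2 (X - ⁅r, (zMap F w X : L)⁆)
      map_add' X Y := by
        simp only [map_add, map_sub, Submodule.coe_add, lie_add]; ring
      map_smul' a X := by
        have h := (F.mem_H.1 (zMap F w X).2).1
        simp only [map_smul, SetLike.val_smul, leibniz_smul_right, map_sub, map_add, h,
          smul_eq_mul, RingHom.id_apply]
        ring }
  -- The scaling makes [e₁, e₂] congruent to r modulo H, so that θ takes the value 1.
  e₁ := ⟨F.c 2 r • F.b 0, F.H.smul_mem _ F.b_zero_mem⟩
  e₂ := ⟨F.b 1, F.b_one_mem⟩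
  z_mem h := zMap_eq_zero (F.mem_H.1 h.2).2.1 (F.mem_H.1 h.2).2.2
  z_r := zMap_eq_zero h3 h4
  z_lie h := by
    obtain ⟨e3, e4⟩ := c_lie_r h3 h4 h.2
    ext
    rw [zMap_apply, e3, e4]
    conv_rhs => rw [F.eq_of_mem h.2]
    linear_combination (norm := module)
      congrArg (fun t => t • (F.c 0 h • F.b 0 + F.c 1 h • F.b 1)) hw
  z_lie_mem h k := zMap_eq_zero (F.lie_mem_mem h.2 k.2).2.1 (F.lie_mem_mem h.2 k.2).2.2
  θ_mem h := by
    obtain ⟨h2, h3, h4⟩ := F.mem_H.1 h.2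
    simp [zMap_eq_zero h3 h4, h2]
  θ_r := by simp [zMap_eq_zero h3 h4, hw]
  θ_lie h := by
    have : zMap F w ⁅r, (h : L)⁆ = h := by
      obtain ⟨e3, e4⟩ := c_lie_r h3 h4 h.2
      ext
      rw [zMap_apply, e3, e4]
      conv_rhs => rw [F.eq_of_mem h.2]
      linear_combination (norm := module)
        congrArg (fun t => t • (F.c 0 h • F.b 0 + F.c 1 h • F.b 1)) hw
    simp [this]
  mem_of_eq_zero X hz hθ := by
    have e0 : (-w) • (F.c 3 X • F.b 0 + F.c 4 X • F.b 1) = 0 := by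
      rw [← zMap_apply, hz]; rfl
    have e3 : w * F.c 3 X = 0 := by simpa using congrArg (F.c 0) e0
    have e4 : w * F.c 4 X = 0 := by simpa using congrArg (F.c 1) e0
    simp only [LinearMap.coe_mk, AddHom.coe_mk, hz, ZeroMemClass.coe_zero, lie_zero,
      sub_zero] at hθ
    have key (t : A) (h : w * t = 0) : t = 0 := by
      linear_combination F.c 2 r * h - t * hw
    exact F.mem_H.2 ⟨key _ hθ, key _ e3, key _ e4⟩
  θ_frame := by
    obtain ⟨e2, e3, e4⟩ := F.lie_mem_mem (F.H.smul_mem (F.c 2 r) F.b_zero_mem) F.b_one_mem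
    simp [zMap_eq_zero e3 e4, e2, hw]
  expand h := by
    obtain ⟨e2, e3, e4⟩ := F.lie_mem_mem (F.H.smul_mem (F.c 2 r) F.b_zero_mem) h.2
    obtain ⟨e2', e3', e4'⟩ := F.lie_mem_mem h.2 F.b_one_mem
    ext
    simp only [LinearMap.coe_mk, AddHom.coe_mk, zMap_eq_zero e3 e4, zMap_eq_zero e3' e4',
      Submodule.coe_add, SetLike.val_smul, ZeroMemClass.coe_zero, lie_zero, sub_zero, e2, e2']
    conv_lhs => rw [F.eq_of_mem h.2]
    simp
    linear_combination (norm := module)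
      congrArg (fun t => -t • (F.c 0 h • F.b 0 + F.c 1 h • F.b 1)) hw

/-- There is a section `r` of `T⁻²` with prescribed class in `gr₋₂` for which the skew form is
parallel. -/
theorem exists_parallel (F : AdaptedBasis A L) (a w : A) (hw : w * a = 1) :
    ∃ (r : L) (h3 : F.c 3 r = 0) (h4 : F.c 4 r = 0) (h2 : F.c 2 r = a),
      (F.datum r w h3 h4 (h2 ▸ hw)).Parallel := by
  have e2 : F.c 2 (a • F.b 2) = a := by simp
  have e3 : F.c 3 (a • F.b 2) = 0 := by simp
  have e4 : F.c 4 (a • F.b 2) = 0 := by simp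
  -- A trial section with the right class in gr₋₂; the correction by `shift` lies in H and preserves
  -- that class and the frame of H.
  set D := F.datum (a • F.b 2) w e3 e4 (by rw [e2, hw]) with hD
  obtain ⟨s2, s3, s4⟩ := F.mem_H.1 D.shift.2
  have f2 : F.c 2 (a • F.b 2 + D.shift) = a := by rw [map_add, e2, s2, add_zero]
  refine ⟨a • F.b 2 + D.shift, by rw [map_add, e3, s3, add_zero],
    by rw [map_add, e4, s4, add_zero], f2, ?_⟩
  apply ReebDatum.parallel_of_shift (D := D) rfl
  · ext
    change F.c 2 (a • F.b 2 + D.shift) • F.b 0 = F.c 2 (a • F.b 2) • F.b 0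
    rw [f2, e2]
  · rfl

end AdaptedBasis

end Algebra

/-! ### Smooth fields, commutators as derivations, and smoothness of coefficients -/

section Smooth

variable {M : Type*} [TopologicalSpace M] [ChartedSpace E5 M] [IsManifold (𝓡 5) ∞ M]

instance isManifold_minSmoothness_two : IsManifold (𝓡 5) (minSmoothness ℝ 2) M := by
  rw [minSmoothness_of_isRCLikeNormedField]; infer_instance

instance isManifold_minSmoothness_three : IsManifold (𝓡 5) (minSmoothness ℝ 3) M := by
  rw [minSmoothness_of_isRCLikeNormedField]; infer_instance

instance isManifold_infty_add_one : IsManifold (𝓡 5) (((⊤ : ℕ∞) : ℕ∞ω) + 1) M :=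
  IsManifold.of_le (n := ∞) (by simp)

/-- The vector field `V` is smooth on `U`. -/
def SmoothField (U : Set M) (V : VField M) : Prop :=
  ContMDiffOn (𝓡 5) (𝓡 5).tangent ∞ (fun y => (⟨y, V y⟩ : TangentBundle (𝓡 5) M)) U

/-- The function `f` is smooth on `U`. -/
def SmoothFn (U : Set M) (f : M → ℝ) : Prop := ContMDiffOn (𝓡 5) 𝓘(ℝ, ℝ) ∞ f U

variable {U : Set M} {V W Z : VField M} {f g : M → ℝ}

theorem SmoothField.mono {U' : Set M} (h : SmoothField U V) (hU : U' ⊆ U) : SmoothField U' V :=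
  ContMDiffOn.mono h hU

theorem SmoothFn.mono {U' : Set M} (h : SmoothFn U f) (hU : U' ⊆ U) : SmoothFn U' f :=
  ContMDiffOn.mono h hU

theorem SmoothField.congr (h : SmoothField U V) (hW : ∀ y ∈ U, W y = V y) : SmoothField U W :=
  ContMDiffOn.congr h fun y hy => by rw [hW y hy]

theorem SmoothFn.congr (h : SmoothFn U f) (hg : ∀ y ∈ U, g y = f y) : SmoothFn U g :=
  ContMDiffOn.congr h hg

theorem SmoothField.contMDiffAt (h : SmoothField U V) (hU : IsOpen U) {x : M} (hx : x ∈ U) :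
    ContMDiffAt (𝓡 5) (𝓡 5).tangent ∞ (fun y => (⟨y, V y⟩ : TangentBundle (𝓡 5) M)) x :=
  ContMDiffOn.contMDiffAt h (hU.mem_nhds hx)

theorem SmoothField.mdifferentiableAt (h : SmoothField U V) (hU : IsOpen U) {x : M} (hx : x ∈ U) :
    MDifferentiableAt (𝓡 5) (𝓡 5).tangent (fun y => (⟨y, V y⟩ : TangentBundle (𝓡 5) M)) x :=
  (h.contMDiffAt hU hx).mdifferentiableAt (by simp)

theorem SmoothFn.mdifferentiableAt (h : SmoothFn U f) (hU : IsOpen U) {x : M} (hx : x ∈ U) :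
    MDifferentiableAt (𝓡 5) 𝓘(ℝ, ℝ) f x :=
  (ContMDiffOn.contMDiffAt h (hU.mem_nhds hx)).mdifferentiableAt (by simp)

theorem SmoothField.add (hV : SmoothField U V) (hW : SmoothField U W) : SmoothField U (V + W) :=
  ContMDiffOn.add_section hV hW

theorem SmoothField.smul (hf : SmoothFn U f) (hV : SmoothField U V) : SmoothField U (f • V) :=
  ContMDiffOn.smul_section hf hV

theorem SmoothField.zero : SmoothField U (0 : VField M) :=
  (contMDiff_zeroSection ℝ (TangentSpace (𝓡 5) : M → Type _)).contMDiffOn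

theorem SmoothField.lie (hU : IsOpen U) (hV : SmoothField U V) (hW : SmoothField U W) :
    SmoothField U (mlieBracket (𝓡 5) V W) := fun x hx =>
  ((hV.contMDiffAt hU hx).mlieBracket_vectorField (m := ⊤) (n := ⊤) (hW.contMDiffAt hU hx)
    (by simp)).contMDiffWithinAt

theorem SmoothFn.deriv (hU : IsOpen U) (hf : SmoothFn U f) (hV : SmoothField U V) :
    SmoothFn U (fun y => mvfderiv (𝓡 5) f y (V y)) := by
  have h1 := ContMDiffOn.contMDiffOn_tangentMapWithin (m := ∞) hf (by simp) hU.uniqueMDiffOn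
  have h2 := h1.comp hV (fun y hy => hy)
  have h3 := (contMDiff_snd_tangentBundle_modelSpace ℝ 𝓘(ℝ, ℝ) (n := ∞)).comp_contMDiffOn h2
  refine h3.congr fun y hy => ?_
  change _ = mfderivWithin (𝓡 5) 𝓘(ℝ, ℝ) f U y (V y)
  rw [mfderivWithin_of_isOpen hU hy]
  rfl

theorem smoothField_trivializationAt (x : M) (c : E5) :
    SmoothField (trivializationAt E5 (TangentSpace (𝓡 5) : M → Type _) x).baseSet
      (fun y => (trivializationAt E5 (TangentSpace (𝓡 5) : M → Type _) x).symm y c) := by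
  let e := trivializationAt E5 (TangentSpace (𝓡 5) : M → Type _) x
  refine (e.contMDiffOn_section_baseSet_iff (IB := 𝓡 5) (n := ∞)).2 ?_
  refine (contMDiffOn_const (c := c)).congr fun y hy => ?_
  rw [e.apply_mk_symm hy]

theorem exists_smooth_field_eq (x : M) (v : TangentSpace (𝓡 5) x) :
    ∃ (U : Set M) (V : VField M), IsOpen U ∧ x ∈ U ∧ SmoothField U V ∧ V x = v := by
  let e := trivializationAt E5 (TangentSpace (𝓡 5) : M → Type _) x
  have hx : x ∈ e.baseSet := FiberBundle.mem_baseSet_trivializationAt' x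
  refine ⟨e.baseSet, fun y => e.symm y ((e ⟨x, v⟩).2), e.open_baseSet, hx,
    smoothField_trivializationAt x _, e.symm_apply_apply_mk hx v⟩

/-- Write the Jacobi identity for V, W, f Z, subtract f times the one for V, W, Z, and compare
coefficients of a field Z that does not vanish at x. -/
theorem mvfderiv_mlieBracket (hU : IsOpen U) (hV : SmoothField U V) (hW : SmoothField U W)
    (hf : SmoothFn U f) {x : M} (hx : x ∈ U) :
    mvfderiv (𝓡 5) f x (mlieBracket (𝓡 5) V W x) =
      mvfderiv (𝓡 5) (fun y => mvfderiv (𝓡 5) f y (W y)) x (V x)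
        - mvfderiv (𝓡 5) (fun y => mvfderiv (𝓡 5) f y (V y)) x (W x) := by
  obtain ⟨v, hv⟩ := (exists_ne (0 : E5) : ∃ v : TangentSpace (𝓡 5) x, v ≠ 0)
  obtain ⟨U', Z, hU', hx', hZ', rfl⟩ := exists_smooth_field_eq x v
  have hO : IsOpen (U ∩ U') := hU.inter hU'
  have hxO : x ∈ U ∩ U' := ⟨hx, hx'⟩
  replace hV := hV.mono (Set.inter_subset_left (t := U'))
  replace hW := hW.mono (Set.inter_subset_left (t := U'))
  replace hf := hf.mono (Set.inter_subset_left (t := U'))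
  have hZ := hZ'.mono (Set.inter_subset_right (s := U))
  have step {X Y : VField M} (hX : SmoothField (U ∩ U') X) (hY : SmoothField (U ∩ U') Y) :
      mlieBracket (𝓡 5) X (mlieBracket (𝓡 5) Y (f • Z)) x =
        mvfderiv (𝓡 5) (fun y => mvfderiv (𝓡 5) f y (Y y)) x (X x) • Z x
          + mvfderiv (𝓡 5) f x (Y x) • mlieBracket (𝓡 5) X Z x
          + mvfderiv (𝓡 5) f x (X x) • mlieBracket (𝓡 5) Y Z x
          + f x • mlieBracket (𝓡 5) X (mlieBracket (𝓡 5) Y Z) x := by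
    have h1 : mlieBracket (𝓡 5) Y (f • Z) =ᶠ[𝓝 x]
        ((fun y => mvfderiv (𝓡 5) f y (Y y)) • Z + f • mlieBracket (𝓡 5) Y Z : VField M) := by
      filter_upwards [hO.mem_nhds hxO] with y hy
      exact mlieBracket_smul_right (hf.mdifferentiableAt hO hy) (hZ.mdifferentiableAt hO hy)
    have hd := hf.deriv hO hY
    have hYZ := hY.lie hO hZ
    rw [(Filter.EventuallyEq.refl _ X).mlieBracket_vectorField_eq h1,
      mlieBracket_add_right ((SmoothField.smul hd hZ).mdifferentiableAt hO hxO)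
        ((SmoothField.smul hf hYZ).mdifferentiableAt hO hxO),
      mlieBracket_smul_right (hd.mdifferentiableAt hO hxO) (hZ.mdifferentiableAt hO hxO),
      mlieBracket_smul_right (hf.mdifferentiableAt hO hxO) (hYZ.mdifferentiableAt hO hxO)]
    abel
  have hfZ := SmoothField.smul hf hZ
  have jac {X : VField M} (hX : SmoothField (U ∩ U') X) :=
    leibniz_identity_mlieBracket_apply (I := 𝓡 5) (𝕜 := ℝ) (x := x)
      (((hV.contMDiffAt hO hxO).of_le (by simpa using ENat.LEInfty.out)))
      (((hW.contMDiffAt hO hxO).of_le (by simpa using ENat.LEInfty.out)))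
      (((hX.contMDiffAt hO hxO).of_le (by simpa using ENat.LEInfty.out)))
  have j1 := jac hfZ
  have j2 := jac hZ
  rw [step hV hW, step hW hV, mlieBracket_smul_right (hf.mdifferentiableAt hO hxO)
    (hZ.mdifferentiableAt hO hxO), j2] at j1
  have j3 : (mvfderiv (𝓡 5) f x (mlieBracket (𝓡 5) V W x) -
      (mvfderiv (𝓡 5) (fun y => mvfderiv (𝓡 5) f y (W y)) x (V x)
        - mvfderiv (𝓡 5) (fun y => mvfderiv (𝓡 5) f y (V y)) x (W x))) • Z x = 0 := by
    linear_combination (norm := module) -j1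
  exact sub_eq_zero.1 ((smul_eq_zero.1 j3).resolve_right hv)

/-- The Gram map of a family of vectors. -/
def gram {k : ℕ} (v : Fin k → E5) : (Fin k → ℝ) →L[ℝ] (Fin k → ℝ) :=
  ∑ i, ∑ j, inner ℝ (v i) (v j) •
    (ContinuousLinearMap.proj (R := ℝ) (φ := fun _ : Fin k => ℝ) j).smulRight
      (Pi.single i (1 : ℝ))

theorem gram_apply {k : ℕ} (v : Fin k → E5) (c : Fin k → ℝ) (i : Fin k) :
    gram v c i = inner ℝ (v i) (∑ j, c j • v j) := by
  simp only [gram, sum_apply, Finset.sum_apply, inner_sum,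
    smul_apply, ContinuousLinearMap.smulRight_apply, Pi.smul_apply,
    ContinuousLinearMap.proj_apply, inner_smul_right, Pi.single_apply, smul_eq_mul]
  rw [Finset.sum_eq_single i]
  · simp [mul_comm]
  · intro b _ hb
    simp [hb.symm]
  · simp

theorem exists_gram_equiv {k : ℕ} {v : Fin k → E5} (hv : LinearIndependent ℝ v) :
    ∃ A : (Fin k → ℝ) ≃L[ℝ] (Fin k → ℝ), (A : (Fin k → ℝ) →L[ℝ] (Fin k → ℝ)) = gram v := by
  have hinj : Function.Injective (gram v : (Fin k → ℝ) →ₗ[ℝ] (Fin k → ℝ)) := by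
    rw [injective_iff_map_eq_zero]
    intro c hc
    have h0 : inner ℝ (∑ j, c j • v j) (∑ j, c j • v j) = (0 : ℝ) := by
      rw [sum_inner]
      refine Finset.sum_eq_zero fun i _ => ?_
      rw [inner_smul_left, ← gram_apply]
      have : gram v c i = 0 := congrFun hc i
      simp [this]
    exact funext (Fintype.linearIndependent_iff.1 hv c (inner_self_eq_zero.1 h0))
  refine ⟨(LinearEquiv.ofInjectiveEndo _ hinj).toContinuousLinearEquiv, ?_⟩
  ext c : 1
  rfl

/-- In a trivialization, inner products with the frame give a linear system whose Gram map is
invertible by independence. Inversion of continuous linear maps is smooth, so the solution is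
smooth. -/
theorem smoothFn_coeff {k : ℕ} {e : Fin k → VField M} (hU : IsOpen U)
    (he : ∀ i, SmoothField U (e i))
    (hli : ∀ y ∈ U, LinearIndependent ℝ (fun i => e i y)) (hV : SmoothField U V)
    {a : Fin k → M → ℝ} (ha : ∀ y ∈ U, V y = ∑ i, a i y • e i y) (i : Fin k) :
    SmoothFn U (a i) := by
  intro x hx
  refine ContMDiffAt.contMDiffWithinAt ?_
  let t := trivializationAt E5 (TangentSpace (𝓡 5) : M → Type _) x
  have hxt : x ∈ t.baseSet := FiberBundle.mem_baseSet_trivializationAt' x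
  have hsm {W : VField M} (hW : SmoothField U W) :
      ContMDiffAt (𝓡 5) 𝓘(ℝ, E5) ∞ (fun y => t.continuousLinearMapAt ℝ y (W y)) x := by
    have h1 := (contMDiffAt_section (IB := 𝓡 5) (n := ∞) (F := E5) (s := W) x).1
      (hW.contMDiffAt hU hx)
    refine h1.congr_of_eventuallyEq ?_
    filter_upwards [t.open_baseSet.mem_nhds hxt] with y hy
    rw [Trivialization.continuousLinearMapAt_apply, t.coe_linearMapAt_of_mem hy]
  have hinner {p q : M → E5} (hp : ContMDiffAt (𝓡 5) 𝓘(ℝ, E5) ∞ p x)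
      (hq : ContMDiffAt (𝓡 5) 𝓘(ℝ, E5) ∞ q x) :
      ContMDiffAt (𝓡 5) 𝓘(ℝ, ℝ) ∞ (fun y => inner ℝ (p y) (q y)) x :=
    (contDiff_inner (𝕜 := ℝ) (E := E5)).contMDiff.contMDiffAt.comp x (hp.prodMk_space hq)
  let v : M → Fin k → E5 := fun y i => t.continuousLinearMapAt ℝ y (e i y)
  let B : M → (Fin k → ℝ) →L[ℝ] (Fin k → ℝ) := fun y => gram (v y)
  let b : M → Fin k → ℝ := fun y i => inner ℝ (v y i) (t.continuousLinearMapAt ℝ y (V y))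
  have hB : ContMDiffAt (𝓡 5) 𝓘(ℝ, (Fin k → ℝ) →L[ℝ] (Fin k → ℝ)) ∞ B x :=
    contMDiffAt_finsetSum fun i _ => contMDiffAt_finsetSum fun j _ =>
      (hinner (hsm (he i)) (hsm (he j))).smul contMDiffAt_const
  have hb : ContMDiffAt (𝓡 5) 𝓘(ℝ, Fin k → ℝ) ∞ b x :=
    contMDiffAt_pi_space.2 fun i => hinner (hsm (he i)) (hsm hV)
  have hequiv (y : M) (hy : y ∈ U ∩ t.baseSet) : ∃ A : (Fin k → ℝ) ≃L[ℝ] (Fin k → ℝ),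
      (A : (Fin k → ℝ) →L[ℝ] (Fin k → ℝ)) = B y := by
    apply exists_gram_equiv
    have h2 := (hli y hy.1).map' (t.continuousLinearEquivAt ℝ y hy.2).toLinearEquiv.toLinearMap
      (LinearEquiv.ker _)
    have h3 : v y = ⇑(t.continuousLinearEquivAt ℝ y hy.2).toLinearEquiv.toLinearMap ∘
        fun i => e i y := by
      ext1 i
      simp [v, Trivialization.linearMapAt_apply, hy.2]
    rw [h3]
    exact h2
  obtain ⟨A, hA⟩ := hequiv x ⟨hx, hxt⟩
  have hinv : ContMDiffAt (𝓡 5) 𝓘(ℝ, (Fin k → ℝ) →L[ℝ] (Fin k → ℝ)) ∞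
      (fun y => (B y).inverse) x := by
    have h3 : ContDiffAt ℝ ∞ ContinuousLinearMap.inverse (B x) := hA ▸ contDiffAt_map_inverse A
    exact h3.contMDiffAt.comp x hB
  have hfin := hinv.clm_apply hb
  have hfin' : ContMDiffAt (𝓡 5) 𝓘(ℝ, Fin k → ℝ) ∞ (fun y i => a i y) x := by
    refine hfin.congr_of_eventuallyEq ?_
    filter_upwards [(hU.inter t.open_baseSet).mem_nhds ⟨hx, hxt⟩] with y hy
    obtain ⟨A', hA'⟩ := hequiv y hy
    have h4 : b y = A' (fun i => a i y) := by
      ext i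
      have h5 : A' (fun i => a i y) = B y (fun i => a i y) := by rw [← hA']; rfl
      rw [h5, gram_apply]
      simp only [b, ha y hy.1, map_sum, map_smul, v]
    rw [← hA', h4, ContinuousLinearMap.inverse_equiv]
    simp
  exact (contMDiffAt_pi_space.1 hfin') i

end Smooth

/-! ### The Lie-Rinehart algebra of vector fields on an open set -/

section LocalAlgebra

variable {M : Type*} [TopologicalSpace M] [ChartedSpace E5 M] [IsManifold (𝓡 5) ∞ M]

open scoped Classical in
/-- Extension by zero of a function on an open subset. -/
def extFn (U : Opens M) (f : U → ℝ) : M → ℝ := fun y => if h : y ∈ U then f ⟨y, h⟩ else 0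

open scoped Classical in
/-- Extension by zero of a vector field on an open subset. -/
def extField (U : Opens M) (V : (y : U) → TangentSpace (𝓡 5) (y : M)) : VField M :=
  fun y => if h : y ∈ U then V ⟨y, h⟩ else 0

variable {U : Opens M}

@[simp] theorem extFn_apply (f : U → ℝ) (y : U) : extFn U f y = f y := by
  simp [extFn]

@[simp] theorem extField_apply (V : (y : U) → TangentSpace (𝓡 5) (y : M)) (y : U) :
    extField U V y = V y := by
  simp [extField]

variable (U) in
/-- The ring of smooth functions on `U`. -/
def FnRing : Subring (U → ℝ) where
  carrier := {f | SmoothFn (U : Set M) (extFn U f)}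
  mul_mem' {f g} hf hg := (ContMDiffOn.mul hf hg).congr fun y hy => by
    simp [extFn, show y ∈ U from hy]
  one_mem' := (contMDiffOn_const (c := (1 : ℝ))).congr fun y hy => by
    simp [extFn, show y ∈ U from hy]
  add_mem' {f g} hf hg := (ContMDiffOn.add hf hg).congr fun y hy => by
    simp [extFn, show y ∈ U from hy]
  zero_mem' := (contMDiffOn_const (c := (0 : ℝ))).congr fun y hy => by
    simp [extFn, show y ∈ U from hy]
  neg_mem' {f} hf := (ContMDiffOn.neg hf).congr fun y hy => by
    simp [extFn, show y ∈ U from hy]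

variable (U) in
/-- The module of smooth vector fields on `U`. -/
def FieldModule : Submodule (FnRing U) ((y : U) → TangentSpace (𝓡 5) (y : M)) where
  carrier := {V | SmoothField (U : Set M) (extField U V)}
  add_mem' {V W} hV hW := (SmoothField.add hV hW).congr fun y hy => by
    simp [extField, show y ∈ U from hy]
  zero_mem' := SmoothField.zero.congr fun y hy => by
    simp [extField, show y ∈ U from hy]
  smul_mem' f V hV := (SmoothField.smul f.2 hV).congr fun y hy => by
    simp [extField, extFn, show y ∈ U from hy, Subring.smul_def]

instance : CommRing (FnRing U) := inferInstance

instance : AddCommGroup (FieldModule U) := inferInstance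

instance : Module (FnRing U) (FieldModule U) := inferInstance

instance : SMul (FnRing U) (FieldModule U) :=
  (Module.toDistribMulAction (R := FnRing U) (M := FieldModule U)).toDistribSMul.toSMul

instance : CoeFun (FnRing U) (fun _ => U → ℝ) := ⟨fun f => f.1⟩

instance : CoeFun (FieldModule U) (fun _ => (y : U) → TangentSpace (𝓡 5) (y : M)) :=
  ⟨fun V => V.1⟩

@[simp] theorem FnRing.add_apply (f g : FnRing U) (y : U) : (f + g) y = f y + g y := rfl
@[simp] theorem FnRing.one_apply (y : U) : (1 : FnRing U) y = 1 := rfl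

theorem FieldModule.eval_eq {V W Z : FieldModule U} {f : FnRing U} (h : V = f • W + Z) (y : U) :
    V y = f y • W y + Z y := by
  rw [h]; rfl

theorem field_smooth (v : FieldModule U) : SmoothField (U : Set M) (extField U v) :=
  v.2

theorem fn_smooth (f : FnRing U) : SmoothFn (U : Set M) (extFn U f) := f.2

/-- The vector field `V` restricts to `v` on `U`. -/
def Rep (V : VField M) (v : FieldModule U) : Prop := ∀ y : U, V y = v y

/-- The function `F` restricts to `f` on `U`. -/
def RepFn (F : M → ℝ) (f : FnRing U) : Prop := ∀ y : U, F y = f y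

theorem Rep.ext (v : FieldModule U) : Rep (extField U v) v := fun y => extField_apply _ y

theorem RepFn.ext (f : FnRing U) : RepFn (extFn U f) f := fun y => extFn_apply _ y

theorem exists_rep {V : VField M} (hV : SmoothField (U : Set M) V) :
    ∃ v : FieldModule U, Rep V v :=
  ⟨⟨fun y => V y, hV.congr fun y hy => by simp [extField, show y ∈ U from hy]⟩, fun _ => rfl⟩

theorem exists_repFn {F : M → ℝ} (hF : SmoothFn (U : Set M) F) : ∃ f : FnRing U, RepFn F f :=
  ⟨⟨fun y => F y, hF.congr fun y hy => by simp [extFn, show y ∈ U from hy]⟩, fun _ => rfl⟩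

theorem Rep.smoothField {V : VField M} {v : FieldModule U} (h : Rep V v) :
    SmoothField (U : Set M) V :=
  (field_smooth v).congr fun y hy => by rw [h ⟨y, hy⟩]; exact (extField_apply _ ⟨y, hy⟩).symm

theorem RepFn.smoothFn {F : M → ℝ} {f : FnRing U} (h : RepFn F f) : SmoothFn (U : Set M) F :=
  (fn_smooth f).congr fun y hy => by rw [h ⟨y, hy⟩]; exact (extFn_apply _ ⟨y, hy⟩).symm

theorem Rep.eventuallyEq {V W : VField M} {v : FieldModule U} (hV : Rep V v) (hW : Rep W v)
    (y : U) : V =ᶠ[𝓝 (y : M)] W := by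
  filter_upwards [U.isOpen.mem_nhds y.2] with z hz
  rw [hV ⟨z, hz⟩, hW ⟨z, hz⟩]

theorem RepFn.eventuallyEq {F G : M → ℝ} {f : FnRing U} (hF : RepFn F f) (hG : RepFn G f)
    (y : U) : F =ᶠ[𝓝 (y : M)] G := by
  filter_upwards [U.isOpen.mem_nhds y.2] with z hz
  rw [hF ⟨z, hz⟩, hG ⟨z, hz⟩]

theorem Rep.unique {V : VField M} {v w : FieldModule U} (hv : Rep V v) (hw : Rep V w) : v = w :=
  Subtype.ext (funext fun y => (hv y).symm.trans (hw y))

theorem RepFn.unique {F : M → ℝ} {f g : FnRing U} (hf : RepFn F f) (hg : RepFn F g) : f = g :=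
  Subtype.ext (funext fun y => (hf y).symm.trans (hg y))

theorem Rep.add {V W : VField M} {v w : FieldModule U} (hV : Rep V v) (hW : Rep W w) :
    Rep (V + W) (v + w) := fun y => by
  rw [Pi.add_apply, hV, hW]; rfl

theorem Rep.smul {F : M → ℝ} {f : FnRing U} {V : VField M} {v : FieldModule U} (hF : RepFn F f)
    (hV : Rep V v) : Rep (F • V) (f • v) := fun y => by
  rw [Pi.smul_apply', hV, hF]; rfl

theorem mvfderiv_congr {F G : M → ℝ} {x : M} (h : F =ᶠ[𝓝 x] G) (v : TangentSpace (𝓡 5) x) :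
    mvfderiv (𝓡 5) F x v = mvfderiv (𝓡 5) G x v := by
  change mfderiv (𝓡 5) 𝓘(ℝ, ℝ) F x v = mfderiv (𝓡 5) 𝓘(ℝ, ℝ) G x v
  rw [h.mfderiv_eq]
  rfl

/-- Extension by zero need not be smooth across the boundary of U; the bracket at a point of U sees
only the germ there. -/
instance : Bracket (FieldModule U) (FieldModule U) where
  bracket v w := ⟨fun y => mlieBracket (𝓡 5) (extField U v) (extField U w) y,
    (SmoothField.lie U.isOpen (field_smooth v) (field_smooth w)).congr fun y hy => by
      simp [extField, show y ∈ U from hy]⟩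

instance : Bracket (FieldModule U) (FnRing U) where
  bracket v f := ⟨fun y => mvfderiv (𝓡 5) (extFn U f) y (v y),
    (SmoothFn.deriv U.isOpen (fn_smooth f) (field_smooth v)).congr fun y hy => by
      simp [extFn, extField, show y ∈ U from hy]⟩

theorem Rep.lie {V W : VField M} {v w : FieldModule U} (hV : Rep V v) (hW : Rep W w) :
    Rep (mlieBracket (𝓡 5) V W) ⁅v, w⁆ := fun y =>
  (hV.eventuallyEq (Rep.ext v) y).mlieBracket_vectorField_eq (hW.eventuallyEq (Rep.ext w) y)

theorem Rep.deriv {V : VField M} {v : FieldModule U} {F : M → ℝ} {f : FnRing U} (hV : Rep V v)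
    (hF : RepFn F f) : RepFn (fun y => mvfderiv (𝓡 5) F y (V y)) ⁅v, f⁆ := fun y => by
  change mvfderiv (𝓡 5) F y (V y) = mvfderiv (𝓡 5) (extFn U f) y (v y)
  rw [hV y, mvfderiv_congr (hF.eventuallyEq (RepFn.ext f) y)]

theorem lie_add_aux (u v w : FieldModule U) : ⁅u, v + w⁆ = ⁅u, v⁆ + ⁅u, w⁆ := by
  refine ((Rep.ext u).lie ((Rep.ext v).add (Rep.ext w))).unique fun y => ?_
  rw [mlieBracket_add_right ((field_smooth v).mdifferentiableAt U.isOpen y.2)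
    ((field_smooth w).mdifferentiableAt U.isOpen y.2)]
  rfl

theorem lie_swap_aux (v w : FieldModule U) : ⁅v, w⁆ = -⁅w, v⁆ :=
  Subtype.ext (funext fun _ => mlieBracket_swap_apply)

instance : LieRing (FieldModule U) where
  add_lie u v w := by
    rw [lie_swap_aux, lie_add_aux, lie_swap_aux w u, lie_swap_aux w v]
    abel
  lie_add := lie_add_aux
  lie_self v := Subtype.ext (funext fun y => by
    change mlieBracket (𝓡 5) (extField U v) (extField U v) y = 0
    simp)
  leibniz_lie u v w := by
    refine ((Rep.ext u).lie ((Rep.ext v).lie (Rep.ext w))).unique fun y => ?_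
    rw [leibniz_identity_mlieBracket_apply
      ((((field_smooth u).contMDiffAt U.isOpen y.2).of_le (by simpa using ENat.LEInfty.out)))
      ((((field_smooth v).contMDiffAt U.isOpen y.2).of_le (by simpa using ENat.LEInfty.out)))
      ((((field_smooth w).contMDiffAt U.isOpen y.2).of_le (by simpa using ENat.LEInfty.out)))]
    rw [((Rep.ext u).lie (Rep.ext v)).lie (Rep.ext w) y,
      (Rep.ext v).lie ((Rep.ext u).lie (Rep.ext w)) y]
    rfl

theorem fn_mdifferentiableAt (f : FnRing U) (y : U) :
    MDifferentiableAt (𝓡 5) 𝓘(ℝ, ℝ) (extFn U f) (y : M) :=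
  (fn_smooth f).mdifferentiableAt U.isOpen y.2

instance : LieRingModule (FieldModule U) (FnRing U) where
  add_lie u v f := Subtype.ext (funext fun y => by
    change mvfderiv (𝓡 5) (extFn U f) y (u y + v y) = _
    rw [map_add]; rfl)
  lie_add v f g := by
    have h : RepFn (extFn U f + extFn U g) (f + g) := fun y => by
      rw [Pi.add_apply, RepFn.ext f, RepFn.ext g]; rfl
    refine ((Rep.ext v).deriv h).unique fun y => ?_
    beta_reduce
    rw [mvfderiv_add (fn_mdifferentiableAt f y) (fn_mdifferentiableAt g y)]
    change mvfderiv (𝓡 5) (extFn U f) y _ + mvfderiv (𝓡 5) (extFn U g) y _ = _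
    rw [extField_apply]; rfl
  leibniz_lie u v f := by
    refine Subtype.ext (funext fun y => ?_)
    have h2 := mvfderiv_mlieBracket U.isOpen (field_smooth u) (field_smooth v) (fn_smooth f) y.2
    have h3 := ((Rep.ext u).lie (Rep.ext v)).deriv (RepFn.ext f) y
    have h4 := (Rep.ext u).deriv ((Rep.ext v).deriv (RepFn.ext f)) y
    have h5 := (Rep.ext v).deriv ((Rep.ext u).deriv (RepFn.ext f)) y
    beta_reduce at h3 h4 h5
    rw [h3, h4, h5] at h2
    change ⁅u, ⁅v, f⁆⁆ y = ⁅⁅u, v⁆, f⁆ y + ⁅v, ⁅u, f⁆⁆ y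
    rw [h2]; ring

instance : LieRinehartRing (FnRing U) (FieldModule U) where
  lie_smul_eq_mul' f g v := Subtype.ext (funext fun y => by
    change mvfderiv (𝓡 5) (extFn U g) y (f y • v y) = _
    rw [map_smul]; rfl)
  leibniz_mul_right' v f g := by
    have h : RepFn (extFn U f * extFn U g) (f * g) := fun y => by
      rw [Pi.mul_apply, RepFn.ext f, RepFn.ext g]; rfl
    refine ((Rep.ext v).deriv h).unique fun y => ?_
    beta_reduce
    rw [mvfderiv_mul (fn_mdifferentiableAt f y) (fn_mdifferentiableAt g y)]
    change extFn U f y * mvfderiv (𝓡 5) (extFn U g) y _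
      + extFn U g y * mvfderiv (𝓡 5) (extFn U f) y _ = _
    rw [extField_apply, extFn_apply, extFn_apply, mul_comm (g y)]; rfl
  leibniz_smul_right' v w f := by
    refine ((Rep.ext v).lie ((Rep.ext w).smul (RepFn.ext f))).unique fun y => ?_
    rw [mlieBracket_smul_right (fn_mdifferentiableAt f y)
      ((field_smooth w).mdifferentiableAt U.isOpen y.2), add_comm, extField_apply, extField_apply,
      extFn_apply]
    rfl

end LocalAlgebra

/-! ### Brackets of spans -/

section LieSpan

variable {A L : Type*} [CommRing A] [LieRing L] [Module A L] [LieRingModule L A]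
  [LieRinehartRing A L]

theorem lie_mem_of_mem_span {S T : Set L} {N : Submodule A L} (hS : S ⊆ N) (hT : T ⊆ N)
    (h : ∀ s ∈ S, ∀ t ∈ T, ⁅s, t⁆ ∈ N) {X Y : L} (hX : X ∈ Submodule.span A S)
    (hY : Y ∈ Submodule.span A T) : ⁅X, Y⁆ ∈ N := by
  induction hX using Submodule.span_induction with
  | mem s hs =>
    induction hY using Submodule.span_induction with
    | mem t ht => exact h s hs t ht
    | zero => simp
    | add Y Y' _ _ h1 h2 => rw [lie_add]; exact N.add_mem h1 h2
    | smul a Y hY h1 =>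
      rw [leibniz_smul_right]
      exact N.add_mem (N.smul_mem _ h1) (N.smul_mem _ (Submodule.span_le.2 hT hY))
  | zero => simp
  | add X X' _ _ h1 h2 => rw [add_lie]; exact N.add_mem h1 h2
  | smul a X hX h1 =>
    rw [smul_lie_eq]
    exact N.sub_mem (N.smul_mem _ h1) (N.smul_mem _ (Submodule.span_le.2 hS hX))

end LieSpan

/-! ### From pointwise independence to bases of fields -/

section Frames

variable {M : Type*} [TopologicalSpace M] [ChartedSpace E5 M] [IsManifold (𝓡 5) ∞ M]
  {H : Distrib M} {U : Opens M}

instance finiteDimensional_tangentSpace (x : M) : FiniteDimensional ℝ (TangentSpace (𝓡 5) x) :=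
  inferInstanceAs (FiniteDimensional ℝ E5)

theorem finrank_tangentSpace (x : M) : Module.finrank ℝ (TangentSpace (𝓡 5) x) = 5 := by
  change Module.finrank ℝ E5 = 5
  simp

theorem IsSectionOn.mono {D : Distrib M} {O O' : Set M} {V : VField M} (h : IsSectionOn D O V)
    (hO : O' ⊆ O) : IsSectionOn D O' V :=
  ⟨h.1.mono hO, fun y hy => h.2 y (hO hy)⟩

theorem eval_mem_of_mem_span {S : Set (FieldModule U)} {y : U}
    {P : Submodule ℝ (TangentSpace (𝓡 5) (y : M))} (hS : ∀ s ∈ S, s y ∈ P) {X : FieldModule U}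
    (hX : X ∈ Submodule.span (FnRing U) S) : X y ∈ P := by
  induction hX using Submodule.span_induction with
  | mem s hs => exact hS s hs
  | zero => exact P.zero_mem
  | add X Y _ _ h1 h2 => exact P.add_mem h1 h2
  | smul a X _ h1 => exact P.smul_mem _ h1

theorem FieldModule.sum_apply {ι : Type*} (s : Finset ι) (V : ι → FieldModule U) (y : U) :
    (∑ i ∈ s, V i) y = ∑ i ∈ s, V i y := by
  classical
  induction s using Finset.induction_on with
  | empty => simp
  | insert i s hi ih => rw [Finset.sum_insert hi, Finset.sum_insert hi, ← ih]; rfl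

/-- Pointwise linearly independent vector fields span the fields with values in their pointwise
span. -/
theorem mem_span_of_forall {k : ℕ} {b : Fin k → FieldModule U}
    (hb : ∀ y : U, LinearIndependent ℝ (fun i => b i y)) {V : FieldModule U}
    (hV : ∀ y : U, V y ∈ Submodule.span ℝ (Set.range fun i => b i y)) :
    V ∈ Submodule.span (FnRing U) (Set.range b) := by
  choose a ha using fun y => (Submodule.mem_span_range_iff_exists_fun ℝ).1 (hV y)
  have hsm (i : Fin k) : SmoothFn (U : Set M) (extFn U fun y => a y i) := by
    refine smoothFn_coeff (e := fun i => extField U (b i)) (V := extField U V)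
      (a := fun i => extFn U fun y => a y i) U.isOpen (fun i => field_smooth (b i)) ?_
      (field_smooth V) ?_ i
    · intro y hy
      simpa using! (funext fun i => extField_apply (b i) ⟨y, hy⟩ :
        (fun i => extField U (b i) y) = _) ▸ hb ⟨y, hy⟩
    · intro y hy
      have h := ha ⟨y, hy⟩
      have e1 := extField_apply V ⟨y, hy⟩
      have e2 (i) := extField_apply (b i) ⟨y, hy⟩
      have e3 (i) := extFn_apply (fun y => a y i) ⟨y, hy⟩
      dsimp only at e1 e2 e3
      simp only [e1, e2, e3]
      exact h.symm
  have hsum : V = ∑ i, (⟨fun y => a y i, hsm i⟩ : FnRing U) • b i := by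
    refine Subtype.ext (funext fun y => ?_)
    change V y = (∑ i, (⟨fun y => a y i, hsm i⟩ : FnRing U) • b i) y
    rw [← ha y, FieldModule.sum_apply]
    rfl
  rw [hsum]
  exact Submodule.sum_mem _ fun i _ => Submodule.smul_mem _ _ (Submodule.subset_span ⟨i, rfl⟩)

/-- The pointwise basis of the tangent space. -/
def tangentBasis (x : M) {v : Fin 5 → TangentSpace (𝓡 5) x} (hv : LinearIndependent ℝ v) :
    Module.Basis (Fin 5) ℝ (TangentSpace (𝓡 5) x) :=
  basisOfLinearIndependentOfCardEqFinrank hv (by rw [finrank_tangentSpace]; simp)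

@[simp] theorem tangentBasis_apply (x : M) {v : Fin 5 → TangentSpace (𝓡 5) x}
    (hv : LinearIndependent ℝ v) (i : Fin 5) : tangentBasis x hv i = v i := by
  simp [tangentBasis]

/-- Five pointwise linearly independent vector fields form a basis. -/
def fieldBasis {b : Fin 5 → FieldModule U} (hb : ∀ y : U, LinearIndependent ℝ (fun i => b i y)) :
    Module.Basis (Fin 5) (FnRing U) (FieldModule U) :=
  Module.Basis.mk (v := b)
    (Fintype.linearIndependent_iff.2 fun g hg i => Subtype.ext (funext fun y => by
      refine Fintype.linearIndependent_iff.1 (hb y) (fun i => g i y) ?_ i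
      have h := congrArg (fun V : FieldModule U => V y) hg
      beta_reduce at h
      rw [FieldModule.sum_apply] at h
      exact h))
    (fun V _ => mem_span_of_forall hb fun y => by
      have h := (tangentBasis _ (hb y)).span_eq
      have h2 : ⇑(tangentBasis _ (hb y)) = fun i => b i y :=
        funext fun i => tangentBasis_apply _ _ _
      rw [h2] at h
      rw [h]
      trivial)

@[simp] theorem fieldBasis_apply {b : Fin 5 → FieldModule U}
    (hb : ∀ y : U, LinearIndependent ℝ (fun i => b i y)) (i : Fin 5) :
    fieldBasis hb i = b i := by
  simp [fieldBasis]

end Frames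

/-! ### Constants and restriction to smaller open sets -/

section Restriction

variable {M : Type*} [TopologicalSpace M] [ChartedSpace E5 M] [IsManifold (𝓡 5) ∞ M]
  {H : Distrib M} {U U' : Opens M}

/-- The constant functions. -/
def FnRing.const (a : ℝ) : FnRing U :=
  ⟨fun _ => a, (contMDiffOn_const (c := a)).congr fun y hy => by
    simp [extFn, show y ∈ U from hy]⟩

/-- Restriction of vector fields. -/
def FieldModule.restr (h : U' ≤ U) (v : FieldModule U) : FieldModule U' :=
  ⟨fun y => v ⟨y, h y.2⟩, (SmoothField.mono (field_smooth v) h).congr fun y hy => by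
    simp [extField, show y ∈ U' from hy, h (show y ∈ U' from hy)]⟩

theorem FieldModule.restr_apply (h : U' ≤ U) (v : FieldModule U) (y : U') :
    FieldModule.restr h v y = v ⟨y, h y.2⟩ := rfl

theorem Rep.restr (h : U' ≤ U) {V : VField M} {v : FieldModule U} (hv : Rep V v) :
    Rep V (FieldModule.restr h v) := fun y => hv ⟨y, h y.2⟩

theorem restr_lie (h : U' ≤ U) (v w : FieldModule U) :
    FieldModule.restr h ⁅v, w⁆ = ⁅FieldModule.restr h v, FieldModule.restr h w⁆ :=
  (Rep.restr h ((Rep.ext v).lie (Rep.ext w))).unique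
    ((Rep.restr h (Rep.ext v)).lie (Rep.restr h (Rep.ext w)))

end Restriction

/-! ### Adapted frames of generic distributions -/

section FrameDef

variable {M : Type*} [TopologicalSpace M] [ChartedSpace E5 M] [IsManifold (𝓡 5) ∞ M]

/-- An adapted frame of a generic rank two distribution. -/
structure Frame (H : Distrib M) (U : Opens M) extends
    AdaptedBasis (FnRing U) (FieldModule U) where
  li : ∀ y : U, LinearIndependent ℝ (fun i => b i y)
  eq_span : ∀ y : U, H y = Submodule.span ℝ {b 0 y, b 1 y}

/-- The five fields obtained from two fields by iterated brackets. -/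
def iterated {U : Opens M} (e₁ e₂ : FieldModule U) : Fin 5 → FieldModule U :=
  ![e₁, e₂, ⁅e₁, e₂⁆, ⁅e₁, ⁅e₁, e₂⁆⁆, ⁅e₂, ⁅e₁, e₂⁆⁆]

/-- The frame generated by two sections. -/
def Frame.mk' {H : Distrib M} {U : Opens M} (e₁ e₂ : FieldModule U)
    (hli : ∀ y : U, LinearIndependent ℝ (fun i => iterated e₁ e₂ i y))
    (hs : ∀ y : U, H y = Submodule.span ℝ {e₁ y, e₂ y}) : Frame H U where
  b := fieldBasis hli
  lie_zero_one := by simp [iterated]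
  lie_zero_two := by simp [iterated]
  lie_one_two := by simp [iterated]
  li y := by simpa using hli y
  eq_span y := by simpa [iterated] using hs y

variable {H : Distrib M} {U U' : Opens M}

theorem Frame.b_eq_iterated (F : Frame H U) (i : Fin 5) : F.b i = iterated (F.b 0) (F.b 1) i := by
  fin_cases i
  · rfl
  · rfl
  · exact F.lie_zero_one.symm
  · change F.b 3 = ⁅F.b 0, ⁅F.b 0, F.b 1⁆⁆
    rw [F.lie_zero_one, F.lie_zero_two]
  · change F.b 4 = ⁅F.b 1, ⁅F.b 0, F.b 1⁆⁆
    rw [F.lie_zero_one, F.lie_one_two]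

theorem iterated_restr (h : U' ≤ U) (e₁ e₂ : FieldModule U) (i : Fin 5) :
    iterated (FieldModule.restr h e₁) (FieldModule.restr h e₂) i
      = FieldModule.restr h (iterated e₁ e₂ i) := by
  fin_cases i
  · rfl
  · rfl
  · exact (restr_lie h _ _).symm
  · change ⁅_, ⁅_, _⁆⁆ = FieldModule.restr h ⁅_, ⁅_, _⁆⁆
    rw [restr_lie, restr_lie]
  · change ⁅_, ⁅_, _⁆⁆ = FieldModule.restr h ⁅_, ⁅_, _⁆⁆
    rw [restr_lie, restr_lie]

/-- Restriction of frames. -/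
def Frame.restr (h : U' ≤ U) (F : Frame H U) : Frame H U' :=
  Frame.mk' (FieldModule.restr h (F.b 0)) (FieldModule.restr h (F.b 1))
    (fun y => by
      have h1 := F.li ⟨y, h y.2⟩
      simp only [iterated_restr, FieldModule.restr_apply, ← F.b_eq_iterated]
      exact h1)
    (fun y => F.eq_span ⟨y, h y.2⟩)

theorem exists_rep_of_section {D : Distrib M} {V : VField M} (hV : IsSectionOn D (U : Set M) V) :
    ∃ v : FieldModule U, Rep V v ∧ ∀ y : U, v y ∈ D y := by
  obtain ⟨v, hv⟩ := exists_rep (U := U) hV.1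
  exact ⟨v, hv, fun y => hv y ▸ hV.2 y y.2⟩

theorem mem_span_pair {e₁ e₂ : FieldModule U}
    (hli : ∀ y : U, LinearIndependent ℝ ![e₁ y, e₂ y]) {V : FieldModule U}
    (hV : ∀ y : U, V y ∈ Submodule.span ℝ {e₁ y, e₂ y}) :
    V ∈ Submodule.span (FnRing U) {e₁, e₂} := by
  have e (y : U) : (fun i => ![e₁, e₂] i y) = ![e₁ y, e₂ y] := by
    ext i; fin_cases i <;> rfl
  have h := mem_span_of_forall (b := ![e₁, e₂]) (fun y => by rw [e]; exact hli y) (V := V)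
    (fun y => by rw [e]; simpa [Matrix.range_cons, Set.pair_comm] using hV y)
  simpa [Matrix.range_cons, Set.pair_comm] using h

/-- By the Leibniz rule, one bracket of sections stays in the module generated by e₁, e₂, [e₁, e₂],
and a further bracket with a section stays in that of all five fields. -/
theorem eval_iterated_mem {e₁ e₂ : FieldModule U} {V W Z : FieldModule U}
    (hV : V ∈ Submodule.span (FnRing U) {e₁, e₂}) (hW : W ∈ Submodule.span (FnRing U) {e₁, e₂})
    (hZ : Z ∈ Submodule.span (FnRing U) {e₁, e₂}) (y : U) :
    V y ∈ Submodule.span ℝ (Set.range fun i => iterated e₁ e₂ i y) ∧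
    ⁅V, W⁆ y ∈ Submodule.span ℝ (Set.range fun i => iterated e₁ e₂ i y) ∧
    ⁅V, ⁅W, Z⁆⁆ y ∈ Submodule.span ℝ (Set.range fun i => iterated e₁ e₂ i y) := by
  set N3 := Submodule.span (FnRing U) {e₁, e₂, ⁅e₁, e₂⁆} with hN3
  set N5 := Submodule.span (FnRing U) (Set.range (iterated e₁ e₂)) with hN5
  have i5 (i : Fin 5) : iterated e₁ e₂ i ∈ N5 := Submodule.subset_span ⟨i, rfl⟩
  have m0 : e₁ ∈ N5 := i5 0
  have m1 : e₂ ∈ N5 := i5 1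
  have m2 : ⁅e₁, e₂⁆ ∈ N5 := i5 2
  have m3 : ⁅e₁, ⁅e₁, e₂⁆⁆ ∈ N5 := i5 3
  have m4 : ⁅e₂, ⁅e₁, e₂⁆⁆ ∈ N5 := i5 4
  have n0 : e₁ ∈ N3 := Submodule.subset_span (by simp)
  have n1 : e₂ ∈ N3 := Submodule.subset_span (by simp)
  have n2 : ⁅e₁, e₂⁆ ∈ N3 := Submodule.subset_span (by simp)
  have h1 {X Y : FieldModule U} (hX : X ∈ Submodule.span (FnRing U) {e₁, e₂})
      (hY : Y ∈ Submodule.span (FnRing U) {e₁, e₂}) : ⁅X, Y⁆ ∈ N3 := by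
    refine lie_mem_of_mem_span ?_ ?_ ?_ hX hY
    · rintro s (rfl | rfl) <;> assumption
    · rintro s (rfl | rfl) <;> assumption
    · rintro s (rfl | rfl) t (rfl | rfl)
      · simp
      · exact n2
      · rw [← lie_skew]; exact N3.neg_mem n2
      · simp
  have h2 : ⁅V, ⁅W, Z⁆⁆ ∈ N5 := by
    refine lie_mem_of_mem_span ?_ ?_ ?_ hV (h1 hW hZ)
    · rintro s (rfl | rfl) <;> assumption
    · rintro s (rfl | rfl | rfl) <;> assumption
    · rintro s (rfl | rfl) t (rfl | rfl | rfl)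
      · simp
      · exact m2
      · exact m3
      · rw [← lie_skew]; exact N5.neg_mem m2
      · simp
      · exact m4
  have h3 : N3 ≤ N5 := Submodule.span_le.2 (by rintro s (rfl | rfl | rfl) <;> assumption)
  have h4 : Submodule.span (FnRing U) {e₁, e₂} ≤ N5 :=
    Submodule.span_le.2 (by rintro s (rfl | rfl) <;> assumption)
  have h5 {X : FieldModule U} (hX : X ∈ N5) :
      X y ∈ Submodule.span ℝ (Set.range fun i => iterated e₁ e₂ i y) :=
    eval_mem_of_mem_span (by rintro _ ⟨i, rfl⟩; exact Submodule.subset_span ⟨i, rfl⟩) hX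
  exact ⟨h5 (h4 hV), h5 (h3 (h1 hV hW)), h5 h2⟩

theorem mem_span_iterated {e₁ e₂ : FieldModule U}
    (hs : ∀ y : U, H y = Submodule.span ℝ {e₁ y, e₂ y})
    (hl : ∀ y : U, LinearIndependent ℝ ![e₁ y, e₂ y]) (y : U) {V W Z : VField M}
    (hV : IsLocalSection H y V) (hW : IsLocalSection H y W) (hZ : IsLocalSection H y Z) :
    V y ∈ Submodule.span ℝ (Set.range fun i => iterated e₁ e₂ i y) ∧
    mlieBracket (𝓡 5) V W y ∈ Submodule.span ℝ (Set.range fun i => iterated e₁ e₂ i y) ∧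
    mlieBracket (𝓡 5) V (mlieBracket (𝓡 5) W Z) y ∈
      Submodule.span ℝ (Set.range fun i => iterated e₁ e₂ i y) := by
  obtain ⟨O₁, hO₁, hy₁, hV⟩ := hV
  obtain ⟨O₂, hO₂, hy₂, hW⟩ := hW
  obtain ⟨O₃, hO₃, hy₃, hZ⟩ := hZ
  obtain ⟨U', hU', hy', h1, h2, h3⟩ : ∃ U' : Opens M, ∃ _ : U' ≤ U, (y : M) ∈ U' ∧
      (U' : Set M) ⊆ O₁ ∧ (U' : Set M) ⊆ O₂ ∧ (U' : Set M) ⊆ O₃ :=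
    ⟨U ⊓ ⟨O₁, hO₁⟩ ⊓ ⟨O₂, hO₂⟩ ⊓ ⟨O₃, hO₃⟩, fun z hz => hz.1.1.1, ⟨⟨⟨y.2, hy₁⟩, hy₂⟩, hy₃⟩,
      fun z hz => hz.1.1.2, fun z hz => hz.1.2, fun z hz => hz.2⟩
  obtain ⟨v, hv, hv'⟩ := exists_rep_of_section (hV.mono h1)
  obtain ⟨w, hw, hw'⟩ := exists_rep_of_section (hW.mono h2)
  obtain ⟨u, hu, hu'⟩ := exists_rep_of_section (hZ.mono h3)
  have hmem {v : FieldModule U'} (hv' : ∀ y : U', v y ∈ H y) :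
      v ∈ Submodule.span (FnRing U') {FieldModule.restr hU' e₁, FieldModule.restr hU' e₂} :=
    mem_span_pair (e₁ := FieldModule.restr hU' e₁) (e₂ := FieldModule.restr hU' e₂)
      (fun z => hl ⟨z, hU' z.2⟩) (fun z => (hs ⟨z, hU' z.2⟩).le (hv' z))
  have h := eval_iterated_mem (hmem hv') (hmem hw') (hmem hu') ⟨y, hy'⟩
  simp only [iterated_restr] at h
  rw [← hv ⟨y, hy'⟩, ← (hv.lie hw) ⟨y, hy'⟩, ← (hv.lie (hw.lie hu)) ⟨y, hy'⟩] at h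
  exact h

/-- Generic distributions have adapted frames. -/
theorem IsGeneric.exists_frame (hH : IsGeneric H) (x : M) :
    ∃ (U : Opens M), x ∈ U ∧ Nonempty (Frame H U) := by
  obtain ⟨O, ξ, η, hO, hx, hξ, hη, hsp⟩ := hH.1 x
  obtain ⟨U, rfl⟩ : ∃ U : Opens M, (U : Set M) = O := ⟨⟨O, hO⟩, rfl⟩
  obtain ⟨e₁, he₁, -⟩ := exists_rep_of_section hξ
  obtain ⟨e₂, he₂, -⟩ := exists_rep_of_section hη
  have hs (y : U) : H y = Submodule.span ℝ {e₁ y, e₂ y} := by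
    rw [(hsp y y.2).2, he₁ y, he₂ y]
  have hl (y : U) : LinearIndependent ℝ ![e₁ y, e₂ y] := by
    have h := (hsp y y.2).1
    rwa [he₁ y, he₂ y] at h
  refine ⟨U, hx, ⟨Frame.mk' e₁ e₂ (fun y => ?_) hs⟩⟩
  -- Genericity makes the five fields span a five-dimensional space, so they are independent.
  refine linearIndependent_of_top_le_span_of_card_eq_finrank ?_
    (by rw [finrank_tangentSpace]; simp)
  rw [← hH.2 y, Submodule.span_le]
  rintro _ ((⟨V, hV, rfl⟩ | ⟨V, W, hV, hW, rfl⟩) | ⟨V, W, Z, hV, hW, hZ, rfl⟩)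
  · exact (mem_span_iterated hs hl y hV hV hV).1
  · exact (mem_span_iterated hs hl y hV hW hV).2.1
  · exact (mem_span_iterated hs hl y hV hW hZ).2.2

theorem IsGeneric.exists_frame_le (hH : IsGeneric H) {x : M} {O : Set M} (hO : O ∈ 𝓝 x) :
    ∃ (U : Opens M), x ∈ U ∧ (U : Set M) ⊆ O ∧ Nonempty (Frame H U) := by
  obtain ⟨U, hx, ⟨F⟩⟩ := hH.exists_frame x
  obtain ⟨O', hO', hO'', hx'⟩ := mem_nhds_iff.1 hO
  exact ⟨U ⊓ ⟨O', hO''⟩, ⟨hx, hx'⟩, fun y hy => hO' hy.2, ⟨F.restr inf_le_left⟩⟩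

end FrameDef

/-! ### Membership and Levi brackets in frame coordinates -/

section FramePointwise

variable {M : Type*} [TopologicalSpace M] [ChartedSpace E5 M] [IsManifold (𝓡 5) ∞ M]
  {H : Distrib M} {U U' : Opens M}

namespace Frame

variable (F : Frame H U)

/-- The basis of a tangent space given by a frame. -/
def B (y : U) : Module.Basis (Fin 5) ℝ (TangentSpace (𝓡 5) (y : M)) := tangentBasis _ (F.li y)

@[simp] theorem B_apply (y : U) (i : Fin 5) : F.B y i = F.b i y := tangentBasis_apply _ _ _

theorem apply_eq (V : FieldModule U) (y : U) : V y = F.c 0 V y • F.b 0 y + F.c 1 V y • F.b 1 y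
    + F.c 2 V y • F.b 2 y + F.c 3 V y • F.b 3 y + F.c 4 V y • F.b 4 y :=
  congrArg (fun W : FieldModule U => W y) (F.sum_c V)

theorem repr_eq (V : FieldModule U) (y : U) (i : Fin 5) : (F.B y).repr (V y) i = F.c i V y := by
  rw [F.apply_eq V y]
  simp only [← B_apply, map_add, map_smul, Module.Basis.repr_self, Finsupp.add_apply,
    Finsupp.smul_apply, Finsupp.single_apply, smul_eq_mul]
  fin_cases i <;> simp [-map_zero, -map_one]

theorem mem_H_iff (y : U) (v : TangentSpace (𝓡 5) (y : M)) :
    v ∈ H y ↔ (F.B y).repr v 2 = 0 ∧ (F.B y).repr v 3 = 0 ∧ (F.B y).repr v 4 = 0 := by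
  rw [F.eq_span, Submodule.mem_span_pair]
  constructor
  · rintro ⟨s, t, rfl⟩
    simp [-map_zero, -map_one, ← B_apply]
  · rintro ⟨h2, h3, h4⟩
    refine ⟨(F.B y).repr v 0, (F.B y).repr v 1, ?_⟩
    conv_rhs => rw [← (F.B y).sum_repr v]
    simp [-map_zero, -map_one, Fin.sum_univ_five, h2, h3, h4]

theorem mem_H_iff_c (y : U) (V : FieldModule U) :
    V y ∈ H y ↔ F.c 2 V y = 0 ∧ F.c 3 V y = 0 ∧ F.c 4 V y = 0 := by
  simp only [F.mem_H_iff y, repr_eq]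

theorem mem_H_module (V : FieldModule U) : V ∈ F.H ↔ ∀ y : U, V y ∈ H y := by
  simp only [F.mem_H_iff_c, F.mem_H]
  constructor
  · rintro ⟨h2, h3, h4⟩ y
    rw [h2, h3, h4]; exact ⟨rfl, rfl, rfl⟩
  · intro h
    exact ⟨Subtype.ext (funext fun y => (h y).1), Subtype.ext (funext fun y => (h y).2.1),
      Subtype.ext (funext fun y => (h y).2.2)⟩

theorem restr_b (h : U' ≤ U) (i : Fin 5) : (F.restr h).b i = FieldModule.restr h (F.b i) := by
  rw [(F.restr h).b_eq_iterated, F.b_eq_iterated, ← iterated_restr]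
  have h0 : (F.restr h).b 0 = FieldModule.restr h (F.b 0) := by
    simp [-map_zero, -map_one, Frame.restr, Frame.mk', iterated]
  have h1 : (F.restr h).b 1 = FieldModule.restr h (F.b 1) := by
    simp [-map_zero, -map_one, Frame.restr, Frame.mk', iterated]
  rw [h0, h1]

theorem restr_B (h : U' ≤ U) (y : U') : (F.restr h).B y = F.B ⟨y, h y.2⟩ :=
  Module.Basis.eq_of_apply_eq fun i => by
    rw [B_apply, B_apply, restr_b, FieldModule.restr_apply]

end Frame

theorem IsLocalSection.exists_opens {D : Distrib M} {x : M} {V : VField M}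
    (h : IsLocalSection D x V) : ∃ O : Opens M, x ∈ O ∧ IsSectionOn D (O : Set M) V := by
  obtain ⟨O, hO, hx, hV⟩ := h
  exact ⟨⟨O, hO⟩, hx, hV⟩

theorem IsSectionOn.isLocalSection {D : Distrib M} {x : M} {V : VField M}
    (h : IsSectionOn D (U : Set M) V) (hx : x ∈ U) : IsLocalSection D x V :=
  ⟨U, U.isOpen, hx, h⟩

theorem Rep.isSectionOn {D : Distrib M} {V : VField M} {v : FieldModule U} (h : Rep V v)
    (hv : ∀ y : U, v y ∈ D y) : IsSectionOn D (U : Set M) V :=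
  ⟨h.smoothField, fun y hy => by rw [h ⟨y, hy⟩]; exact hv ⟨y, hy⟩⟩

/-- Two local sections are represented on a common open set. -/
theorem exists_rep_two {D E : Distrib M} (y : U) {V W : VField M}
    (hV : IsLocalSection D y V) (hW : IsLocalSection E y W) {N : Set M} (hN : N ∈ 𝓝 (y : M)) :
    ∃ (U' : Opens M) (_ : U' ≤ U) (_ : (y : M) ∈ U') (v w : FieldModule U'), Rep V v ∧ Rep W w ∧
      (∀ z : U', v z ∈ D z) ∧ (∀ z : U', w z ∈ E z) ∧ (U' : Set M) ⊆ N := by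
  obtain ⟨O', hO', hO'', hy''⟩ := mem_nhds_iff.1 hN
  obtain ⟨O₁, hy₁, hV⟩ := hV.exists_opens
  obtain ⟨O₂, hy₂, hW⟩ := hW.exists_opens
  obtain ⟨U', hU', hy', h1, h2, h3⟩ : ∃ U' : Opens M, ∃ _ : U' ≤ U, (y : M) ∈ U' ∧
      (U' : Set M) ⊆ O₁ ∧ (U' : Set M) ⊆ O₂ ∧ (U' : Set M) ⊆ N :=
    ⟨U ⊓ O₁ ⊓ O₂ ⊓ ⟨O', hO''⟩, fun z hz => hz.1.1.1, ⟨⟨⟨y.2, hy₁⟩, hy₂⟩, hy''⟩,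
      fun z hz => hz.1.1.2, fun z hz => hz.1.2, fun z hz => hO' hz.2⟩
  obtain ⟨v, hv, hv'⟩ := exists_rep_of_section (hV.mono h1)
  obtain ⟨w, hw, hw'⟩ := exists_rep_of_section (hW.mono h2)
  exact ⟨U', hU', hy', v, w, hv, hw, hv', hw', h3⟩

namespace Frame

variable (F : Frame H U)

theorem lie_mem_span (y : U) {V W : VField M}
    (hV : IsLocalSection H y V) (hW : IsLocalSection H y W) :
    (F.B y).repr (mlieBracket (𝓡 5) V W y) 2 =
      (F.B y).repr (V y) 0 * (F.B y).repr (W y) 1 - (F.B y).repr (V y) 1 * (F.B y).repr (W y) 0 ∧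
    (F.B y).repr (mlieBracket (𝓡 5) V W y) 3 = 0 ∧
    (F.B y).repr (mlieBracket (𝓡 5) V W y) 4 = 0 := by
  obtain ⟨U', hU', hy', v, w, hv, hw, hv', hw', -⟩ :=
    exists_rep_two y hV hW Filter.univ_mem
  have hb := F.restr_B hU' ⟨y, hy'⟩
  have h := (F.restr hU').lie_mem_mem (((F.restr hU').mem_H_module v).2 hv')
    (((F.restr hU').mem_H_module w).2 hw')
  change (F.restr hU').B ⟨y, hy'⟩ = F.B y at hb
  rw [hv ⟨y, hy'⟩, hw ⟨y, hy'⟩, hv.lie hw ⟨y, hy'⟩, ← hb]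
  simp only [repr_eq, h]
  exact ⟨rfl, rfl, rfl⟩

theorem derived_eq (y : U) : derived H (y : M) = Submodule.span ℝ {F.b 0 y, F.b 1 y, F.b 2 y} := by
  have hl (i : Fin 5) (hi : F.b i ∈ F.H) : IsLocalSection H (y : M) (extField U (F.b i)) :=
    ((Rep.ext (F.b i)).isSectionOn ((F.mem_H_module _).1 hi)).isLocalSection y.2
  apply le_antisymm
  · rw [derived, Submodule.span_le]
    rintro _ (⟨V, ⟨O, hO, hy, hV⟩, rfl⟩ | ⟨V, W, hV, hW, rfl⟩)
    · have h := hV.2 y hy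
      rw [F.eq_span] at h
      exact Submodule.span_mono (by simp [-map_zero, -map_one, Set.insert_subset_iff]) h
    · obtain ⟨-, h3, h4⟩ := F.lie_mem_span y hV hW
      rw [SetLike.mem_coe, ← (F.B y).sum_repr (mlieBracket (𝓡 5) V W y)]
      simp only [Fin.sum_univ_five, h3, h4, zero_smul, add_zero, B_apply]
      exact add_mem (add_mem (Submodule.smul_mem _ _
          (Submodule.subset_span (by simp [-map_zero, -map_one])))
        (Submodule.smul_mem _ _ (Submodule.subset_span (by simp [-map_zero, -map_one]))))
        (Submodule.smul_mem _ _ (Submodule.subset_span (by simp [-map_zero, -map_one])))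
  · rw [Submodule.span_le]
    rintro _ (rfl | rfl | rfl)
    · exact Submodule.subset_span (.inl ⟨_, hl 0 F.b_zero_mem, (Rep.ext (F.b 0) y).symm⟩)
    · exact Submodule.subset_span (.inl ⟨_, hl 1 F.b_one_mem, (Rep.ext (F.b 1) y).symm⟩)
    · refine Submodule.subset_span (.inr ⟨_, _, hl 0 F.b_zero_mem, hl 1 F.b_one_mem, ?_⟩)
      rw [(Rep.ext (F.b 0)).lie (Rep.ext (F.b 1)) y, F.lie_zero_one]

theorem mem_derived_iff (y : U) (v : TangentSpace (𝓡 5) (y : M)) :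
    v ∈ derived H (y : M) ↔ (F.B y).repr v 3 = 0 ∧ (F.B y).repr v 4 = 0 := by
  rw [F.derived_eq, Submodule.mem_span_triple]
  constructor
  · rintro ⟨s, t, u, rfl⟩
    simp [-map_zero, -map_one, ← B_apply]
  · rintro ⟨h3, h4⟩
    refine ⟨(F.B y).repr v 0, (F.B y).repr v 1, (F.B y).repr v 2, ?_⟩
    conv_rhs => rw [← (F.B y).sum_repr v]
    simp [-map_zero, -map_one, Fin.sum_univ_five, h3, h4]

theorem lie_derived (y : U) {V W : VField M}
    (hV : IsLocalSection H y V) (hW : IsLocalSection (derived H) y W) :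
    (F.B y).repr (mlieBracket (𝓡 5) V W y) 3 = (F.B y).repr (V y) 0 * (F.B y).repr (W y) 2 ∧
    (F.B y).repr (mlieBracket (𝓡 5) V W y) 4 = (F.B y).repr (V y) 1 * (F.B y).repr (W y) 2 := by
  obtain ⟨U', hU', hy', v, w, hv, hw, hv', hw', -⟩ :=
    exists_rep_two y hV hW Filter.univ_mem
  have hb := F.restr_B hU' ⟨y, hy'⟩
  have hc (z : U') := ((F.restr hU').mem_derived_iff z _).1 (hw' z)
  simp only [repr_eq] at hc
  have h := (F.restr hU').lie_mem_eq (((F.restr hU').mem_H_module v).2 hv')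
    (Subtype.ext (funext fun z => (hc z).1)) (Subtype.ext (funext fun z => (hc z).2))
  change (F.restr hU').B ⟨y, hy'⟩ = F.B y at hb
  rw [hv ⟨y, hy'⟩, hw ⟨y, hy'⟩, hv.lie hw ⟨y, hy'⟩, ← hb]
  simp only [repr_eq, h]
  exact ⟨rfl, rfl⟩

end Frame

theorem H_le_derived (hH : IsGeneric H) (x : M) : H x ≤ derived H x := by
  obtain ⟨U, hx, ⟨F⟩⟩ := hH.exists_frame x
  intro v hv
  exact (F.mem_derived_iff ⟨x, hx⟩ v).2 ((F.mem_H_iff ⟨x, hx⟩ v).1 hv).2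

/-- The epsilon choice is meaningful as soon as the bracket class is some function φ of the two
values at x. -/
theorem bracketMod_eq {D E F : Distrib M} {x : M}
    {φ : TangentSpace (𝓡 5) x → TangentSpace (𝓡 5) x → TangentSpace (𝓡 5) x ⧸ F x}
    (h : ∀ V W : VField M, IsLocalSection D x V → IsLocalSection E x W →
      (F x).mkQ (mlieBracket (𝓡 5) V W x) = φ (V x) (W x))
    {V W : VField M} (hV : IsLocalSection D x V) (hW : IsLocalSection E x W) :
    bracketMod D E F x (V x) (W x) = (F x).mkQ (mlieBracket (𝓡 5) V W x) := by
  refine Classical.epsilon_spec (p := fun c => ∀ V' W' : VField M, IsLocalSection D x V' →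
    IsLocalSection E x W' → V' x = V x → W' x = W x → c = (F x).mkQ (mlieBracket (𝓡 5) V' W' x))
    ⟨φ (V x) (W x), ?_⟩ V W hV hW rfl rfl
  intro V' W' hV' hW' e1 e2
  rw [h V' W' hV' hW', e1, e2]

theorem levi11_eq (hH : IsGeneric H) {x : M} {V W : VField M} (hV : IsLocalSection H x V)
    (hW : IsLocalSection H x W) :
    levi11 H x (V x) (W x) = q2 H x (mlieBracket (𝓡 5) V W x) := by
  obtain ⟨U, hx, ⟨F⟩⟩ := hH.exists_frame x
  refine bracketMod_eq (φ := fun v w => (H x).mkQ ((((F.B ⟨x, hx⟩).repr v 0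
    * (F.B ⟨x, hx⟩).repr w 1 - (F.B ⟨x, hx⟩).repr v 1 * (F.B ⟨x, hx⟩).repr w 0)) •
    F.b 2 ⟨x, hx⟩)) (fun V W hV hW => ?_) hV hW
  rw [← sub_eq_zero, ← map_sub, Submodule.mkQ_apply, Submodule.Quotient.mk_eq_zero,
    F.mem_H_iff ⟨x, hx⟩]
  obtain ⟨h2, h3, h4⟩ := F.lie_mem_span ⟨x, hx⟩ hV hW
  simp only [map_sub, map_smul, Finsupp.sub_apply, Finsupp.smul_apply, h2, h3, h4, ← F.B_apply]
  simp [-map_zero, -map_one]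

theorem levi12_eq (hH : IsGeneric H) {x : M} {V W : VField M} (hV : IsLocalSection H x V)
    (hW : IsLocalSection (derived H) x W) :
    levi12 H x (V x) (W x) = q3 H x (mlieBracket (𝓡 5) V W x) := by
  obtain ⟨U, hx, ⟨F⟩⟩ := hH.exists_frame x
  refine bracketMod_eq (φ := fun v w => (derived H x).mkQ ((((F.B ⟨x, hx⟩).repr v 0
    * (F.B ⟨x, hx⟩).repr w 2) • F.b 3 ⟨x, hx⟩ + ((F.B ⟨x, hx⟩).repr v 1
    * (F.B ⟨x, hx⟩).repr w 2) • F.b 4 ⟨x, hx⟩))) (fun V W hV hW => ?_) hV hW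
  rw [← sub_eq_zero, ← map_sub, Submodule.mkQ_apply, Submodule.Quotient.mk_eq_zero,
    F.mem_derived_iff ⟨x, hx⟩]
  obtain ⟨h3, h4⟩ := F.lie_derived ⟨x, hx⟩ hV hW
  simp only [map_sub, map_add, map_smul, Finsupp.sub_apply, Finsupp.add_apply,
    Finsupp.smul_apply, h3, h4, ← F.B_apply]
  simp [-map_zero, -map_one]

theorem levi21_eq (hH : IsGeneric H) {x : M} {V W : VField M}
    (hV : IsLocalSection (derived H) x V) (hW : IsLocalSection H x W) :
    levi21 H x (V x) (W x) = q3 H x (mlieBracket (𝓡 5) V W x) := by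
  refine bracketMod_eq (φ := fun v w => -levi12 H x w v) (fun V W hV hW => ?_) hV hW
  rw [levi12_eq hH hW hV, mlieBracket_swap_apply, map_neg]
  rfl

end FramePointwise

/-! ### A Reeb datum in adapted coordinates -/

section DatumCoordinates

variable {A L : Type*} [CommRing A] [LieRing L] [Module A L] [LieRingModule L A]
  [LieRinehartRing A L] {F : AdaptedBasis A L} (D : ReebDatum F.H)

namespace ReebDatum

theorem exists_lie_eq {H : Submodule A L} (D : ReebDatum H) (ξ η : H) :
    ∃ k : H, ⁅(ξ : L), (η : L)⁆ = D.skew ξ η • D.r + k :=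
  ⟨_, D.lie_eq ξ η⟩

theorem z_b_two : D.z (F.b 2) = 0 := by
  rw [← F.lie_zero_one]
  exact D.z_lie_mem ⟨_, F.b_zero_mem⟩ ⟨_, F.b_one_mem⟩

theorem z_eq_coord (X : L) :
    (D.z X : L) = (-D.θ (F.b 2)) • (F.c 3 X • F.b 0 + F.c 4 X • F.b 1) := by
  have h3 : D.z (F.b 3) = -(D.θ (F.b 2) • ⟨F.b 0, F.b_zero_mem⟩) := by
    rw [← F.lie_zero_two]
    exact D.z_lie_of_z_eq_zero ⟨_, F.b_zero_mem⟩ D.z_b_two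
  have h4 : D.z (F.b 4) = -(D.θ (F.b 2) • ⟨F.b 1, F.b_one_mem⟩) := by
    rw [← F.lie_one_two]
    exact D.z_lie_of_z_eq_zero ⟨_, F.b_one_mem⟩ D.z_b_two
  have h0 : D.z (F.b 0) = 0 := D.z_mem ⟨_, F.b_zero_mem⟩
  have h1 : D.z (F.b 1) = 0 := D.z_mem ⟨_, F.b_one_mem⟩
  conv_lhs => rw [F.sum_c X]
  simp only [map_add, map_smul, h0, h1, D.z_b_two, h3, h4, smul_zero, zero_add, Submodule.coe_add,
    Submodule.coe_smul, Submodule.coe_neg]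
  module

/-- [e₁, e₂] equals r modulo H, so r lies in T⁻²; and b₂ = [b₀, b₁] equals θ(b₂) r modulo H. -/
theorem c_r : F.c 3 D.r = 0 ∧ F.c 4 D.r = 0 ∧ D.θ (F.b 2) * F.c 2 D.r = 1 := by
  have key (ξ η : F.H) : ⁅(ξ : L), (η : L)⁆ = D.skew ξ η • D.r + (D.nab ξ η - D.nab η ξ : F.H) :=
    D.lie_eq ξ η
  have hm (h : F.H) := F.mem_H.1 h.2
  have h1 := key D.e₁ D.e₂
  have h2 := key ⟨_, F.b_zero_mem⟩ ⟨_, F.b_one_mem⟩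
  obtain ⟨-, h3, h4⟩ := F.lie_mem_mem D.e₁.2 D.e₂.2
  rw [h1, map_add, (hm _).2.1, D.skew_frame, one_smul, add_zero] at h3
  rw [h1, map_add, (hm _).2.2, D.skew_frame, one_smul, add_zero] at h4
  refine ⟨h3, h4, ?_⟩
  have h5 := congrArg (F.c 2) h2
  rw [map_add, (hm _).1, map_smul, ReebDatum.skew_apply] at h5
  simp only [F.lie_zero_one, AdaptedBasis.c_b, if_true, add_zero, smul_eq_mul] at h5
  exact h5.symm

theorem θ_eq_coord (X : L) : D.θ X = F.c 2 X * D.θ (F.b 2) + F.c 3 X * D.θ (F.b 3)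
    + F.c 4 X * D.θ (F.b 4) := by
  have h0 : D.θ (F.b 0) = 0 := D.θ_mem ⟨_, F.b_zero_mem⟩
  have h1 : D.θ (F.b 1) = 0 := D.θ_mem ⟨_, F.b_one_mem⟩
  conv_lhs => rw [F.sum_c X]
  simp only [map_add, map_smul, h0, h1, smul_eq_mul, mul_zero, zero_add]

end ReebDatum

end DatumCoordinates

/-! ### The partial connections and their algebraic form -/

section Connection

variable {M : Type*} [TopologicalSpace M] [ChartedSpace E5 M] [IsManifold (𝓡 5) ∞ M]
  {H : Distrib M} {U U' : Opens M} {F : Frame H U} (D : ReebDatum F.H) {R : VField M}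

theorem FnRing.exists_inv {f : FnRing U} (hf : ∀ y : U, f y ≠ 0) : ∃ w : FnRing U, w * f = 1 := by
  have h : SmoothFn (U : Set M) (fun y => (extFn U f y)⁻¹) :=
    ContMDiffOn.inv₀ (fn_smooth f) fun y hy => by
      have := extFn_apply f.1 ⟨y, hy⟩
      dsimp only at this
      rw [this]
      exact hf ⟨y, hy⟩
  obtain ⟨w, hw⟩ := exists_repFn h
  refine ⟨w, Subtype.ext (funext fun y => ?_)⟩
  change w y * f y = 1
  rw [← hw y]
  beta_reduce
  rw [extFn_apply, inv_mul_cancel₀ (hf y)]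

/-- A section of `T⁻²` transverse to `H` is part of a Reeb datum. -/
theorem Frame.exists_datum (F : Frame H U) (hR : IsSectionOn (derived H) (U : Set M) R)
    (hne : ∀ y ∈ U, R y ∉ H y) : ∃ D : ReebDatum F.H, Rep R D.r := by
  obtain ⟨r, hr, hr'⟩ := exists_rep_of_section hR
  have hd (y : U) := (F.mem_derived_iff y _).1 (hr' y)
  simp only [F.repr_eq] at hd
  have h3 : F.c 3 r = 0 := Subtype.ext (funext fun y => (hd y).1)
  have h4 : F.c 4 r = 0 := Subtype.ext (funext fun y => (hd y).2)
  obtain ⟨w, hw⟩ := FnRing.exists_inv (f := F.c 2 r) fun y h2 =>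
    hne y y.2 (by rw [hr y, F.mem_H_iff_c]; exact ⟨h2, (hd y).1, (hd y).2⟩)
  exact ⟨F.datum r w h3 h4 hw, hr⟩

namespace ReebDatum

theorem θ_b_two_ne_zero (y : U) : D.θ (F.b 2) y ≠ 0 := fun h => by
  have h1 : D.θ (F.b 2) y * F.c 2 D.r y = 1 := congrArg (fun f : FnRing U => f y) D.c_r.2.2
  rw [h, zero_mul] at h1
  exact zero_ne_one h1

theorem mem_derived_iff (X : FieldModule U) (y : U) :
    X y ∈ derived H (y : M) ↔ (D.z X : FieldModule U) y = 0 := by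
  rw [F.mem_derived_iff, F.repr_eq, F.repr_eq, D.z_eq_coord]
  change _ ↔ (-D.θ (F.b 2) y) • (F.c 3 X y • F.b 0 y + F.c 4 X y • F.b 1 y) = 0
  rw [smul_eq_zero_iff_right (neg_ne_zero.2 (D.θ_b_two_ne_zero y))]
  constructor
  · rintro ⟨h3, h4⟩
    rw [h3, h4, zero_smul, zero_smul, add_zero]
  · intro h
    have h5 (i : Fin 5) : (F.B y).repr (F.c 3 X y • F.b 0 y + F.c 4 X y • F.b 1 y) i = 0 := by
      rw [h, map_zero]; rfl
    have h3 := h5 0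
    have h4 := h5 1
    simp only [← F.B_apply, map_add, map_smul, Module.Basis.repr_self, Finsupp.add_apply,
      Finsupp.smul_apply, Finsupp.single_apply, smul_eq_mul] at h3 h4
    simpa [-map_zero, -map_one] using And.intro h3 h4

theorem mem_H_iff (X : FieldModule U) (y : U) :
    X y ∈ H y ↔ (D.z X : FieldModule U) y = 0 ∧ D.θ X y = 0 := by
  have e : D.θ X y = F.c 2 X y * D.θ (F.b 2) y + F.c 3 X y * D.θ (F.b 3) y
      + F.c 4 X y * D.θ (F.b 4) y := congrArg (fun f : FnRing U => f y) (D.θ_eq_coord X)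
  rw [← D.mem_derived_iff, F.mem_derived_iff, F.mem_H_iff, e]
  simp only [F.repr_eq]
  refine ⟨fun ⟨h2, h3, h4⟩ => ⟨⟨h3, h4⟩, ?_⟩, fun ⟨⟨h3, h4⟩, h⟩ => ⟨?_, h3, h4⟩⟩
  · rw [h2, h3, h4]; ring
  · rw [h3, h4, zero_mul, zero_mul, add_zero, add_zero] at h
    exact (mul_eq_zero.1 h).resolve_right (D.θ_b_two_ne_zero y)

theorem r_mem_derived (y : U) : D.r y ∈ derived H (y : M) := by
  rw [D.mem_derived_iff, D.z_r]; rfl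

theorem r_notMem (y : U) : D.r y ∉ H y := by
  rw [D.mem_H_iff, D.θ_r]
  exact fun h => one_ne_zero h.2

end ReebDatum

theorem Frame.coe_mem (F : Frame H U) (h : F.H) (y : U) : (h : FieldModule U) y ∈ H y :=
  (F.mem_H_module _).1 h.2 y

theorem Frame.exists_eq (F : Frame H U) (y : U) {v : TangentSpace (𝓡 5) (y : M)} (hv : v ∈ H y) :
    ∃ h : F.H, (h : FieldModule U) y = v := by
  rw [F.eq_span, Submodule.mem_span_pair] at hv
  obtain ⟨s, t, rfl⟩ := hv
  exact ⟨⟨FnRing.const s • F.b 0 + FnRing.const t • F.b 1,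
    F.H.add_mem (F.H.smul_mem _ F.b_zero_mem) (F.H.smul_mem _ F.b_one_mem)⟩, rfl⟩

theorem Rep.isLocalSection {V : VField M} {h : F.H} (hV : Rep V (h : FieldModule U)) (y : U) :
    IsLocalSection H (y : M) V :=
  (hV.isSectionOn ((F.mem_H_module _).1 h.2)).isLocalSection y.2

variable {D}

theorem Rep.isLocalSection_derived (hR : Rep R D.r) (y : U) :
    IsLocalSection (derived H) (y : M) R :=
  (hR.isSectionOn D.r_mem_derived).isLocalSection y.2

theorem q3_eq_iff (X Y : FieldModule U) (y : U) :
    q3 H y (X y) = q3 H y (Y y) ↔ (D.z X : FieldModule U) y = (D.z Y : FieldModule U) y := by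
  rw [q3, q3, ← sub_eq_zero, ← map_sub, Submodule.mkQ_apply, Submodule.Quotient.mk_eq_zero]
  have h := D.mem_derived_iff (X - Y) y
  rw [map_sub] at h
  rw [← sub_eq_zero (b := (D.z Y : FieldModule U) y)]
  exact h

theorem levi12_r (hH : IsGeneric H) (hR : Rep R D.r) (h : F.H) (X : FieldModule U) (y : U) :
    levi12 H y ((h : FieldModule U) y) (R y) = q3 H y (X y) ↔
      (h : FieldModule U) y = -(D.z X : FieldModule U) y := by
  have h1 := levi12_eq hH ((Rep.ext (h : FieldModule U)).isLocalSection y)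
    (hR.isLocalSection_derived y)
  rw [extField_apply] at h1
  rw [h1, (Rep.ext (h : FieldModule U)).lie hR y, q3_eq_iff (D := D), ← lie_skew, map_neg, D.z_lie]
  exact neg_eq_iff_eq_neg

/-- Levi bracketing with q₋₂(r) is injective on H, with z as inverse up to sign. This evaluates the
choices defining both ∇ and Ψ. -/
theorem epsilon_levi12 (hH : IsGeneric H) (hR : Rep R D.r) (X : FieldModule U) (y : U) :
    Classical.epsilon (fun v => v ∈ H y ∧ levi12 H y v (R y) = q3 H y (X y))
      = -(D.z X : FieldModule U) y := by
  have hspec := Classical.epsilon_spec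
    (p := fun v => v ∈ H y ∧ levi12 H y v (R y) = q3 H y (X y))
    ⟨((-D.z X : F.H) : FieldModule U) y, F.coe_mem _ y, (levi12_r hH hR _ _ _).2 rfl⟩
  obtain ⟨h, hh⟩ := F.exists_eq y hspec.1
  rw [← hh] at hspec ⊢
  exact (levi12_r hH hR _ _ _).1 hspec.2

theorem nabla_rep (hH : IsGeneric H) (hR : Rep R D.r) {X Y : VField M} {ξ η : F.H}
    (hX : Rep X (ξ : FieldModule U)) (hY : Rep Y (η : FieldModule U)) :
    Rep (nabla H R X Y) (D.nab ξ η : FieldModule U) := fun y => by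
  have h : ⁅(ξ : FieldModule U), ⁅D.r, (η : FieldModule U)⁆⁆
      = -⁅(ξ : FieldModule U), ⁅(η : FieldModule U), D.r⁆⁆ := by rw [← lie_neg, lie_skew]
  rw [nabla, hX.lie (hY.lie hR) y, epsilon_levi12 hH hR, ReebDatum.nab, h, map_neg]
  rfl

theorem q2_smul_add {x : M} (a : ℝ) (r : TangentSpace (𝓡 5) x) {v : TangentSpace (𝓡 5) x}
    (hv : v ∈ H x) : q2 H x (a • r + v) = a • q2 H x r := by
  simp only [q2, map_add, map_smul, Submodule.mkQ_apply, (Submodule.Quotient.mk_eq_zero _).2 hv,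
    add_zero]

theorem levi11_rep (hH : IsGeneric H) (hR : Rep R D.r) {X Y : VField M} {ξ η : F.H}
    (hX : Rep X (ξ : FieldModule U)) (hY : Rep Y (η : FieldModule U)) (y : U) :
    levi11 H y (X y) (Y y) = D.skew ξ η y • q2 H y (R y) := by
  obtain ⟨k, hk⟩ := D.exists_lie_eq ξ η
  have e := (hX.lie hY y).trans (FieldModule.eval_eq hk y)
  rw [levi11_eq hH (hX.isLocalSection y) (hY.isLocalSection y), e, hR y]
  exact q2_smul_add _ _ (F.coe_mem k y)

theorem q2_ne_zero (hR : Rep R D.r) (y : U) : q2 H y (R y) ≠ 0 := by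
  rw [q2, Submodule.mkQ_apply, Ne, Submodule.Quotient.mk_eq_zero, hR y]
  exact D.r_notMem y

theorem levi11_nabla (hH : IsGeneric H) (hR : Rep R D.r) {Γ X Y : VField M} {γ ξ η : F.H}
    (hΓ : Rep Γ (γ : FieldModule U)) (hX : Rep X (ξ : FieldModule U))
    (hY : Rep Y (η : FieldModule U)) (hskew : D.skew ξ η = 1) (y : U) :
    levi11 H y (nabla H R Γ X y) (Y y) + levi11 H y (X y) (nabla H R Γ Y y)
      = D.κ γ y • q2 H y (R y) := by
  rw [levi11_rep hH hR (nabla_rep hH hR hΓ hX) hY, levi11_rep hH hR hX (nabla_rep hH hR hΓ hY),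
    ← add_smul, ← FnRing.add_apply, D.κ_spec, hskew, lie_one_eq_zero, zero_add, mul_one]

theorem skew_eq_one_iff (hH : IsGeneric H) (hR : Rep R D.r) {X Y : VField M} {ξ η : F.H}
    (hX : Rep X (ξ : FieldModule U)) (hY : Rep Y (η : FieldModule U)) :
    D.skew ξ η = 1 ↔ ∀ y : U, q2 H y (R y) = levi11 H y (X y) (Y y) := by
  constructor
  · intro h y
    rw [levi11_rep hH hR hX hY, h, FnRing.one_apply, one_smul]
  · intro h
    refine Subtype.ext (funext fun y => ?_)
    have h1 := h y
    rw [levi11_rep hH hR hX hY] at h1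
    exact smul_left_injective ℝ (q2_ne_zero hR y) (h1.symm.trans (one_smul ℝ _).symm)

/-- The frame of D, restricted to U', is still normalized for D', and any normalized pair computes
the trace. -/
theorem κ_congr (hH : IsGeneric H) (hR : Rep R D.r) (h : U' ≤ U) {F' : Frame H U'}
    {D' : ReebDatum F'.H} (hR' : Rep R D'.r) {Γ : VField M} {γ : F.H} {γ' : F'.H}
    (hΓ : Rep Γ (γ : FieldModule U)) (hΓ' : Rep Γ (γ' : FieldModule U')) (y : U') :
    D'.κ γ' y = D.κ γ ⟨y, h y.2⟩ := by
  have mem (ξ : F.H) : FieldModule.restr h (ξ : FieldModule U) ∈ F'.H :=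
    (F'.mem_H_module _).2 fun z => F.coe_mem ξ ⟨z, h z.2⟩
  have r1 := Rep.ext (D.e₁ : FieldModule U)
  have r2 := Rep.ext (D.e₂ : FieldModule U)
  have r1' : Rep _ ((⟨_, mem D.e₁⟩ : F'.H) : FieldModule U') := r1.restr h
  have r2' : Rep _ ((⟨_, mem D.e₂⟩ : F'.H) : FieldModule U') := r2.restr h
  have h1 := levi11_nabla hH hR hΓ r1 r2 D.skew_frame ⟨y, h y.2⟩
  have h2 := levi11_nabla hH hR' hΓ' r1' r2' ((skew_eq_one_iff hH hR' r1' r2').2 fun z =>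
    (skew_eq_one_iff hH hR r1 r2).1 D.skew_frame ⟨z, h z.2⟩) y
  exact smul_left_injective ℝ (q2_ne_zero hR' y) (h2.symm.trans h1)

theorem exists_datum_restr (hR : Rep R D.r) (h : U' ≤ U) :
    ∃ D' : ReebDatum (F.restr h).H, Rep R D'.r :=
  (F.restr h).exists_datum ((hR.isSectionOn D.r_mem_derived).mono h)
    fun z hz => by rw [hR ⟨z, h hz⟩]; exact D.r_notMem ⟨z, h hz⟩

/-- Each local pair with Levi bracket q₋₂(r) gives the same trace after passing to a smaller open
set, so the epsilon condition is satisfiable; the frame of D then identifies its value. -/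
theorem nablaGr_eq (hH : IsGeneric H) (hR : Rep R D.r) {Γ : VField M} {γ : F.H}
    (hΓ : Rep Γ (γ : FieldModule U)) (y : U) :
    nablaGr H R Γ (fun y => q2 H y (R y)) y = D.κ γ y • q2 H y (R y) := by
  have r1 := Rep.ext (D.e₁ : FieldModule U)
  have r2 := Rep.ext (D.e₂ : FieldModule U)
  have hspec := Classical.epsilon_spec (p := fun c => ∀ ξ η : VField M,
    IsLocalSection H (y : M) ξ → IsLocalSection H (y : M) η →
    (∀ᶠ z in 𝓝 (y : M), q2 H z (R z) = levi11 H z (ξ z) (η z)) →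
    c = levi11 H y (nabla H R Γ ξ y) (η y) + levi11 H y (ξ y) (nabla H R Γ η y))
    ⟨D.κ γ y • q2 H y (R y), fun X Y hX hY hev => by
      obtain ⟨U', hU', hy', v, w, hv, hw, hv', hw', hN⟩ := exists_rep_two y hX hY hev
      obtain ⟨D', hD'⟩ := exists_datum_restr hR hU'
      have mv := ((F.restr hU').mem_H_module v).2 hv'
      have mw := ((F.restr hU').mem_H_module w).2 hw'
      have mγ : FieldModule.restr hU' (γ : FieldModule U) ∈ (F.restr hU').H :=
        ((F.restr hU').mem_H_module _).2 fun z => F.coe_mem γ ⟨z, hU' z.2⟩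
      have hskew := (skew_eq_one_iff (ξ := ⟨v, mv⟩) (η := ⟨w, mw⟩) hH hD' hv hw).2
        fun z => hN z.2
      have h1 := levi11_nabla (γ := ⟨_, mγ⟩) hH hD' (hΓ.restr hU') hv hw hskew ⟨y, hy'⟩
      rw [κ_congr hH hR hU' hD' hΓ (γ' := ⟨_, mγ⟩) (hΓ.restr hU') ⟨y, hy'⟩] at h1
      exact h1.symm⟩
  have h2 := hspec _ _ (r1.isLocalSection y) (r2.isLocalSection y)
    (Filter.eventually_of_mem (U.isOpen.mem_nhds y.2) fun z hz =>
      (skew_eq_one_iff hH hR r1 r2).1 D.skew_frame ⟨z, hz⟩)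
  exact h2.trans (levi11_nabla hH hR hΓ r1 r2 D.skew_frame y)

/-- A section over U' need not extend to U, but κ is linear over functions and the frame fields b₀,
b₁ do extend. -/
theorem parallel_restr (hH : IsGeneric H) (hR : Rep R D.r) (h : U' ≤ U)
    {D' : ReebDatum (F.restr h).H} (hR' : Rep R D'.r) (hD : D.Parallel) : D'.Parallel := by
  rw [D.parallel_iff] at hD
  rw [D'.parallel_iff]
  intro γ
  have hb (i : Fin 5) (hi : F.b i ∈ F.H) (hi' : (F.restr h).b i ∈ (F.restr h).H) :
      D'.κ ⟨_, hi'⟩ = 0 := by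
    refine Subtype.ext (funext fun y => ?_)
    have h1 := Rep.ext (F.b i)
    have h2 := h1.restr h
    rw [← F.restr_b] at h2
    have h3 := κ_congr hH hR h hR' (γ := ⟨_, hi⟩) (γ' := ⟨_, hi'⟩) h1 h2 y
    rw [hD] at h3
    exact h3
  have e : γ = (F.restr h).c 0 γ • ⟨_, (F.restr h).b_zero_mem⟩
      + (F.restr h).c 1 γ • ⟨_, (F.restr h).b_one_mem⟩ :=
    Subtype.ext ((F.restr h).eq_of_mem γ.2)
  rw [e, D'.κ_add, D'.κ_smul, D'.κ_smul, hb 0 F.b_zero_mem, hb 1 F.b_one_mem]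
  simp only [mul_zero, add_zero]

theorem parallel_iff_nablaGr (hH : IsGeneric H) (hR : Rep R D.r) :
    D.Parallel ↔ ∀ y : U, ∀ Γ : VField M, IsLocalSection H (y : M) Γ →
      nablaGr H R Γ (fun y => q2 H y (R y)) y = 0 := by
  constructor
  · intro h y Γ hΓ
    obtain ⟨U', hU', hy', v, -, hv, -, hv', -, -⟩ := exists_rep_two y hΓ hΓ Filter.univ_mem
    obtain ⟨D', hD'⟩ := exists_datum_restr hR hU'
    have h1 := nablaGr_eq (γ := ⟨v, ((F.restr hU').mem_H_module v).2 hv'⟩) hH hD' hv ⟨y, hy'⟩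
    rw [D'.parallel_iff.1 (parallel_restr hH hR hU' hD' h)] at h1
    exact h1.trans (zero_smul ℝ _)
  · intro h
    rw [D.parallel_iff]
    intro γ
    refine Subtype.ext (funext fun y => ?_)
    have h1 := h y _ ((Rep.ext (γ : FieldModule U)).isLocalSection y)
    rw [nablaGr_eq hH hR (Rep.ext _)] at h1
    exact (smul_eq_zero.1 h1).resolve_right (q2_ne_zero hR y)

end Connection

theorem ReebDatum.lie_θ_mem {A L : Type*} [CommRing A] [LieRing L] [Module A L]
    [LieRingModule L A] [LieRinehartRing A L] {H : Submodule A L} (D : ReebDatum H) (X : L)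
    (h : H) : ⁅X, D.θ h⁆ = 0 := by
  rw [D.θ_mem, lie_zero]

/-! ### The extension, Φ, Ψ, π₋₁ and the metric formula in algebraic form -/

section Operators

variable {M : Type*} [TopologicalSpace M] [ChartedSpace E5 M] [IsManifold (𝓡 5) ∞ M]
  {H : Distrib M} {U U' : Opens M} {F : Frame H U} {D : ReebDatum F.H} {R : VField M}
  {Θ : OneForm M}

/-- The section `R` of `T⁻²` and the one-form `Θ` satisfy the algebraic relations between the Reeb
field and the canonical extension. -/
structure ReebPair (H : Distrib M) (R : VField M) (Θ : OneForm M) : Prop where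
  isSectionOn : IsSectionOn (derived H) Set.univ R
  apply_mem : ∀ (x : M), ∀ v ∈ H x, Θ x v = 0
  apply_self : ∀ x : M, Θ x (R x) = 1
  dOne_eq_zero : ∀ (x : M) (γ : VField M), IsLocalSection H x γ → dOne Θ R γ x = 0

/-- The relations which characterize the value at `x` of the canonical extension. -/
structure IsThetaAt (H : Distrib M) (R : VField M) (x : M)
    (l : TangentSpace (𝓡 5) x →L[ℝ] ℝ) : Prop where
  apply_mem : ∀ v ∈ H x, l v = 0
  apply_self : l (R x) = 1
  apply_lie : ∀ γ : VField M, IsLocalSection H x γ → l (mlieBracket (𝓡 5) R γ x) = 0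

theorem IsThetaAt.apply_eq {y : U} {l : TangentSpace (𝓡 5) (y : M) →L[ℝ] ℝ}
    (hl : IsThetaAt H R y l) (hR : Rep R D.r) (v : FieldModule U) : l (v y) = D.θ v y := by
  have e : v y =
      ⁅D.r, (D.z v : FieldModule U)⁆ y + D.θ v y • D.r y + (D.pr v : FieldModule U) y := by
    conv_lhs => rw [D.decomp v]
    rfl
  have h1 := Rep.ext (D.z v : FieldModule U)
  have h2 := hl.apply_lie _ (h1.isLocalSection y)
  rw [hR.lie h1 y] at h2
  rw [e, map_add, map_add, map_smul, h2, hl.apply_mem _ (F.coe_mem (D.pr v) y), ← hR y,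
    hl.apply_self]
  simp

/-- Both differentiated functions are locally constant. Thus the condition on dΘ becomes the
pointwise linear one in `IsThetaAt`. -/
theorem dOne_eq_neg (hm : ∀ (x : M), ∀ v ∈ H x, Θ x v = 0) (hs : ∀ x : M, Θ x (R x) = 1) {x : M}
    {γ : VField M} (hγ : IsLocalSection H x γ) :
    dOne Θ R γ x = -Θ x (mlieBracket (𝓡 5) R γ x) := by
  have h3 : (fun z : M => Θ z (R z)) = fun _ => 1 := funext hs
  have h4 : (fun z : M => Θ z (γ z)) =ᶠ[𝓝 x] fun _ => 0 := by
    obtain ⟨O, hO, hx, hγ⟩ := hγ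
    filter_upwards [hO.mem_nhds hx] with z hz
    exact hm z _ (hγ.2 z hz)
  rw [dOne, h3, mvfderiv_congr h4, mvfderiv_const, mvfderiv_const]
  simp

namespace ReebPair

theorem exists_datum (P : ReebPair H R Θ) (F : Frame H U) : ∃ D : ReebDatum F.H, Rep R D.r :=
  F.exists_datum (P.isSectionOn.mono (Set.subset_univ _)) fun y _ hy => by
    have h := P.apply_self y
    rw [P.apply_mem y _ hy] at h
    exact zero_ne_one h

theorem isThetaAt (P : ReebPair H R Θ) (x : M) : IsThetaAt H R x (Θ x) where
  apply_mem := P.apply_mem x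
  apply_self := P.apply_self x
  apply_lie γ hγ := by
    have h := dOne_eq_neg P.apply_mem P.apply_self hγ
    rw [P.dOne_eq_zero x γ hγ] at h
    linarith

theorem θ_eq (P : ReebPair H R Θ) (hR : Rep R D.r) (v : FieldModule U) (y : U) :
    Θ y (v y) = D.θ v y :=
  (P.isThetaAt y).apply_eq hR v

theorem repFn (P : ReebPair H R Θ) (hR : Rep R D.r) {V : VField M} {v : FieldModule U}
    (hV : Rep V v) : RepFn (fun y => Θ y (V y)) (D.θ v) := fun y => by
  beta_reduce
  rw [hV y, P.θ_eq hR]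

theorem dOne_eq (P : ReebPair H R Θ) (hR : Rep R D.r) {X Y : VField M} {ξ η : F.H}
    (hX : Rep X (ξ : FieldModule U)) (hY : Rep Y (η : FieldModule U)) (y : U) :
    dOne Θ X Y y = -D.skew ξ η y := by
  have h1 := hX.deriv (P.repFn hR hY) y
  have h2 := hY.deriv (P.repFn hR hX) y
  have h3 := P.repFn hR (hX.lie hY) y
  beta_reduce at h1 h2 h3
  rw [D.lie_θ_mem] at h1 h2
  rw [dOne, h1, h2, h3]
  change 0 - 0 - D.skew ξ η y = _
  ring

end ReebPair

variable {α : PartialForm H}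

/-- The curvature expression of the partial connection. -/
def curvature (H : Distrib M) (α : PartialForm H) (ξ η γ : VField M) : VField M := fun x =>
  nabla H (reebField H α) ξ (nabla H (reebField H α) η γ) x
    - nabla H (reebField H α) η (nabla H (reebField H α) ξ γ) x
    - nabla H (reebField H α) (bracketProj H α ξ η) γ x

theorem curvature_rep (hH : IsGeneric H) (P : ReebPair H (reebField H α) (extension H α))
    (hR : Rep (reebField H α) D.r) {X Y Γ : VField M} {ξ η γ : F.H}
    (hX : Rep X (ξ : FieldModule U)) (hY : Rep Y (η : FieldModule U))
    (hΓ : Rep Γ (γ : FieldModule U)) (y : U) :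
    curvature H α X Y Γ y = D.skew ξ η y • (D.Phi γ : FieldModule U) y := by
  have h : Rep (bracketProj H α X Y) (D.tor ξ η : FieldModule U) := fun z => by
    have h1 := P.repFn hR (hX.lie hY) z
    beta_reduce at h1
    rw [bracketProj, h1, hX.lie hY z, hR z, D.tor_apply]
    rfl
  have h2 := congrArg (fun k : F.H => (k : FieldModule U) y) (D.curv_eq ξ η γ)
  refine Eq.trans ?_ h2
  rw [curvature, nabla_rep hH hR hX (nabla_rep hH hR hY hΓ) y,
    nabla_rep hH hR hY (nabla_rep hH hR hX hΓ) y, nabla_rep hH hR h hΓ y]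
  rfl

theorem extension_lie (P : ReebPair H (reebField H α) (extension H α))
    (hR : Rep (reebField H α) D.r) {X Y : VField M} {ξ η : F.H}
    (hX : Rep X (ξ : FieldModule U)) (hY : Rep Y (η : FieldModule U)) (y : U) :
    extension H α y (mlieBracket (𝓡 5) X Y y) = D.skew ξ η y :=
  P.repFn hR (hX.lie hY) y

theorem curvature_frame (hH : IsGeneric H) (P : ReebPair H (reebField H α) (extension H α))
    (hR : Rep (reebField H α) D.r) {X Y Γ : VField M} {ξ η γ : F.H}
    (hX : Rep X (ξ : FieldModule U)) (hY : Rep Y (η : FieldModule U))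
    (hΓ : Rep Γ (γ : FieldModule U)) (y : U) :
    curvature H α X Y Γ y
      = extension H α y (mlieBracket (𝓡 5) X Y y) • (D.Phi γ : FieldModule U) y := by
  rw [extension_lie P hR hX hY y]
  exact curvature_rep hH P hR hX hY hΓ y

theorem extension_lie_frame (P : ReebPair H (reebField H α) (extension H α))
    (hR : Rep (reebField H α) D.r) (y : U) :
    extension H α y (mlieBracket (𝓡 5) (extField U (D.e₁ : FieldModule U))
      (extField U (D.e₂ : FieldModule U)) y) = 1 := by
  rw [extension_lie P hR (Rep.ext _) (Rep.ext _) y, D.skew_frame, FnRing.one_apply]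

theorem Phi_congr (hH : IsGeneric H) (P : ReebPair H (reebField H α) (extension H α))
    (hR : Rep (reebField H α) D.r) (h : U' ≤ U) {F' : Frame H U'}
    {D' : ReebDatum F'.H} (hR' : Rep (reebField H α) D'.r) {Γ : VField M} {γ : F.H} {γ' : F'.H}
    (hΓ : Rep Γ (γ : FieldModule U)) (hΓ' : Rep Γ (γ' : FieldModule U')) (y : U') :
    (D'.Phi γ' : FieldModule U') y = (D.Phi γ : FieldModule U) ⟨y, h y.2⟩ := by
  have mem (ξ : F.H) : FieldModule.restr h (ξ : FieldModule U) ∈ F'.H :=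
    (F'.mem_H_module _).2 fun z => F.coe_mem ξ ⟨z, h z.2⟩
  have r1 := Rep.ext (D.e₁ : FieldModule U)
  have r2 := Rep.ext (D.e₂ : FieldModule U)
  have c0 := curvature_frame hH P hR r1 r2 hΓ ⟨y, h y.2⟩
  have c1 := extension_lie_frame P hR ⟨y, h y.2⟩
  have d0 := curvature_frame (ξ := ⟨_, mem D.e₁⟩) (η := ⟨_, mem D.e₂⟩) hH P hR'
    (r1.restr h) (r2.restr h) hΓ' y
  have e := d0.symm.trans c0
  rw [c1] at e
  simpa only [one_smul] using e

/-- The curvature identity must hold for all germs of sections, hence the passage to smaller open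
sets through `Phi_congr`. The normalized frame, where α([e₁, e₂]) = 1, pins the chosen vector. -/
theorem Phi_rep (hH : IsGeneric H) (P : ReebPair H (reebField H α) (extension H α))
    (hR : Rep (reebField H α) D.r) {Γ : VField M} {γ : F.H} (hΓ : Rep Γ (γ : FieldModule U)) :
    Rep (Phi H α Γ) (D.Phi γ : FieldModule U) := fun y => by
  have r1 := Rep.ext (D.e₁ : FieldModule U)
  have r2 := Rep.ext (D.e₂ : FieldModule U)
  have hex : ∀ X Y : VField M, IsLocalSection H (y : M) X → IsLocalSection H (y : M) Y →
      curvature H α X Y Γ y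
        = extension H α y (mlieBracket (𝓡 5) X Y y) • (D.Phi γ : FieldModule U) y := by
    intro X Y hX hY
    obtain ⟨U', hU', hy', v, w, hv, hw, hv', hw', -⟩ := exists_rep_two y hX hY Filter.univ_mem
    obtain ⟨D', hD'⟩ := exists_datum_restr hR hU'
    have mγ : FieldModule.restr hU' (γ : FieldModule U) ∈ (F.restr hU').H :=
      ((F.restr hU').mem_H_module _).2 fun z => F.coe_mem γ ⟨z, hU' z.2⟩
    have d1 := curvature_frame (ξ := ⟨v, ((F.restr hU').mem_H_module v).2 hv'⟩)
      (η := ⟨w, ((F.restr hU').mem_H_module w).2 hw'⟩) (γ := ⟨_, mγ⟩) hH P hD' hv hw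
      (hΓ.restr hU') ⟨y, hy'⟩
    rw [Phi_congr (γ' := ⟨_, mγ⟩) hH P hR hU' hD' hΓ (hΓ.restr hU') ⟨y, hy'⟩] at d1
    exact d1
  have hspec := Classical.epsilon_spec (p := fun v => v ∈ H y ∧ ∀ ξ η : VField M,
    IsLocalSection H (y : M) ξ → IsLocalSection H (y : M) η →
    curvature H α ξ η Γ y = extension H α y (mlieBracket (𝓡 5) ξ η y) • v)
    ⟨(D.Phi γ : FieldModule U) y, F.coe_mem _ y, hex⟩
  have h := hspec.2 _ _ (r1.isLocalSection y) (r2.isLocalSection y)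
  have h2 := hex _ _ (r1.isLocalSection y) (r2.isLocalSection y)
  rw [extension_lie_frame P hR y, one_smul] at h h2
  exact h.symm.trans h2

theorem Psi_eq (hH : IsGeneric H) (hR : Rep (reebField H α) D.r) {Γ : VField M} {γ : F.H}
    (hΓ : Rep Γ (γ : FieldModule U)) (y : U) :
    Psi H α Γ y = (1 / 2 : ℝ) • (D.Psi γ : FieldModule U) y := by
  have e : (1 / 2 : ℝ) • q3 H y (⁅D.r, ⁅(γ : FieldModule U), D.r⁆⁆ y)
      = q3 H y (((FnRing.const (1 / 2) : FnRing U) • ⁅D.r, ⁅(γ : FieldModule U), D.r⁆⁆ :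
        FieldModule U) y) := ((derived H (y : M)).mkQ.map_smul _ _).symm
  have e2 : ⁅D.r, ⁅(γ : FieldModule U), D.r⁆⁆ = -⁅D.r, ⁅D.r, (γ : FieldModule U)⁆⁆ := by
    rw [← lie_neg, lie_skew]
  rw [Psi, hR.lie (hΓ.lie hR) y, e, epsilon_levi12 hH hR, map_smul, e2, map_neg]
  change -((1 / 2 : ℝ) • -(D.Psi γ : FieldModule U) y) = _
  module

theorem zeta1_rep (hH : IsGeneric H) (hR : Rep (reebField H α) D.r) {Z : VField M}
    {ζ : FieldModule U} (hZ : Rep Z ζ) : Rep (zeta1 H α Z) (D.z ζ : FieldModule U) := fun y => by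
  have key (h : F.H) : q3 H y (Z y) = levi21 H y (reebField H α y) ((h : FieldModule U) y) ↔
      (D.z ζ : FieldModule U) y = (h : FieldModule U) y := by
    have r := Rep.ext (h : FieldModule U)
    have h1 := levi21_eq hH (hR.isLocalSection_derived y) (r.isLocalSection y)
    rw [extField_apply] at h1
    rw [h1, hR.lie r y, hZ y, q3_eq_iff (D := D), D.z_lie]
  have hspec := Classical.epsilon_spec
    (p := fun v => v ∈ H y ∧ q3 H y (Z y) = levi21 H y (reebField H α y) v)
    ⟨(D.z ζ : FieldModule U) y, F.coe_mem _ y, (key _).2 rfl⟩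
  obtain ⟨h, hh⟩ := F.exists_eq y hspec.1
  rw [← hh] at hspec
  exact hh.symm.trans ((key h).1 hspec.2).symm

theorem zeta2_rep (hH : IsGeneric H) (P : ReebPair H (reebField H α) (extension H α))
    (hR : Rep (reebField H α) D.r) {Z : VField M}
    {ζ : FieldModule U} (hZ : Rep Z ζ) : Rep (zeta2 H α Z) (D.pr ζ : FieldModule U) := fun y => by
  have h1 := P.repFn hR hZ y
  beta_reduce at h1
  rw [zeta2, h1, hR.lie (zeta1_rep hH hR hZ) y, hZ y, hR y, D.pr_apply]
  rfl

theorem piMinusOne_rep (hH : IsGeneric H) (P : ReebPair H (reebField H α) (extension H α))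
    (hR : Rep (reebField H α) D.r) {Z : VField M} {ζ : FieldModule U} (hZ : Rep Z ζ) :
    Rep (piMinusOne H α Z)
      (((FnRing.const (1 / 10) : FnRing U) • D.proj ζ : F.H) : FieldModule U) :=
  fun y => by
  have h1 := zeta1_rep hH hR hZ
  have e : (D.proj ζ : FieldModule U) y = (-4 : ℝ) • (D.Phi (D.z ζ) : FieldModule U) y
      + (7 : ℝ) • (D.Psi (D.z ζ) : FieldModule U) y + (10 : ℝ) • (D.pr ζ : FieldModule U) y := by
    rw [D.proj_apply]
    rfl
  change _ = (1 / 10 : ℝ) • (D.proj ζ : FieldModule U) y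
  rw [e, piMinusOne, Phi_rep hH P hR h1 y, Psi_eq hH hR h1, zeta2_rep hH P hR hZ y]
  module

theorem ReebDatum.G_apply (D : ReebDatum F.H) (ζ ζ' : FieldModule U) (y : U) :
    D.G ζ ζ' y = -((3 : ℝ) * D.skew (D.z ζ) (D.proj ζ') y) - (40 : ℝ) * (D.θ ζ y * D.θ ζ' y)
      - (3 : ℝ) * D.skew (D.z ζ') (D.proj ζ) y :=
  rfl

set_option maxHeartbeats 1000000 in
theorem metricFormula_eq (hH : IsGeneric H) (P : ReebPair H (reebField H α) (extension H α))
    (hR : Rep (reebField H α) D.r) {Z Z' : VField M} {ζ ζ' : FieldModule U} (hZ : Rep Z ζ)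
    (hZ' : Rep Z' ζ') (y : U) :
    metricFormula H α Z Z' y = (1 / 30 : ℝ) * D.G ζ ζ' y := by
  have h1 := P.repFn hR hZ y
  have h2 := P.repFn hR hZ' y
  beta_reduce at h1 h2
  have key {X Y : VField M} {x : F.H} {y' : F.H} (hX : Rep X (x : FieldModule U))
      (hY : Rep Y (((FnRing.const (1 / 10) : FnRing U) • y' : F.H) : FieldModule U)) :
      dOne (extension H α) X Y y = -((1 / 10 : ℝ) * D.skew x y' y) := by
    rw [P.dOne_eq hR hX hY y, map_smul]
    rfl
  have k1 := key (zeta1_rep hH hR hZ) (piMinusOne_rep hH P hR hZ')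
  have k2 := key (zeta1_rep hH hR hZ') (piMinusOne_rep hH P hR hZ)
  have k3 := D.G_apply ζ ζ' y
  unfold metricFormula
  rw [k1, k2, h1, h2, k3]
  ring

end Operators

/-! ### Existence and uniqueness of the Reeb field -/

section Reeb

variable {M : Type*} [TopologicalSpace M] [ChartedSpace E5 M] [IsManifold (𝓡 5) ∞ M]
  {H : Distrib M} {U : Opens M} {α : PartialForm H}

theorem PartialForm.eval_eq (α : PartialForm H) {V : VField M} {x : M}
    (h : V x ∈ derived H x) : α.eval V x = α x ⟨V x, h⟩ := by
  simp [PartialForm.eval, h]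

theorem PartialForm.eval_add_smul (α : PartialForm H) {V W Z : VField M} {x : M} {a : ℝ}
    (hV : V x ∈ derived H x) (hW : W x ∈ derived H x) (h : Z x = V x + a • W x) :
    α.eval Z x = α.eval V x + a * α.eval W x := by
  have hZ : Z x ∈ derived H x := h ▸ add_mem hV (Submodule.smul_mem _ _ hW)
  rw [α.eval_eq hV, α.eval_eq hW, α.eval_eq hZ]
  have e : (⟨Z x, hZ⟩ : derived H x) = ⟨V x, hV⟩ + a • ⟨W x, hW⟩ := Subtype.ext h
  rw [e, map_add, map_smul, smul_eq_mul]

theorem IsContactForm.apply_eq_zero_iff (hα : IsContactForm H α) {x : M} (v : derived H x) :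
    α x v = 0 ↔ (v : TangentSpace (𝓡 5) x) ∈ H x := by
  rw [← LinearMap.mem_ker, hα.2 x]
  exact Iff.rfl

theorem IsContactForm.eval_eq_zero_iff (hα : IsContactForm H α) {V : VField M} {x : M}
    (h : V x ∈ derived H x) : α.eval V x = 0 ↔ V x ∈ H x := by
  rw [α.eval_eq h, hα.apply_eq_zero_iff]

/-- `R` is a generalized Reeb field of `α` on the open set `O`. -/
structure LocalReeb (H : Distrib M) (α : PartialForm H) (O : Opens M) (R : VField M) : Prop where
  isSectionOn : IsSectionOn (derived H) (O : Set M) R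
  eval_eq_one : ∀ x ∈ O, α.eval R x = 1
  nablaGr_eq_zero : ∀ x ∈ O, ∀ γ : VField M, IsLocalSection H x γ →
    nablaGr H R γ (fun y => q2 H y (R y)) x = 0

theorem isReebField_iff {R : VField M} : IsReebField H α R ↔ LocalReeb H α ⊤ R :=
  ⟨fun h => ⟨h.1, fun x _ => h.2.1 x, fun x _ => h.2.2 x⟩,
    fun h => ⟨h.1, fun x => h.2 x trivial, fun x => h.3 x trivial⟩⟩

namespace LocalReeb

variable {O O' : Opens M} {R R' : VField M}

theorem exists_parallel (h : LocalReeb H α O R) (hα : IsContactForm H α) (hH : IsGeneric H)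
    (F : Frame H U) (hU : U ≤ O) : ∃ D : ReebDatum F.H, Rep R D.r ∧ D.Parallel := by
  obtain ⟨D, hD⟩ := F.exists_datum (h.isSectionOn.mono hU) fun y hy hm => by
    have h1 := h.eval_eq_one y (hU hy)
    rw [(hα.eval_eq_zero_iff (h.isSectionOn.2 y (hU hy))).2 hm] at h1
    exact zero_ne_one h1
  exact ⟨D, hD, (parallel_iff_nablaGr hH hD).2 fun y => h.nablaGr_eq_zero y (hU y.2)⟩

theorem congr (h : LocalReeb H α O R) (hα : IsContactForm H α) (hH : IsGeneric H)
    (hR : ∀ y ∈ O, R' y = R y) : LocalReeb H α O R' where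
  isSectionOn := ⟨SmoothField.congr h.isSectionOn.1 hR,
    fun y hy => by rw [hR y hy]; exact h.isSectionOn.2 y hy⟩
  eval_eq_one x hx := by
    have h1 := h.eval_eq_one x hx
    rwa [PartialForm.eval, ← hR x hx] at h1
  nablaGr_eq_zero x hx := by
    obtain ⟨U, hxU, hU, ⟨F⟩⟩ := hH.exists_frame_le (O.isOpen.mem_nhds hx)
    obtain ⟨D, hD, hp⟩ := h.exists_parallel hα hH F hU
    have hD' : Rep R' D.r := fun y => (hR y (hU y.2)).trans (hD y)
    exact (parallel_iff_nablaGr hH hD').1 hp ⟨x, hxU⟩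

/-- Both fields have α-value 1, so they differ by a section of H, and `eq_of_parallel` applies. -/
theorem unique (h : LocalReeb H α O R) (h' : LocalReeb H α O' R') (hα : IsContactForm H α)
    (hH : IsGeneric H) {x : M} (hx : x ∈ O) (hx' : x ∈ O') : R x = R' x := by
  obtain ⟨U, hxU, hU, ⟨F⟩⟩ := hH.exists_frame_le ((O ⊓ O').isOpen.mem_nhds ⟨hx, hx'⟩)
  obtain ⟨D, hD, hp⟩ := h.exists_parallel hα hH F fun y hy => (hU hy).1
  obtain ⟨D', hD', hp'⟩ := h'.exists_parallel hα hH F fun y hy => (hU hy).2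
  have hμ : D'.r - D.r ∈ F.H := (F.mem_H_module _).2 fun y => by
    have m1 := h.isSectionOn.2 y (hU y.2).1
    have m2 := h'.isSectionOn.2 y (hU y.2).2
    have e1 := α.eval_add_smul (Z := fun z => R' z + (-1 : ℝ) • R z) m2 m1 rfl
    rw [h.eval_eq_one y (hU y.2).1, h'.eval_eq_one y (hU y.2).2] at e1
    have e2 := (hα.eval_eq_zero_iff
      (add_mem m2 (Submodule.smul_mem _ (-1 : ℝ) m1))).1 (e1.trans (by norm_num))
    rw [hD y, hD' y, neg_one_smul, ← sub_eq_add_neg] at e2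
    exact e2
  have e := ReebDatum.eq_of_parallel hp hp' (μ := ⟨_, hμ⟩) (add_sub_cancel _ _).symm
  rw [hD ⟨x, hxU⟩, hD' ⟨x, hxU⟩, e]

end LocalReeb

theorem IsContactForm.exists_localReeb (hα : IsContactForm H α) (hH : IsGeneric H) (x : M) :
    ∃ (O : Opens M) (R : VField M), x ∈ O ∧ LocalReeb H α O R := by
  obtain ⟨U, hx, ⟨F⟩⟩ := hH.exists_frame x
  have hr2 := Rep.ext (F.b 2)
  have hd (y : U) : F.b 2 y ∈ derived H (y : M) := by
    rw [F.derived_eq]; exact Submodule.subset_span (by simp [-map_zero, -map_one])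
  have hb : IsSectionOn (derived H) (U : Set M) (extField U (F.b 2)) := hr2.isSectionOn hd
  obtain ⟨w, hw⟩ := exists_repFn (U := U) (hα.1 U _ U.isOpen hb)
  have hw0 (y : U) : w y ≠ 0 := fun h => by
    rw [← hw y, hα.eval_eq_zero_iff (hb.2 y y.2), hr2 y, F.mem_H_iff_c, F.c_b] at h
    simpa using congrArg (fun t : ℝ => t) h.1
  -- With w = α(b₂), the coefficient a = 1/w of b₂ is what makes α(r) = 1.
  obtain ⟨a, ha⟩ := FnRing.exists_inv hw0
  have ha' (y : U) : a y * w y = 1 := congrArg (fun f : FnRing U => f y) ha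
  obtain ⟨r, h3, h4, h2, hp⟩ := F.exists_parallel a w (by rw [mul_comm]; exact ha)
  set D := F.datum r w h3 h4 (h2 ▸ by rw [mul_comm]; exact ha) with hD
  have hR : Rep (extField U r) D.r := Rep.ext r
  refine ⟨U, extField U r, hx, hR.isSectionOn D.r_mem_derived, fun y hy => ?_, fun y hy =>
    (parallel_iff_nablaGr hH hR).1 hp ⟨y, hy⟩⟩
  obtain ⟨h, hh⟩ : ∃ h : F.H, (h : FieldModule U) = F.c 0 r • F.b 0 + F.c 1 r • F.b 1 :=
    ⟨⟨_, F.H.add_mem (F.H.smul_mem _ F.b_zero_mem) (F.H.smul_mem _ F.b_one_mem)⟩, rfl⟩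
  have rm := Rep.ext (h : FieldModule U)
  have m1 : extField U (h : FieldModule U) y ∈ H y := by
    rw [rm ⟨y, hy⟩]; exact F.coe_mem h ⟨y, hy⟩
  have e := F.apply_eq r ⟨y, hy⟩
  rw [h3, h4, h2] at e
  have e1 := α.eval_add_smul (V := extField U (h : FieldModule U))
    (W := extField U (F.b 2)) (Z := extField U r) (x := y) (a := a ⟨y, hy⟩)
    (H_le_derived hH y m1) (hb.2 y hy) (by
      rw [rm ⟨y, hy⟩, hr2 ⟨y, hy⟩, hR ⟨y, hy⟩, hh]
      refine e.trans ?_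
      change _ + (0 : ℝ) • _ + (0 : ℝ) • _ = _
      rw [zero_smul, zero_smul, add_zero, add_zero]
      rfl)
  rw [(hα.eval_eq_zero_iff (H_le_derived hH y m1)).2 m1, hw ⟨y, hy⟩, ha', zero_add] at e1
  exact e1

/-- Local uniqueness makes the diagonal choice agree with each local Reeb field on its whole domain,
so it is smooth and parallel. -/
theorem IsContactForm.existsUnique_isReebField (hα : IsContactForm H α) (hH : IsGeneric H) :
    ∃! R : VField M, IsReebField H α R := by
  choose O R hx hR using hα.exists_localReeb hH
  have h (x : M) : LocalReeb H α (O x) (fun y => R y y) :=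
    (hR x).congr hα hH fun y hy => (hR y).unique (hR x) hα hH (hx y) hy
  refine ⟨fun y => R y y, ⟨⟨fun x _ => ?_, fun x _ => (h x).isSectionOn.2 x (hx x)⟩,
    fun x => (h x).eval_eq_one x (hx x), fun x => (h x).nablaGr_eq_zero x (hx x)⟩, ?_⟩
  · exact (SmoothField.contMDiffAt (h x).isSectionOn.1 (O x).isOpen (hx x)).contMDiffWithinAt
  · intro R' hR'
    exact funext fun x => (isReebField_iff.1 hR').unique (hR x) hα hH trivial (hx x)

theorem IsContactForm.isReebField (hα : IsContactForm H α) (hH : IsGeneric H) :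
    IsReebField H α (reebField H α) :=
  Classical.epsilon_spec (hα.existsUnique_isReebField hH).exists

end Reeb

/-! ### Smoothness of tensors tested on smooth fields -/

section HomBundle

variable {M : Type*} [TopologicalSpace M] [ChartedSpace E5 M] [IsManifold (𝓡 5) ∞ M]

variable {F₂ : Type*} [NormedAddCommGroup F₂] [NormedSpace ℝ F₂] {E₂ : M → Type*}
  [TopologicalSpace (TotalSpace F₂ E₂)] [∀ x, AddCommGroup (E₂ x)] [∀ x, Module ℝ (E₂ x)]
  [∀ x, TopologicalSpace (E₂ x)] [FiberBundle F₂ E₂] [VectorBundle ℝ F₂ E₂]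
  [∀ x, IsTopologicalAddGroup (E₂ x)] [∀ x, ContinuousSMul ℝ (E₂ x)]

theorem clm_eq_sum (L : E5 →L[ℝ] F₂) :
    L = ∑ i, (ContinuousLinearMap.smulRightL ℝ E5 F₂ (EuclideanSpace.proj i))
      (L (EuclideanSpace.basisFun (Fin 5) ℝ i)) := by
  ext v
  conv_lhs => rw [← (EuclideanSpace.basisFun (Fin 5) ℝ).sum_repr v]
  simp

/-- A field of linear maps from the tangent spaces to the fibres of a vector bundle is smooth if
it maps smooth fields to smooth sections. -/
theorem contMDiffAt_of_apply (φ : (x : M) → TangentSpace (𝓡 5) x →L[ℝ] E₂ x) (x₀ : M)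
    (h : ∀ (U : Set M) (V : VField M), IsOpen U → x₀ ∈ U → SmoothField U V →
      ContMDiffAt (𝓡 5) ((𝓡 5).prod 𝓘(ℝ, F₂)) ∞ (fun x => TotalSpace.mk' F₂ x (φ x (V x))) x₀) :
    ContMDiffAt (𝓡 5) ((𝓡 5).prod 𝓘(ℝ, E5 →L[ℝ] F₂)) ∞
      (fun x => TotalSpace.mk' (E5 →L[ℝ] F₂)
        (E := fun y : M => TangentSpace (𝓡 5) y →L[ℝ] E₂ y) x (φ x)) x₀ := by
  rw [contMDiffAt_hom_bundle]
  refine ⟨contMDiffAt_id, ?_⟩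
  set e₁ := trivializationAt E5 (TangentSpace (𝓡 5) : M → Type _) x₀ with he₁
  set e₂ := trivializationAt F₂ E₂ x₀ with he₂
  have hx₁ : x₀ ∈ e₁.baseSet := FiberBundle.mem_baseSet_trivializationAt' x₀
  have hx₂ : x₀ ∈ e₂.baseSet := FiberBundle.mem_baseSet_trivializationAt' x₀
  have key (c : E5) : ContMDiffAt (𝓡 5) 𝓘(ℝ, F₂) ∞
      (fun x => ContinuousLinearMap.inCoordinates E5 (TangentSpace (𝓡 5)) F₂ E₂ x₀ x x₀ x (φ x) c)
      x₀ := by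
    have h1 := (contMDiffAt_section (IB := 𝓡 5) _).1
      (h e₁.baseSet _ e₁.open_baseSet hx₁ (smoothField_trivializationAt x₀ c))
    refine h1.congr_of_eventuallyEq ?_
    filter_upwards [e₁.open_baseSet.mem_nhds hx₁, e₂.open_baseSet.mem_nhds hx₂] with y hy₁ hy₂
    rw [ContinuousLinearMap.inCoordinates_eq hy₁ hy₂]
    simp only [ContinuousLinearMap.comp_apply, ContinuousLinearEquiv.coe_coe]
    rw [Trivialization.continuousLinearEquivAt_apply]
    rfl
  -- A linear map out of ℝ⁵ is recovered smoothly from its values on the standard basis.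
  have h2 : ContMDiffAt (𝓡 5) 𝓘(ℝ, E5 →L[ℝ] F₂) ∞ (fun x => ∑ i,
      (ContinuousLinearMap.smulRightL ℝ E5 F₂ (EuclideanSpace.proj i))
      (ContinuousLinearMap.inCoordinates E5 (TangentSpace (𝓡 5)) F₂ E₂ x₀ x x₀ x (φ x)
        (EuclideanSpace.basisFun (Fin 5) ℝ i))) x₀ := by
    refine contMDiffAt_finsetSum fun i _ => ?_
    exact ContMDiffAt.clm_apply contMDiffAt_const (key _)
  refine h2.congr_of_eventuallyEq (Filter.Eventually.of_forall fun x => ?_)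
  exact clm_eq_sum _

theorem exists_opens_inter {x : M} {O U : Set M} (hO : O ∈ 𝓝 x) (hU : IsOpen U) (hx : x ∈ U) :
    ∃ W : Opens M, x ∈ W ∧ (W : Set M) ⊆ O ∧ (W : Set M) ⊆ U := by
  obtain ⟨O', hO', hO'', hx'⟩ := mem_nhds_iff.1 hO
  exact ⟨⟨O', hO''⟩ ⊓ ⟨U, hU⟩, ⟨hx', hx⟩, fun y hy => hO' hy.1, fun y hy => hy.2⟩

theorem isSmoothOneForm_of_apply {θ : OneForm M}
    (h : ∀ x : M, ∃ O ∈ 𝓝 x, ∀ (U : Opens M) (V : VField M), x ∈ U → (U : Set M) ⊆ O →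
      SmoothField (U : Set M) V → ContMDiffAt (𝓡 5) 𝓘(ℝ, ℝ) ∞ (fun y => θ y (V y)) x) :
    IsSmoothOneForm θ := fun x => by
  refine contMDiffAt_of_apply (E₂ := fun _ : M => ℝ) θ x fun U V hU hx hV => ?_
  obtain ⟨O, hO, hOV⟩ := h x
  obtain ⟨W, hxW, hWO, hWU⟩ := exists_opens_inter hO hU hx
  exact (contMDiffAt_section (IB := 𝓡 5) _).2 (hOV W V hxW hWO (hV.mono hWU))

theorem isSmoothBilin_of_apply {g : BilinField M}
    (h : ∀ x : M, ∃ O ∈ 𝓝 x, ∀ (U : Opens M) (V W : VField M), x ∈ U → (U : Set M) ⊆ O →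
      SmoothField (U : Set M) V → SmoothField (U : Set M) W →
      ContMDiffAt (𝓡 5) 𝓘(ℝ, ℝ) ∞ (fun y => g y (V y) (W y)) x) :
    IsSmoothBilin g := fun x => by
  refine contMDiffAt_of_apply (E₂ := fun y : M => TangentSpace (𝓡 5) y →L[ℝ] ℝ) g x
    fun U V hU hx hV => ?_
  refine contMDiffAt_of_apply (E₂ := fun _ : M => ℝ) (fun y => g y (V y)) x
    fun U' Z hU' hx' hZ => ?_
  obtain ⟨O, hO, hOV⟩ := h x
  obtain ⟨W, hxW, hWO, hWU⟩ := exists_opens_inter hO (hU.inter hU') ⟨hx, hx'⟩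
  exact (contMDiffAt_section (IB := 𝓡 5) _).2 (hOV W V Z hxW hWO (hV.mono fun y hy => (hWU hy).1)
    (hZ.mono fun y hy => (hWU hy).2))

end HomBundle

/-! ### Orthogonality relations for the algebraic metric -/

section DatumForms

variable {A L : Type*} [CommRing A] [LieRing L] [Module A L] [LieRingModule L A]
  [LieRinehartRing A L]

namespace ReebDatum

variable {H : Submodule A L} (D : ReebDatum H)

theorem θ_of_decomp {X : L} {h k : H} {f : A} (e : X = ⁅D.r, (h : L)⁆ + f • D.r + k) :
    D.θ X = f := by
  rw [e]; simp

theorem G_swap (ζ ζ' : L) : D.G ζ ζ' = D.G ζ' ζ := by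
  simp only [G]; ring

theorem G_sum {n : ℕ} (b : Module.Basis (Fin n) A L) (ζ ζ' : L) :
    D.G ζ ζ' = ∑ i, ∑ j, D.G (b i) (b j) * b.repr ζ i * b.repr ζ' j := by
  let B : L →ₗ[A] L →ₗ[A] A := LinearMap.mk₂ A D.G
    (by intros; simp only [G, map_add, LinearMap.add_apply]; ring)
    (by intros; simp only [G, map_smul, LinearMap.smul_apply, smul_eq_mul]; ring)
    (by intros; simp only [G, map_add, LinearMap.add_apply]; ring)
    (by intros; simp only [G, map_smul, LinearMap.smul_apply, smul_eq_mul]; ring)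
  change B ζ ζ' = ∑ i, ∑ j, B (b i) (b j) * b.repr ζ i * b.repr ζ' j
  conv_lhs => rw [← b.sum_repr ζ, ← b.sum_repr ζ']
  simp only [map_sum, map_smul, LinearMap.sum_apply, LinearMap.smul_apply, smul_eq_mul,
    Finset.mul_sum]
  rw [Finset.sum_comm]
  exact Finset.sum_congr rfl fun i _ => Finset.sum_congr rfl fun j _ => by ring

theorem θ_sum {n : ℕ} (b : Module.Basis (Fin n) A L) (ζ : L) :
    D.θ ζ = ∑ i, D.θ (b i) * b.repr ζ i := by
  conv_lhs => rw [← b.sum_repr ζ]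
  rw [map_sum]
  exact Finset.sum_congr rfl fun i _ => by rw [map_smul, smul_eq_mul, mul_comm]

theorem proj_mem (h : H) : D.proj h = (10 : A) • h := by
  have : D.pr (h : L) = h := by ext; simp
  rw [proj_apply, D.z_mem, this]
  simp [Phi, curv, nab, Psi]

theorem proj_r : D.proj D.r = 0 := by
  have : D.pr D.r = 0 := by ext; simp [pr_apply]
  rw [proj_apply, D.z_r, this]
  simp [Phi, curv, nab, Psi]

/-- A complement of `H` in the orthogonal complement of `r`, isotropic for the metric. -/
def compl (h : H) : L := (10 : A) • ⁅D.r, (h : L)⁆ - D.proj ⁅D.r, (h : L)⁆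

theorem z_compl (h : H) : D.z (D.compl h) = (10 : A) • h := by simp [compl]

theorem θ_compl (h : H) : D.θ (D.compl h) = 0 := by simp [compl]

/-- `proj` has values in H and is multiplication by 10 there, so 10 X - proj X lies in its kernel.
-/
theorem proj_compl (h : H) : D.proj (D.compl h) = 0 := by
  rw [compl, map_sub, map_smul, proj_mem, sub_self]

theorem G_mem_mem (h k : H) : D.G h k = 0 := by simp [G]

theorem G_r_r : D.G D.r D.r = -40 := by simp [G]

theorem G_r_mem (h : H) : D.G D.r h = 0 := by simp [G, proj_r]

theorem G_r_compl (h : H) : D.G D.r (D.compl h) = 0 := by simp [G, proj_r, θ_compl]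

theorem G_compl_compl (h k : H) : D.G (D.compl h) (D.compl k) = 0 := by
  simp [G, proj_compl, θ_compl]

theorem G_compl_mem (h k : H) : D.G (D.compl h) k = -(300 * D.skew h k) := by
  simp [G, proj_mem, z_compl]
  ring

end ReebDatum

end DatumForms

/-! ### Signature from two hyperbolic planes and a negative line -/

section OrthogonalBasis

variable {E : Type*} [AddCommGroup E] [Module ℝ E] [TopologicalSpace E] [IsTopologicalAddGroup E]
  [ContinuousSMul ℝ E]

theorem exists_basis_of_orthonormal (hE : Module.finrank ℝ E = 5) (g : E →L[ℝ] E →L[ℝ] ℝ)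
    {b : Fin 5 → E}
    (key : ∀ i j, g (b i) (b j) = if i = j then (if i < 2 then 1 else -1) else 0) :
    ∃ b : Module.Basis (Fin 5) ℝ E, ∀ i j : Fin 5,
      g (b i) (b j) = if i = j then (if i < 2 then 1 else -1) else 0 := by
  have hli : LinearIndependent ℝ b := by
    refine Fintype.linearIndependent_iff.2 fun a ha j => ?_
    have h : g (∑ i, a i • b i) (b j) = 0 := by rw [ha]; simp
    simp only [map_sum, map_smul, sum_apply, smul_apply,
      key, smul_eq_mul, mul_ite, mul_zero, Finset.sum_ite_eq', Finset.mem_univ, if_true] at h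
    split_ifs at h <;> linarith
  exact ⟨basisOfLinearIndependentOfCardEqFinrank hli (by rw [hE]; simp), fun i j => by
    rw [coe_basisOfLinearIndependentOfCardEqFinrank, key]⟩

/-- Two hyperbolic pairs and a negative vector give an orthonormal basis of signature `(2, 3)`. -/
theorem exists_orthonormal_basis (hE : Module.finrank ℝ E = 5) (g : E →L[ℝ] E →L[ℝ] ℝ)
    (hg : ∀ v w, g v w = g w v) {u v r p q : E} (huu : g u u = 0)
    (hvv : g v v = 0) (huv : g u v = 0) (hpp : g p p = 0) (hqq : g q q = 0) (hpq : g p q = 0)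
    (hup : g u p = 1) (hvq : g v q = 1) (huq : g u q = 0) (hvp : g v p = 0)
    (hrr : g r r = -(4 / 3)) (hru : g r u = 0) (hrv : g r v = 0) (hrp : g r p = 0)
    (hrq : g r q = 0) :
    ∃ b : Module.Basis (Fin 5) ℝ E, ∀ i j : Fin 5,
      g (b i) (b j) = if i = j then (if i < 2 then 1 else -1) else 0 := by
  have hvu := (hg v u).trans huv
  have hqp := (hg q p).trans hpq
  have hpu := (hg p u).trans hup
  have hqv := (hg q v).trans hvq
  have hqu := (hg q u).trans huq
  have hpv := (hg p v).trans hvp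
  have hur := (hg u r).trans hru
  have hvr := (hg v r).trans hrv
  have hpr := (hg p r).trans hrp
  have hqr := (hg q r).trans hrq
  -- Sums and differences of hyperbolic pairs have square ±2, and r has square -4/3; s and t
  -- normalize them.
  obtain ⟨s, hs⟩ : ∃ s : ℝ, s * s = 1 / 2 := ⟨√(1 / 2), Real.mul_self_sqrt (by norm_num)⟩
  obtain ⟨t, ht⟩ : ∃ t : ℝ, t * t = 3 / 4 := ⟨√(3 / 4), Real.mul_self_sqrt (by norm_num)⟩
  refine exists_basis_of_orthonormal hE g
    (b := ![s • (u + p), s • (v + q), t • r, s • (u - p), s • (v - q)]) fun i j => ?_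
  fin_cases i <;> fin_cases j <;>
    simp [huu, hvv, huv, hpp, hqq, hpq, hup, hvq, huq, hvp, hrr, hru, hrv, hrp, hrq, hvu, hqp,
      hpu, hqv, hqu, hpv, hur, hvr, hpr, hqr] <;> linarith [hs, ht]

end OrthogonalBasis

/-! ### The canonical extension -/

section Extension

variable {M : Type*} [TopologicalSpace M] [ChartedSpace E5 M] [IsManifold (𝓡 5) ∞ M]
  {H : Distrib M} {U U' : Opens M} {α : PartialForm H} {R : VField M} {Θ : OneForm M}

theorem Frame.exists_apply_eq (F : Frame H U) (y : U) (v : TangentSpace (𝓡 5) (y : M)) :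
    ∃ V : FieldModule U, V y = v := by
  refine ⟨∑ i, (FnRing.const ((F.B y).repr v i) : FnRing U) • F.b i, ?_⟩
  rw [FieldModule.sum_apply]
  conv_rhs => rw [← (F.B y).sum_repr v]
  simp only [F.B_apply]
  rfl

/-- Evaluation of smooth functions at a point. -/
def FnRing.evalHom (y : U) : FnRing U →+* ℝ := (Pi.evalRingHom _ y).comp (FnRing U).subtype

variable {F : Frame H U} {D : ReebDatum F.H}

/-- Restricting the splitting of V for D gives a splitting for D', whose r-coefficient must be θ'.
-/
theorem θ_restr (hR : Rep R D.r) (h : U' ≤ U) {F' : Frame H U'} {D' : ReebDatum F'.H}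
    (hR' : Rep R D'.r) (V : FieldModule U) (y : U') :
    D'.θ (FieldModule.restr h V) y = D.θ V ⟨y, h y.2⟩ := by
  obtain ⟨f, hf⟩ := exists_repFn (SmoothFn.mono (fn_smooth (D.θ V)) h)
  have hr : FieldModule.restr h D.r = D'.r := (hR.restr h).unique hR'
  have mem (k : F.H) : FieldModule.restr h (k : FieldModule U) ∈ F'.H :=
    (F'.mem_H_module _).2 fun z => F.coe_mem k ⟨z, h z.2⟩
  have e : FieldModule.restr h V = ⁅D'.r, FieldModule.restr h (D.z V : FieldModule U)⁆ + f • D'.r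
      + FieldModule.restr h (D.pr V : FieldModule U) := by
    rw [← hr, ← restr_lie]
    refine Subtype.ext (funext fun z => ?_)
    have e1 : V ⟨z, h z.2⟩ = ⁅D.r, (D.z V : FieldModule U)⁆ ⟨z, h z.2⟩
        + D.θ V ⟨z, h z.2⟩ • D.r ⟨z, h z.2⟩ + (D.pr V : FieldModule U) ⟨z, h z.2⟩ := by
      conv_lhs => rw [D.decomp V]
      rfl
    have e2 : f z = D.θ V ⟨z, h z.2⟩ := (hf z).symm.trans
      (extFn_apply (U := U) (D.θ V).1 ⟨(z : M), h z.2⟩)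
    rw [← e2] at e1
    exact e1
  have e3 := D'.θ_of_decomp (h := ⟨_, mem (D.z V)⟩) (k := ⟨_, mem (D.pr V)⟩) e
  rw [e3, ← hf y]
  exact extFn_apply (U := U) (D.θ V).1 ⟨(y : M), h y.2⟩

instance t2Space_tangentSpace (x : M) : T2Space (TangentSpace (𝓡 5) x) :=
  inferInstanceAs (T2Space E5)

/-- The value of the form of a Reeb datum at a point. -/
def thetaAt (D : ReebDatum F.H) (y : U) : TangentSpace (𝓡 5) (y : M) →L[ℝ] ℝ :=
  LinearMap.toContinuousLinearMap (∑ i, D.θ (F.b i) y • (F.B y).coord i)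

theorem thetaAt_apply (y : U) (V : FieldModule U) : thetaAt D y (V y) = D.θ V y := by
  have h2 : D.θ V y = ∑ i, D.θ (F.b i) y * F.c i V y := by
    have := congrArg (FnRing.evalHom y) (D.θ_sum F.b V)
    rw [map_sum] at this
    exact this
  rw [h2, thetaAt, LinearMap.coe_toContinuousLinearMap', LinearMap.sum_apply]
  exact Finset.sum_congr rfl fun i _ => by
    rw [LinearMap.smul_apply, Module.Basis.coord_apply, F.repr_eq, smul_eq_mul]

theorem isThetaAt_thetaAt (hR : Rep R D.r) (y : U) : IsThetaAt H R y (thetaAt D y) where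
  apply_mem v hv := by
    obtain ⟨h, rfl⟩ := F.exists_eq y hv
    rw [thetaAt_apply, D.θ_mem]
    rfl
  apply_self := by
    rw [hR y, thetaAt_apply, D.θ_r]
    rfl
  apply_lie γ hγ := by
    obtain ⟨U', hU', hy', v, -, hv, -, hv', -, -⟩ := exists_rep_two y hγ hγ Filter.univ_mem
    obtain ⟨D', hD'⟩ := exists_datum_restr hR hU'
    obtain ⟨V, hV⟩ := F.exists_apply_eq y (mlieBracket (𝓡 5) R γ y)
    have h1 : FieldModule.restr hU' V ⟨y, hy'⟩ = ⁅D'.r, v⁆ ⟨y, hy'⟩ :=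
      hV.trans (hD'.lie hv ⟨y, hy'⟩)
    have h2 := congrArg (thetaAt D' ⟨y, hy'⟩) h1
    rw [thetaAt_apply, thetaAt_apply, θ_restr hR hU' hD',
      D'.θ_lie ⟨v, ((F.restr hU').mem_H_module v).2 hv'⟩] at h2
    rw [← hV, thetaAt_apply]
    exact h2

theorem IsThetaAt.unique (hH : IsGeneric H) {x : M} (hR : IsSectionOn (derived H) Set.univ R)
    {l l' : TangentSpace (𝓡 5) x →L[ℝ] ℝ} (hl : IsThetaAt H R x l) (hl' : IsThetaAt H R x l')
    (hne : ∀ y, R y ∉ H y) : l = l' := by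
  obtain ⟨U, hx, ⟨F⟩⟩ := hH.exists_frame x
  obtain ⟨D, hD⟩ := F.exists_datum (hR.mono (Set.subset_univ _)) fun y _ => hne y
  ext v
  obtain ⟨V, rfl⟩ := F.exists_apply_eq ⟨x, hx⟩ v
  rw [hl.apply_eq (y := ⟨x, hx⟩) hD, hl'.apply_eq (y := ⟨x, hx⟩) hD]

theorem IsReebField.notMem (hα : IsContactForm H α) (hR : IsReebField H α R) (x : M) :
    R x ∉ H x := fun h => by
  have h1 := hR.2.1 x
  rw [(hα.eval_eq_zero_iff (hR.1.2 x trivial)).2 h] at h1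
  exact zero_ne_one h1

theorem IsCanonicalExtension.reebPair (hH : IsGeneric H) (hα : IsContactForm H α)
    (hR : IsReebField H α R) (hΘ : IsCanonicalExtension H α R Θ) : ReebPair H R Θ where
  isSectionOn := hR.1
  apply_mem x v hv := by
    rw [hΘ.2.1 x ⟨v, H_le_derived hH x hv⟩]
    exact (hα.apply_eq_zero_iff ⟨v, H_le_derived hH x hv⟩).2 hv
  apply_self x := by
    rw [hΘ.2.1 x ⟨R x, hR.1.2 x trivial⟩]
    exact (α.eval_eq (hR.1.2 x trivial)).symm.trans (hR.2.1 x)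
  dOne_eq_zero := hΘ.2.2

/-- Smoothness is automatic: on smooth fields the form equals the θ of a local datum, whose values
are smooth functions. It extends α since T⁻² is H plus the line of R. -/
theorem isCanonicalExtension_of_isThetaAt (hH : IsGeneric H) (hα : IsContactForm H α)
    (hR : IsReebField H α R) (hΘ : ∀ x, IsThetaAt H R x (Θ x)) :
    IsCanonicalExtension H α R Θ := by
  refine ⟨isSmoothOneForm_of_apply fun x => ?_, fun x v => ?_, fun x γ hγ => ?_⟩
  · obtain ⟨U, hx, ⟨F⟩⟩ := hH.exists_frame x
    refine ⟨U, U.isOpen.mem_nhds hx, fun W V hxW hWU hV => ?_⟩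
    obtain ⟨D, hD⟩ := (F.restr hWU).exists_datum (hR.1.mono (Set.subset_univ _))
      fun y _ => hR.notMem hα y
    obtain ⟨v, hv⟩ := exists_rep hV
    have h : RepFn (fun y => Θ y (V y)) (D.θ v) := fun y => by
      beta_reduce
      rw [hv y, (hΘ y).apply_eq hD]
    exact ContMDiffOn.contMDiffAt h.smoothFn (W.isOpen.mem_nhds hxW)
  · have hr := hR.1.2 x trivial
    have h1 : α x ⟨R x, hr⟩ = 1 := (α.eval_eq hr).symm.trans (hR.2.1 x)
    have h2 : α x (v - α x v • ⟨R x, hr⟩) = 0 := by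
      rw [map_sub, map_smul, h1, smul_eq_mul, mul_one, sub_self]
    have h3 := (hΘ x).apply_mem _ ((hα.apply_eq_zero_iff _).1 h2)
    rw [Submodule.coe_sub, Submodule.coe_smul, map_sub, map_smul, (hΘ x).apply_self] at h3
    simpa [sub_eq_zero] using h3
  · rw [dOne_eq_neg (fun y => (hΘ y).apply_mem) (fun y => (hΘ y).apply_self) hγ,
      (hΘ x).apply_lie γ hγ, neg_zero]

theorem IsContactForm.existsUnique_isCanonicalExtension (hH : IsGeneric H)
    (hα : IsContactForm H α) (hR : IsReebField H α R) :
    ∃! Θ : OneForm M, IsCanonicalExtension H α R Θ := by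
  have hex (x : M) : ∃ l, IsThetaAt H R x l := by
    obtain ⟨U, hx, ⟨F⟩⟩ := hH.exists_frame x
    obtain ⟨D, hD⟩ := F.exists_datum (hR.1.mono (Set.subset_univ _)) fun y _ => hR.notMem hα y
    exact ⟨thetaAt D ⟨x, hx⟩, isThetaAt_thetaAt hD ⟨x, hx⟩⟩
  choose Θ hΘ using hex
  refine ⟨Θ, isCanonicalExtension_of_isThetaAt hH hα hR hΘ, fun Θ' hΘ' => funext fun x => ?_⟩
  exact ((hΘ'.reebPair hH hα hR).isThetaAt x).unique hH hR.1 (hΘ x) (hR.notMem hα)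

theorem IsContactForm.isCanonicalExtension (hα : IsContactForm H α) (hH : IsGeneric H) :
    IsCanonicalExtension H α (reebField H α) (extension H α) :=
  Classical.epsilon_spec (hα.existsUnique_isCanonicalExtension hH (hα.isReebField hH)).exists

theorem IsContactForm.reebPair (hα : IsContactForm H α) (hH : IsGeneric H) :
    ReebPair H (reebField H α) (extension H α) :=
  (hα.isCanonicalExtension hH).reebPair hH hα (hα.isReebField hH)

end Extension

/-! ### The associated metric and its signature -/

section Metric

variable {M : Type*} [TopologicalSpace M] [ChartedSpace E5 M] [IsManifold (𝓡 5) ∞ M]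
  {H : Distrib M} {U U' : Opens M} {α : PartialForm H} {F : Frame H U} {D : ReebDatum F.H}

/-- The value of the metric of a Reeb datum at a point. -/
def metricAt (D : ReebDatum F.H) (y : U) :
    TangentSpace (𝓡 5) (y : M) →L[ℝ] TangentSpace (𝓡 5) (y : M) →L[ℝ] ℝ :=
  ∑ i, ∑ j, ((1 / 30 : ℝ) * D.G (F.b i) (F.b j) y) •
    (LinearMap.toContinuousLinearMap ((F.B y).coord i)).smulRight
      (LinearMap.toContinuousLinearMap ((F.B y).coord j))

theorem metricAt_apply (y : U) (V W : FieldModule U) :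
    metricAt D y (V y) (W y) = (1 / 30 : ℝ) * D.G V W y := by
  have h : D.G V W y = ∑ i, ∑ j, D.G (F.b i) (F.b j) y * F.c i V y * F.c j W y := by
    have := congrArg (FnRing.evalHom y) (D.G_sum F.b V W)
    simp only [map_sum] at this
    exact this
  rw [h, Finset.mul_sum, metricAt, sum_apply, sum_apply]
  refine Finset.sum_congr rfl fun i _ => ?_
  rw [Finset.mul_sum, sum_apply, sum_apply]
  refine Finset.sum_congr rfl fun j _ => ?_
  rw [smul_apply, smul_apply,
    ContinuousLinearMap.smulRight_apply, smul_apply,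
    LinearMap.coe_toContinuousLinearMap', LinearMap.coe_toContinuousLinearMap',
    Module.Basis.coord_apply, Module.Basis.coord_apply, F.repr_eq, F.repr_eq, smul_eq_mul,
    smul_eq_mul]
  ring

/-- The fields may exist only on a smaller set. There the formula is tensorial, so they may be
replaced by fields on all of U with the same values at y. -/
theorem metricFormula_metricAt (hH : IsGeneric H)
    (P : ReebPair H (reebField H α) (extension H α)) (hR : Rep (reebField H α) D.r) (y : U)
    {Z Z' : VField M} (hZ : IsLocalVField (y : M) Z) (hZ' : IsLocalVField (y : M) Z') :
    metricAt D y (Z y) (Z' y) = metricFormula H α Z Z' y := by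
  obtain ⟨U', hU', hy', v, w, hv, hw, -, -, -⟩ := exists_rep_two y hZ hZ' Filter.univ_mem
  obtain ⟨D', hD'⟩ := exists_datum_restr hR hU'
  obtain ⟨V, hV⟩ := F.exists_apply_eq y (Z y)
  obtain ⟨W, hW⟩ := F.exists_apply_eq y (Z' y)
  have h1 := metricFormula_eq hH P hD' hv hw ⟨y, hy'⟩
  have h2 := metricFormula_eq hH P hR (Rep.ext V) (Rep.ext W) y
  have h3 := metricFormula_eq hH P hD' ((Rep.ext V).restr hU') ((Rep.ext W).restr hU') ⟨y, hy'⟩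
  have e1 : FieldModule.restr hU' V ⟨y, hy'⟩ = v ⟨y, hy'⟩ := hV.trans (hv ⟨y, hy'⟩)
  have e2 : FieldModule.restr hU' W ⟨y, hy'⟩ = w ⟨y, hy'⟩ := hW.trans (hw ⟨y, hy'⟩)
  have h4 := metricAt_apply (D := D') ⟨y, hy'⟩ (FieldModule.restr hU' V) (FieldModule.restr hU' W)
  rw [e1, e2, metricAt_apply] at h4
  rw [← hV, ← hW, metricAt_apply, ← h2]
  exact h3.trans (h4.symm.trans h1.symm)

theorem SmoothField.isLocalVField {O : Set M} {V : VField M} (h : SmoothField O V) (hO : IsOpen O)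
    {x : M} (hx : x ∈ O) : IsLocalVField x V :=
  ⟨O, hO, hx, h, fun _ _ => trivial⟩

theorem IsContactForm.existsUnique_isAssociatedMetric (hα : IsContactForm H α) (hH : IsGeneric H) :
    ∃! g : BilinField M, IsAssociatedMetric H α g := by
  have P := hα.reebPair hH
  have hex (x : M) : ∃ g : TangentSpace (𝓡 5) x →L[ℝ] TangentSpace (𝓡 5) x →L[ℝ] ℝ,
      ∀ ζ ζ' : VField M, IsLocalVField x ζ → IsLocalVField x ζ' →
        g (ζ x) (ζ' x) = metricFormula H α ζ ζ' x := by
    obtain ⟨U, hx, ⟨F⟩⟩ := hH.exists_frame x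
    obtain ⟨D, hD⟩ := P.exists_datum F
    exact ⟨metricAt D ⟨x, hx⟩, fun ζ ζ' hζ hζ' => metricFormula_metricAt hH P hD ⟨x, hx⟩ hζ hζ'⟩
  choose g hg using hex
  refine ⟨g, hg, fun g' hg' => funext fun x => ?_⟩
  ext v w
  obtain ⟨O, V, hO, hx, hV, rfl⟩ := exists_smooth_field_eq x v
  obtain ⟨O', W, hO', hx', hW, rfl⟩ := exists_smooth_field_eq x w
  rw [hg' x V W (hV.isLocalVField hO hx) (hW.isLocalVField hO' hx'),
    hg x V W (hV.isLocalVField hO hx) (hW.isLocalVField hO' hx')]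

theorem IsContactForm.isAssociatedMetric (hα : IsContactForm H α) (hH : IsGeneric H) :
    IsAssociatedMetric H α (metric H α) :=
  Classical.epsilon_spec (hα.existsUnique_isAssociatedMetric hH).exists

theorem IsContactForm.metric_apply (hα : IsContactForm H α) (hH : IsGeneric H)
    (hR : Rep (reebField H α) D.r) (V W : FieldModule U) (y : U) :
    metric H α y (V y) (W y) = (1 / 30 : ℝ) * D.G V W y := by
  have h (V : FieldModule U) : IsLocalVField (y : M) (extField U V) :=
    SmoothField.isLocalVField (field_smooth V) U.isOpen y.2
  have h1 := hα.isAssociatedMetric hH y _ _ (h V) (h W)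
  rw [metricFormula_eq hH (hα.reebPair hH) hR (Rep.ext V) (Rep.ext W) y, extField_apply,
    extField_apply] at h1
  exact h1

theorem IsContactForm.isMetricTwoThree (hα : IsContactForm H α) (hH : IsGeneric H) :
    IsMetricTwoThree (metric H α) := by
  have P := hα.reebPair hH
  have hsymm (x : M) (v w : TangentSpace (𝓡 5) x) : metric H α x v w = metric H α x w v := by
    obtain ⟨U, hx, ⟨F⟩⟩ := hH.exists_frame x
    obtain ⟨D, hD⟩ := P.exists_datum F
    obtain ⟨V, rfl⟩ := F.exists_apply_eq ⟨x, hx⟩ v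
    obtain ⟨W, rfl⟩ := F.exists_apply_eq ⟨x, hx⟩ w
    exact (hα.metric_apply hH hD V W ⟨x, hx⟩).trans
      ((congrArg (fun f : FnRing U => (1 / 30 : ℝ) * f ⟨x, hx⟩) (D.G_swap V W)).trans
        (hα.metric_apply hH hD W V ⟨x, hx⟩).symm)
  refine ⟨isSmoothBilin_of_apply fun x => ?_, hsymm, fun x => ?_⟩
  · obtain ⟨U, hx, ⟨F⟩⟩ := hH.exists_frame x
    refine ⟨U, U.isOpen.mem_nhds hx, fun O V W hxO hOU hV hW => ?_⟩
    obtain ⟨D, hD⟩ := P.exists_datum (F.restr hOU)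
    obtain ⟨v, hv⟩ := exists_rep hV
    obtain ⟨w, hw⟩ := exists_rep hW
    have h : RepFn (fun y => metric H α y (V y) (W y))
        ((FnRing.const (1 / 30) : FnRing O) * D.G v w) := fun y => by
      beta_reduce
      rw [hv y, hw y, hα.metric_apply hH hD]
      rfl
    exact ContMDiffOn.contMDiffAt h.smoothFn (O.isOpen.mem_nhds hxO)
  · obtain ⟨U, hx, ⟨F⟩⟩ := hH.exists_frame x
    obtain ⟨D, hD⟩ := P.exists_datum F
    have key {V W : FieldModule U} {a : FnRing U} (h : D.G V W = a) :
        metric H α x (V ⟨x, hx⟩) (W ⟨x, hx⟩) = (1 / 30 : ℝ) * a ⟨x, hx⟩ := by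
      rw [← h]; exact hα.metric_apply hH hD V W ⟨x, hx⟩
    have key0 {V W : FieldModule U} (h : D.G V W = 0) :
        metric H α x (V ⟨x, hx⟩) (W ⟨x, hx⟩) = 0 := (key h).trans (mul_zero _)
    refine exists_orthonormal_basis (finrank_tangentSpace x) (metric H α x) (hsymm x)
      (u := D.compl D.e₁ ⟨x, hx⟩) (v := D.compl D.e₂ ⟨x, hx⟩) (r := D.r ⟨x, hx⟩)
      -- The metric pairs `compl h` with k as -10 `skew h k`; this fixes the factors and signs of p
      -- and q.
      (p := (-(1 / 10) : ℝ) • (D.e₂ : FieldModule U) ⟨x, hx⟩)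
      (q := (1 / 10 : ℝ) • (D.e₁ : FieldModule U) ⟨x, hx⟩)
      (key0 (D.G_compl_compl _ _)) (key0 (D.G_compl_compl _ _)) (key0 (D.G_compl_compl _ _))
      ?_ ?_ ?_ ?_ ?_ ?_ ?_ ?_ (key0 (D.G_r_compl _)) (key0 (D.G_r_compl _)) ?_ ?_
    · rw [map_smul, map_smul, smul_apply, key0 (D.G_mem_mem _ _)]; simp
    · rw [map_smul, map_smul, smul_apply, key0 (D.G_mem_mem _ _)]; simp
    · rw [map_smul, map_smul, smul_apply, key0 (D.G_mem_mem _ _)]; simp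
    · rw [map_smul, key (a := -300) (by rw [D.G_compl_mem, D.skew_frame, mul_one])]
      change (-(1 / 10) : ℝ) * ((1 / 30 : ℝ) * (-300 : ℝ)) = 1
      norm_num
    · rw [map_smul, key (a := 300)
        (by rw [D.G_compl_mem, D.skew_swap, D.skew_frame, mul_neg, mul_one, neg_neg])]
      change (1 / 10 : ℝ) * ((1 / 30 : ℝ) * (300 : ℝ)) = 1
      norm_num
    · rw [map_smul, key0 (by rw [D.G_compl_mem, D.skew_self, mul_zero, neg_zero]), smul_zero]
    · rw [map_smul, key0 (by rw [D.G_compl_mem, D.skew_self, mul_zero, neg_zero]), smul_zero]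
    · rw [key D.G_r_r]
      change (1 / 30 : ℝ) * (-40 : ℝ) = _
      norm_num
    · rw [map_smul, key0 (D.G_r_mem _), smul_zero]
    · rw [map_smul, key0 (D.G_r_mem _), smul_zero]

end Metric

/-! ### Conformal covariance and independence of the contact form -/

section Rescale

variable {M : Type*} [TopologicalSpace M] [ChartedSpace E5 M] [IsManifold (𝓡 5) ∞ M]
  {H : Distrib M} {U : Opens M} {α β : PartialForm H} {u : M → ℝ}

/-- Nowhere zero functions have logarithmic derivatives. -/
theorem exists_log_deriv (hu : SmoothFn (U : Set M) u) (h0 : ∀ y ∈ U, u y ≠ 0) {u' : FnRing U}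
    (hu' : RepFn u u') : ∃ f : FnRing U, ∀ X : FieldModule U, ⁅X, u'⁆ = u' * ⁅X, f⁆ := by
  -- `Real.log` is log |u|, so negative u is covered; this is needed because two contact forms may
  -- differ by a negative factor.
  have hlog : SmoothFn (U : Set M) (Real.log ∘ u) := fun y hy =>
    ((Real.contDiffAt_log.2 (h0 y hy)).contMDiffAt.comp y
      (ContMDiffOn.contMDiffAt hu (U.isOpen.mem_nhds hy))).contMDiffWithinAt
  obtain ⟨f, hf⟩ := exists_repFn hlog
  refine ⟨f, fun X => Subtype.ext (funext fun y => ?_)⟩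
  have h1 := (Rep.ext X).deriv hu' y
  have h2 := (Rep.ext X).deriv hf y
  beta_reduce at h1 h2
  have hd := (Real.hasDerivAt_log (h0 y y.2)).differentiableAt
  have h3 : mvfderiv (𝓡 5) (Real.log ∘ u) y (extField U X y)
      = (u y)⁻¹ * mvfderiv (𝓡 5) u y (extField U X y) := by
    rw [mvfderiv_comp_apply (y : M) hd.mdifferentiableAt
      (hu.mdifferentiableAt U.isOpen y.2)]
    change mfderiv 𝓘(ℝ, ℝ) 𝓘(ℝ, ℝ) Real.log (u y) _ = _
    rw [mfderiv_eq_fderiv, (Real.hasDerivAt_log (h0 y y.2)).hasFDerivAt.fderiv]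
    exact mul_comm (mvfderiv (𝓡 5) u y (extField U X y)) (u y)⁻¹
  change ⁅X, u'⁆ y = u' y * ⁅X, f⁆ y
  rw [← h1, ← h2, h3, ← hu' y, mul_inv_cancel_left₀ (h0 y y.2)]

/-- Since α takes the value 1 on both u r_β and r_α, their difference is a section μ of H. This
supplies the `Rescaling` to which `G_eq` applies. -/
theorem metric_rescale (hH : IsGeneric H) (hα : IsContactForm H α) (hβ : IsContactForm H β)
    (hu : ContMDiff (𝓡 5) 𝓘(ℝ, ℝ) ∞ u) (h0 : ∀ x, u x ≠ 0) (hαβ : ∀ x, β x = u x • α x) (x : M) :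
    metric H β x = u x ^ 2 • metric H α x := by
  obtain ⟨U, hx, ⟨F⟩⟩ := hH.exists_frame x
  have hRα := hα.isReebField hH
  have hRβ := hβ.isReebField hH
  obtain ⟨D, hD, hp⟩ := (isReebField_iff.1 hRα).exists_parallel hα hH F le_top
  obtain ⟨D', hD', hp'⟩ := (isReebField_iff.1 hRβ).exists_parallel hβ hH F le_top
  have huU : SmoothFn (U : Set M) u := hu.contMDiffOn
  obtain ⟨u', hu'⟩ := exists_repFn huU
  obtain ⟨v', hv'⟩ := FnRing.exists_inv (f := u') fun y => by rw [← hu' y]; exact h0 y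
  obtain ⟨f, hf⟩ := exists_log_deriv huU (fun y _ => h0 y) hu'
  have hμ : u' • D'.r - D.r ∈ F.H := (F.mem_H_module _).2 fun y => by
    have m1 := hRα.1.2 y trivial
    have m2 := hRβ.1.2 y trivial
    have a1 : α y ⟨reebField H α y, m1⟩ = 1 := (α.eval_eq m1).symm.trans (hRα.2.1 y)
    have a2 : u y * α y ⟨reebField H β y, m2⟩ = 1 := by
      have h := (β.eval_eq m2).symm.trans (hRβ.2.1 y)
      rw [hαβ] at h
      exact h
    have h3 : α y (u y • ⟨reebField H β y, m2⟩ - ⟨reebField H α y, m1⟩) = 0 := by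
      rw [map_sub, map_smul, a1, smul_eq_mul, a2, sub_self]
    have h4 := (hα.apply_eq_zero_iff _).1 h3
    rw [Submodule.coe_sub, Submodule.coe_smul, hu' y] at h4
    dsimp only at h4
    rw [hD y, hD' y] at h4
    exact h4
  have S : Rescaling D D' u' v' f ⟨_, hμ⟩ :=
    { mul_eq_one := by rw [mul_comm]; exact hv'
      lie_u := hf
      r_eq := by
        rw [add_sub_cancel, smul_smul, hv', one_smul] }
  ext v w
  obtain ⟨V, rfl⟩ := F.exists_apply_eq ⟨x, hx⟩ v
  obtain ⟨W, rfl⟩ := F.exists_apply_eq ⟨x, hx⟩ w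
  have e := S.G_eq hp (S.skew_μ hp hp') V W
  have e1 := congrArg (fun f : FnRing U => (1 / 30 : ℝ) * f ⟨x, hx⟩) e
  refine (hβ.metric_apply hH hD' V W ⟨x, hx⟩).trans (e1.trans ?_)
  rw [smul_apply, smul_apply,
    hα.metric_apply hH hD V W ⟨x, hx⟩, hu' ⟨x, hx⟩]
  change (1 / 30 : ℝ) * (u' ⟨x, hx⟩ ^ 2 * D.G V W ⟨x, hx⟩) = u' ⟨x, hx⟩ ^ 2 * _
  ring

theorem IsContactForm.expSmul (hα : IsContactForm H α) {f : M → ℝ}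
    (hf : ContMDiff (𝓡 5) 𝓘(ℝ, ℝ) ∞ f) : IsContactForm H (expSmul f α) := by
  refine ⟨fun O V hO hV => ?_, fun x => ?_⟩
  · have h1 : ContMDiff (𝓡 5) 𝓘(ℝ, ℝ) ∞ fun x => Real.exp (f x) :=
      Real.contDiff_exp.contMDiff.comp hf
    refine (h1.contMDiffOn.mul (hα.1 O V hO hV)).congr fun y hy => ?_
    refine (PartialForm.eval_eq _ (hV.2 y hy)).trans ?_
    change Real.exp (f y) * α y ⟨V y, _⟩ = Real.exp (f y) * α.eval V y
    rw [α.eval_eq (hV.2 y hy)]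
  · rw [← hα.2 x]
    exact LinearMap.ker_smul _ _ (Real.exp_pos _).ne'

/-- Both forms have kernel H in T⁻², so they are proportional, with factor β evaluated on the Reeb
field of α. -/
theorem exists_factor (hH : IsGeneric H) (hα : IsContactForm H α) (hβ : IsContactForm H β) :
    ∃ u : M → ℝ, ContMDiff (𝓡 5) 𝓘(ℝ, ℝ) ∞ u ∧ (∀ x, u x ≠ 0) ∧ ∀ x, β x = u x • α x := by
  have hR := hα.isReebField hH
  refine ⟨β.eval (reebField H α), contMDiffOn_univ.1 (hβ.1 _ _ isOpen_univ hR.1), fun x h => ?_,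
    fun x => ?_⟩
  · exact hR.notMem hα x ((hβ.eval_eq_zero_iff (hR.1.2 x trivial)).1 h)
  · ext v
    have hr := hR.1.2 x trivial
    have h1 : α x ⟨reebField H α x, hr⟩ = 1 := (α.eval_eq hr).symm.trans (hR.2.1 x)
    have h2 : α x (v - α x v • ⟨reebField H α x, hr⟩) = 0 := by
      rw [map_sub, map_smul, h1, smul_eq_mul, mul_one, sub_self]
    have h3 := (hβ.apply_eq_zero_iff _).2 ((hα.apply_eq_zero_iff _).1 h2)
    rw [map_sub, map_smul, sub_eq_zero] at h3
    rw [h3, LinearMap.smul_apply, β.eval_eq hr, smul_eq_mul, smul_eq_mul, mul_comm]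

theorem conformalClass_subset (hH : IsGeneric H) (hα : IsContactForm H α)
    (hβ : IsContactForm H β) :
    conformalClass (metric H β) ⊆ conformalClass (metric H α) := by
  obtain ⟨u, hu, h0, hαβ⟩ := exists_factor hH hα hβ
  rintro g ⟨w, hw, hw0, hg⟩
  refine ⟨fun x => w x * (u x * u x), hw.mul (hu.mul hu), fun x =>
    mul_pos (hw0 x) (mul_self_pos.2 (h0 x)), fun x => ?_⟩
  rw [hg, metric_rescale hH hα hβ hu h0 hαβ, smul_smul, pow_two]

end Rescale

end GenericRankTwo

end

theorem mainTheorem1 {M : Type*} [TopologicalSpace M] [T2Space M] [SecondCountableTopology M]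
    [ChartedSpace GenericRankTwo.E5 M] [IsManifold (𝓡 5) ∞ M]
    (H : GenericRankTwo.Distrib M) (hH : GenericRankTwo.IsGeneric H) :
    -- every generalized contact form has a Reeb field, a canonical extension and a metric
    (∀ α : GenericRankTwo.PartialForm H, GenericRankTwo.IsContactForm H α →
      (∃! r : GenericRankTwo.VField M, GenericRankTwo.IsReebField H α r) ∧
      (∃! θ : GenericRankTwo.OneForm M,
        GenericRankTwo.IsCanonicalExtension H α (GenericRankTwo.reebField H α) θ) ∧
      (∃! g : GenericRankTwo.BilinField M, GenericRankTwo.IsAssociatedMetric H α g) ∧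
      GenericRankTwo.IsMetricTwoThree (GenericRankTwo.metric H α)) ∧
    -- rescaling the generalized contact form
    (∀ α : GenericRankTwo.PartialForm H, GenericRankTwo.IsContactForm H α →
      ∀ f : M → ℝ, ContMDiff (𝓡 5) 𝓘(ℝ, ℝ) ∞ f →
        GenericRankTwo.IsContactForm H (GenericRankTwo.expSmul f α) ∧
        ∀ x : M, GenericRankTwo.metric H (GenericRankTwo.expSmul f α) x =
          Real.exp (2 * f x) • GenericRankTwo.metric H α x) ∧
    -- the conformal class is independent of the generalized contact form
    (∀ α β : GenericRankTwo.PartialForm H,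
      GenericRankTwo.IsContactForm H α → GenericRankTwo.IsContactForm H β →
        GenericRankTwo.conformalClass (GenericRankTwo.metric H α) =
          GenericRankTwo.conformalClass (GenericRankTwo.metric H β)) := by
  refine ⟨fun α hα => ⟨hα.existsUnique_isReebField hH,
    hα.existsUnique_isCanonicalExtension hH (hα.isReebField hH),
    hα.existsUnique_isAssociatedMetric hH, hα.isMetricTwoThree hH⟩,
    fun α hα f hf => ⟨hα.expSmul hf, fun x => ?_⟩, fun α β hα hβ =>
    (GenericRankTwo.conformalClass_subset hH hβ hα).antisymm
      (GenericRankTwo.conformalClass_subset hH hα hβ)⟩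
  rw [GenericRankTwo.metric_rescale hH hα (hα.expSmul hf) (u := fun x => Real.exp (f x))
    (Real.contDiff_exp.contMDiff.comp hf) (fun x => (Real.exp_pos _).ne') (fun x => rfl) x, two_mul,
    Real.exp_add, pow_two]
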